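/- Let $d\ge 1$ and let $\Omega\subset\mathbb C^{d+1}$ be a bounded pseudoconvex domain with $C^\infty$ boundary, of finite type in the sense of D'Angelo at every boundary point, whose Levi form has rank at least $d-1$ at every boundary point. Let $u_n\in\Omega$ be a sequence converging to a point $u_\infty\in\partial\Omega$, and let $r$ be a smooth local defining function of $\Omega$ on an open neighbourhood $W$ of $u_\infty$ (that is, $\Omega\cap W=\{z\in W: r(z)<0\}$ and $dr\neq 0$ on $\{r=0\}\cap W$). Write coordinates of $\mathbb C^{d+1}$ as $\zeta=(\zeta_0,\dots,\zeta_d)$, and for $P:\mathbb C\to\mathbb R$ put $$r_P(\zeta)=\operatorname{Re}\zeta_0+P(\zeta_1)+\sum_{\alpha=2}^d|\zeta_\alpha|^2 .$$ A *scaling* along $(u_n)$ means a sequence of biholomorphic maps $\psi_n:\mathbb C^{d+1}\to\mathbb C^{d+1}$ (onto) and numbers $\varepsilon_n>0$, $\varepsilon_n\to0$, such that every compact subset of $\mathbb C^{d+1}$ is contained in $\psi_n(W)$ for all large $n$ and $\psi_n(u_n)\to(-1,0,\dots,0)$. A *model polynomial* is a subharmonic real-valued polynomial $P(\zeta)=\sum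 c_{jk}\zeta^j\bar\zeta^k$ on $\mathbb C$ without harmonic terms ($c_{j0}=c_{0j}=0$ for $j\ge1$) and with $P(0)=0$. (a) There are a scaling $(\psi_n,\varepsilon_n)$ along $(u_n)$ and a model polynomial $P$ such that $\frac1{\varepsilon_n}\,r\circ\psi_n^{-1}\to r_P$ locally uniformly on $\mathbb C^{d+1}$. (b) Moreover, there is a scaling $(\psi_n,\varepsilon_n)$ along $(u_n)$ such that every subsequence of $(n)$ has a further subsequence along which $\frac1{\varepsilon_n}\,r\circ\psi_n^{-1}\to r_P$ locally uniformly on $\mathbb C^{d+1}$ for some model polynomial $P$ that is not identically zero (equivalently, $\Delta P\not\equiv0$) and has degree at most the D'Angelo type of $\partial\Omega$ at $u_\infty$. -/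

import Mathlib

open Set Filter Topology Complex
open scoped ENNReal ContDiff

namespace CorankOne

noncomputable section

/-- The space `ℂ^{d+1}` with coordinates `z 0, z 1, …, z d`. -/
abbrev Cspace (d : ℕ) : Type := EuclideanSpace ℂ (Fin (d + 1))

/-- A biholomorphic map of `ℂ^{d+1}` onto itself. -/
def IsBiholomorphic {d : ℕ} (ψ : Cspace d ≃ Cspace d) : Prop :=
  Differentiable ℂ ψ ∧ Differentiable ℂ ψ.symm

/-! ### Defining functions and the Levi form -/

/-- The operator `∂/∂z_j = (1/2) (∂/∂x_j - i ∂/∂y_j)`. -/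
def dz {d : ℕ} (j : Fin (d + 1)) (f : Cspace d → ℂ) (z : Cspace d) : ℂ :=
  (1 / 2) * (fderiv ℝ f z (EuclideanSpace.single j 1)
    - I * fderiv ℝ f z (EuclideanSpace.single j I))

/-- The operator `∂/∂z̄_j = (1/2) (∂/∂x_j + i ∂/∂y_j)`. -/
def dzbar {d : ℕ} (j : Fin (d + 1)) (f : Cspace d → ℂ) (z : Cspace d) : ℂ :=
  (1 / 2) * (fderiv ℝ f z (EuclideanSpace.single j 1)
    + I * fderiv ℝ f z (EuclideanSpace.single j I))

/-- `r` is a smooth defining function of `Ω` on the open set `W`: on `W` the set `Ω` is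
`{r < 0}`, and `dr ≠ 0` wherever `r = 0`. -/
structure IsDefiningFunctionOn {d : ℕ} (Ω W : Set (Cspace d)) (r : Cspace d → ℝ) : Prop where
  isOpen : IsOpen W
  smooth : ContDiffOn ℝ ∞ r W
  mem_iff : ∀ z ∈ W, z ∈ Ω ↔ r z < 0
  fderiv_ne_zero : ∀ z ∈ W, r z = 0 → fderiv ℝ r z ≠ 0

/-- The boundary of `Ω` is smooth of class `C^∞`. -/
def HasSmoothBoundary {d : ℕ} (Ω : Set (Cspace d)) : Prop :=
  ∀ p ∈ frontier Ω, ∃ (W : Set (Cspace d)) (r : Cspace d → ℝ),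
    p ∈ W ∧ IsDefiningFunctionOn Ω W r

/-- The complex tangent space `{X : ∑ j, ∂r/∂z_j(p) X_j = 0}`. -/
def complexTangent {d : ℕ} (r : Cspace d → ℝ) (p : Cspace d) : Submodule ℂ (Cspace d) where
  carrier := {X | ∑ j, dz j (fun w => (r w : ℂ)) p * X j = 0}
  zero_mem' := by simp
  add_mem' := by
    intro X Y hX hY
    simp only [mem_ofPred_eq] at hX hY ⊢
    simp [mul_add, Finset.sum_add_distrib, hX, hY]
  smul_mem' := by
    intro c X hX
    simp only [mem_ofPred_eq] at hX ⊢
    have : ∀ j, dz j (fun w => (r w : ℂ)) p * (c • X) j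
        = c * (dz j (fun w => (r w : ℂ)) p * X j) := by
      intro j
      simp only [PiLp.smul_apply, smul_eq_mul]
      ring
    simp only [this, ← Finset.mul_sum, hX, mul_zero]

/-- The mixed second derivative `∂²r/∂z_j∂z̄_k` at `p`. -/
def complexHessian {d : ℕ} (r : Cspace d → ℝ) (p : Cspace d) (j k : Fin (d + 1)) : ℂ :=
  dz j (dzbar k (fun w => (r w : ℂ))) p

/-- The sesquilinear form `∂∂̄r(p)[X, Ȳ] = ∑ j k, ∂²r/∂z_j∂z̄_k(p) X_j conj(Y_k)`. -/
def ddbar {d : ℕ} (r : Cspace d → ℝ) (p : Cspace d) :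
    Cspace d →ₗ[ℂ] Cspace d →ₗ⋆[ℂ] ℂ :=
  LinearMap.mk₂'ₛₗ (RingHom.id ℂ) (starRingEnd ℂ)
    (fun X Y => ∑ j, ∑ k, complexHessian r p j k * X j * starRingEnd ℂ (Y k))
    (by
      intro X X' Y
      simp [mul_add, add_mul, Finset.sum_add_distrib])
    (by
      intro c X Y
      simp only [PiLp.smul_apply, smul_eq_mul, RingHom.id_apply, Finset.mul_sum]
      refine Finset.sum_congr rfl fun j _ => Finset.sum_congr rfl fun k _ => ?_
      ring)
    (by
      intro X Y Y'
      simp [mul_add, Finset.sum_add_distrib])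
    (by
      intro c X Y
      simp only [PiLp.smul_apply, smul_eq_mul, map_mul, Finset.mul_sum]
      refine Finset.sum_congr rfl fun j _ => Finset.sum_congr rfl fun k _ => ?_
      ring)

/-- The Levi form of the hypersurface `{r = 0}` at `p`: the restriction of `∂∂̄r(p)` to the
complex tangent space. -/
def leviForm {d : ℕ} (r : Cspace d → ℝ) (p : Cspace d) :
    complexTangent r p →ₗ[ℂ] complexTangent r p →ₗ⋆[ℂ] ℂ :=
  (ddbar r p).domRestrict₁₂ (complexTangent r p) (complexTangent r p)

/-- The rank of the Levi form. -/
def leviRank {d : ℕ} (r : Cspace d → ℝ) (p : Cspace d) : ℕ :=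
  Module.finrank ℂ (LinearMap.range (leviForm r p))

/-- (Levi) pseudoconvexity of a smoothly bounded set: the Levi form of every local defining
function is positive semidefinite at every boundary point. -/
def IsPseudoconvex {d : ℕ} (Ω : Set (Cspace d)) : Prop :=
  ∀ (W : Set (Cspace d)) (r : Cspace d → ℝ), IsDefiningFunctionOn Ω W r →
    ∀ p ∈ frontier Ω ∩ W, ∀ X : complexTangent r p, 0 ≤ (leviForm r p X X).re

/-- The Levi form has rank at least `d - 1` at every boundary point. -/
def HasLeviCorankAtMostOne {d : ℕ} (Ω : Set (Cspace d)) : Prop :=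
  ∀ (W : Set (Cspace d)) (r : Cspace d → ℝ), IsDefiningFunctionOn Ω W r →
    ∀ p ∈ frontier Ω ∩ W, d - 1 ≤ leviRank r p

/-! ### Finite type in the sense of D'Angelo -/

/-- The order of vanishing at `0` of a function of one complex variable, that is the supremum
of all `k` with `f(t) = O(|t|^k)` as `t → 0`. -/
def vanishingOrder {F : Type*} [NormedAddCommGroup F] (f : ℂ → F) : ℝ≥0∞ :=
  ⨆ (k : ℕ) (_ : f =O[𝓝 0] fun t : ℂ => ‖t‖ ^ k), (k : ℝ≥0∞)

/-- The D'Angelo type at `p` of the hypersurface `{r = 0}`: the supremum of the ratios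
`ν(r ∘ γ) / ν(γ - p)` over all nonconstant germs at `0` of holomorphic curves `γ` with
`γ(0) = p`, where `ν` is the order of vanishing at `0`. -/
def dAngeloType {d : ℕ} (r : Cspace d → ℝ) (p : Cspace d) : ℝ≥0∞ :=
  ⨆ (γ : ℂ → Cspace d) (_ : AnalyticAt ℂ γ 0 ∧ γ 0 = p ∧ ¬ ∀ᶠ t in 𝓝 0, γ t = p),
    vanishingOrder (fun t => r (γ t)) / vanishingOrder (fun t => γ t - p)

/-- Every boundary point is of finite type in the sense of D'Angelo. -/
def IsOfFiniteType {d : ℕ} (Ω : Set (Cspace d)) : Prop :=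
  ∀ (W : Set (Cspace d)) (r : Cspace d → ℝ), IsDefiningFunctionOn Ω W r →
    ∀ p ∈ frontier Ω ∩ W, dAngeloType r p < ⊤

/-! ### The limit model -/

/-- The value at `ζ` of the polynomial `∑ c_{jk} ζ^j ζ̄^k` in `ζ` and `ζ̄`. -/
def polyValue (c : ℕ × ℕ →₀ ℂ) (ζ : ℂ) : ℂ :=
  c.sum fun m a => a * ζ ^ m.1 * (starRingEnd ℂ ζ) ^ m.2

/-- Subharmonicity on `ℂ` of a real-valued function: upper semicontinuity and the sub-mean value
inequality on all circles. -/
def IsSubharmonic (P : ℂ → ℝ) : Prop :=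
  UpperSemicontinuous P ∧ ∀ (a : ℂ) (ρ : ℝ), 0 < ρ → P a ≤ Real.circleAverage P a ρ

/-- `P : ℂ → ℝ` is a subharmonic polynomial, with coefficients `c`, that has no harmonic terms
(no terms `c_{j0} ζ^j` or `c_{0j} ζ̄^j` with `j ≥ 1`) and vanishes at `0`. -/
structure IsModelPolynomial (c : ℕ × ℕ →₀ ℂ) (P : ℂ → ℝ) : Prop where
  eq_polyValue : ∀ ζ, (P ζ : ℂ) = polyValue c ζ
  subharmonic : IsSubharmonic P
  no_harmonic_terms : ∀ j : ℕ, 1 ≤ j → c (j, 0) = 0 ∧ c (0, j) = 0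
  map_zero : P 0 = 0

/-- `r_P(ζ) = Re ζ_0 + P(ζ_1) + ∑_{α = 2}^d |ζ_α|²` (for `d ≥ 1`). -/
def modelFunction {d : ℕ} (P : ℂ → ℝ) (ζ : Cspace d) : ℝ :=
  (ζ 0).re + P (ζ 1) + ∑ α ∈ Finset.univ.filter (fun α : Fin (d + 1) => 2 ≤ (α : ℕ)), ‖ζ α‖ ^ 2

/-- `(ψ_n)`, `(ε_n)` rescale `r` (defined on `W`) along `(u_n)`: the `ψ_n` are biholomorphic maps
of `ℂ^{d+1}`, `ε_n → 0⁺`, every compact set lies in `ψ_n(W)` for all large `n`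
(so that `r ∘ ψ_n⁻¹` is eventually defined there), and `ψ_n(u_n) → (-1, 0, …, 0)`. -/
structure IsScaling {d : ℕ} (W : Set (Cspace d)) (u : ℕ → Cspace d)
    (ψ : ℕ → Cspace d ≃ Cspace d) (ε : ℕ → ℝ) : Prop where
  biholomorphic : ∀ n, IsBiholomorphic (ψ n)
  pos : ∀ n, 0 < ε n
  tendsto_zero : Tendsto ε atTop (𝓝 0)
  exhaust : ∀ K : Set (Cspace d), IsCompact K → ∀ᶠ n in atTop, K ⊆ ψ n '' W
  tendsto_base : Tendsto (fun n => ψ n (u n)) atTop (𝓝 (EuclideanSpace.single 0 (-1)))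

/-- The rescaled function `(1/ε) r ∘ ψ⁻¹`. -/
def rescaled {d : ℕ} (r : Cspace d → ℝ) (ψ : Cspace d ≃ Cspace d) (ε : ℝ) (ζ : Cspace d) : ℝ :=
  1 / ε * r (ψ.symm ζ)

end

end CorankOne

namespace CorankOne

section

/-! ### Jets of functions of one complex variable -/

/-! Near p = `u_∞` the Levi form is bounded below on d - 1 complex tangent directions, and only one
tangential direction e_1 is uncontrolled. Each u_n is moved by ε_n times a fixed transversal vector
to a boundary point q_n. A linear frame at q_n straightens ∂r(q_n). Through q_n runs a polynomial
holomorphic curve, with coordinate z in the direction e_1, along which r and the derivatives ∂r in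
the directions e_α + η_α(z) e_0 have only mixed monomials z^j z̄^k (j, k ≥ 1) up to order N:
`exists_normal_curve`. It is built degree by degree (`IsAdapted.noPure_step`): the e_0-component of
each new coefficient removes the pure terms of r, inverting the Levi form on e_2, …, e_d removes the
antiholomorphic terms of the derivatives, and η_α removes their holomorphic terms. Everything is
uniform in n because the data range over compact sets.

Dilating with weights (ε, τ, √ε, …, √ε) and expanding r to second order around the curve
(`tendsto_rescaled`) gives limits of the form Re ζ_0 + Re A(ζ_1) + 2 Re ∑ ζ_α B_α(ζ_1) + ∑ |ζ_α|²,
where A and B_α have only mixed monomials. A quadratic change of coordinates has removed the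
holomorphic part of the Hessian. For (a) the zero polynomial is enough: take N = 1, where no mixed
monomials exist, and τ = ε.

For (b), N is the integer part of the type at p. If the mixed coefficients of r along the curves
tended to zero on a subsequence, a limit curve would have contact of order N + 1 with the boundary,
which exceeds the type; hence they are bounded below (`NormalData.exists_coeff_lower_bound`).
Choosing τ_n so that the sum of the absolute values of all rescaled coefficients of r and of its
derivatives is 1 then forces τ_n^N = O(ε_n). So the remainder of order N + 1 disappears and
compactness supplies convergent subsequences.

It remains to see B_α = 0 and A ≠ 0 subharmonic. Pseudoconvexity survives in the limit
(`sub_mean_of_tendsto`): on each slice ζ_* = v the function Re(A + 2 ∑ v_α B_α) satisfies the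
sub-mean value inequality. As v is arbitrary and the inequality is real-affine in v, each B_α has
the mean value property. A polynomial with only mixed monomials and this property is zero. The case
v = 0 gives subharmonicity of Re A, and the normalisation then leaves A ≠ 0. The passage to the
limit rests on a touching argument: if the inequality failed, a holomorphic disc pushed outwards by
a multiple of |t|² would stay in {r ≤ 0} and touch the boundary, against `fderiv_le_zero_of_curve`.
-/

/-- The monomial `z^j z̄^k`. -/
noncomputable def monom (m : ℕ × ℕ) (z : ℂ) : ℂ := z ^ m.1 * (starRingEnd ℂ z) ^ m.2

/-- The exponents of degree at most `N`. -/
def jetIndex (N : ℕ) : Finset (ℕ × ℕ) :=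
  (Finset.range (N + 1) ×ˢ Finset.range (N + 1)).filter fun m => m.1 + m.2 ≤ N

/-- The exponents `(j, k)` of degree at most `N` with `j, k ≥ 1`. -/
def mixedIndex (N : ℕ) : Finset (ℕ × ℕ) :=
  (jetIndex N).filter fun m => 1 ≤ m.1 ∧ 1 ≤ m.2

lemma mem_jetIndex {N : ℕ} {m : ℕ × ℕ} : m ∈ jetIndex N ↔ m.1 + m.2 ≤ N := by
  simp only [jetIndex, Finset.mem_filter, Finset.mem_product, Finset.mem_range]
  omega

lemma mem_mixedIndex {N : ℕ} {m : ℕ × ℕ} :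
    m ∈ mixedIndex N ↔ m.1 + m.2 ≤ N ∧ 1 ≤ m.1 ∧ 1 ≤ m.2 := by
  simp only [mixedIndex, Finset.mem_filter, mem_jetIndex]

lemma continuous_monom (m : ℕ × ℕ) : Continuous (monom m) := by
  unfold monom
  fun_prop

lemma monom_ofReal_mul (m : ℕ × ℕ) (t : ℝ) (z : ℂ) :
    monom m (t * z) = (t : ℂ) ^ (m.1 + m.2) * monom m z := by
  simp only [monom, mul_pow, map_mul, conj_ofReal, pow_add]
  ring

lemma sum_jetIndex {N : ℕ} (f : ℕ × ℕ → ℂ) :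
    ∑ m ∈ jetIndex N, f m = ∑ k ∈ Finset.range (N + 1), ∑ m ∈ Finset.HasAntidiagonal.antidiagonal k, f m := by
  rw [Finset.sum_sigma']
  refine Finset.sum_bij' (fun m _ => ⟨m.1 + m.2, m⟩) (fun x _ => x.2) ?_ ?_ ?_ ?_ ?_
  · intro m hm
    simp only [mem_jetIndex] at hm
    simp
    omega
  · rintro ⟨k, m⟩ h
    simp only [Finset.mem_sigma, Finset.mem_range, Finset.HasAntidiagonal.mem_antidiagonal] at h
    simp only [mem_jetIndex]
    omega
  · intro m _; rfl
  · rintro ⟨k, m⟩ h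
    simp only [Finset.mem_sigma, Finset.mem_range, Finset.HasAntidiagonal.mem_antidiagonal] at h
    obtain ⟨_, rfl⟩ := h
    rfl
  · intro m _; rfl

lemma mul_sum_antidiagonal_monom (k : ℕ) (a : ℕ × ℕ → ℂ) (z : ℂ) :
    z * ∑ m ∈ Finset.HasAntidiagonal.antidiagonal k, a m * monom m z =
      ∑ m ∈ Finset.HasAntidiagonal.antidiagonal (k + 1),
        (if m.1 = 0 then 0 else a (m.1 - 1, m.2)) * monom m z := by
  rw [Finset.Nat.sum_antidiagonal_succ, Finset.mul_sum]
  simp only [if_true, zero_mul, zero_add]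
  refine Finset.sum_congr rfl fun m _ => ?_
  simp [monom, pow_succ]
  ring

lemma conj_mul_sum_antidiagonal_monom (k : ℕ) (a : ℕ × ℕ → ℂ) (z : ℂ) :
    starRingEnd ℂ z * ∑ m ∈ Finset.HasAntidiagonal.antidiagonal k, a m * monom m z =
      ∑ m ∈ Finset.HasAntidiagonal.antidiagonal (k + 1),
        (if m.2 = 0 then 0 else a (m.1, m.2 - 1)) * monom m z := by
  rw [Finset.Nat.sum_antidiagonal_succ', Finset.mul_sum]
  simp only [if_true, zero_mul, zero_add]
  refine Finset.sum_congr rfl fun m _ => ?_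
  simp [monom, pow_succ]
  ring

/-- A real multilinear form on the diagonal of a complex line is a homogeneous polynomial in
`z` and `z̄`. -/
lemma exists_multilinear_diag_eq {V : Type*} [NormedAddCommGroup V] [NormedSpace ℝ V]
    (e : ℂ →L[ℝ] V) (h1 : ‖e 1‖ ≤ 1) (hI : ‖e I‖ ≤ 1) (k : ℕ)
    (M : ContinuousMultilinearMap ℝ (fun _ : Fin k => V) ℂ) :
    ∃ a : ℕ × ℕ → ℂ, (∀ m, ‖a m‖ ≤ 2 ^ k * ‖M‖) ∧
      ∀ z : ℂ, M (fun _ => e z) = ∑ m ∈ Finset.HasAntidiagonal.antidiagonal k, a m * monom m z := by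
  induction k with
  | zero =>
    refine ⟨fun _ => M (fun _ => 0), fun m => ?_, fun z => ?_⟩
    · simp
    · simp only [Finset.Nat.antidiagonal_zero, Finset.sum_singleton, monom, pow_zero, mul_one]
      congr 1
      exact Subsingleton.elim _ _
  | succ k ih =>
    obtain ⟨a, ha, ha'⟩ := ih (M.curryLeft (e 1))
    obtain ⟨b, hb, hb'⟩ := ih (M.curryLeft (e I))
    have hM1 : ‖M.curryLeft (e 1)‖ ≤ ‖M‖ := by
      refine (M.curryLeft.le_opNorm _).trans ?_
      rw [ContinuousMultilinearMap.curryLeft_norm]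
      exact mul_le_of_le_one_right (norm_nonneg _) h1
    have hMI : ‖M.curryLeft (e I)‖ ≤ ‖M‖ := by
      refine (M.curryLeft.le_opNorm _).trans ?_
      rw [ContinuousMultilinearMap.curryLeft_norm]
      exact mul_le_of_le_one_right (norm_nonneg _) hI
    have ha2 : ∀ m, ‖a m‖ ≤ 2 ^ k * ‖M‖ := fun m =>
      (ha m).trans (mul_le_mul_of_nonneg_left hM1 (by positivity))
    have hb2 : ∀ m, ‖b m‖ ≤ 2 ^ k * ‖M‖ := fun m =>
      (hb m).trans (mul_le_mul_of_nonneg_left hMI (by positivity))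
    -- Expressing re z and im z through z and z̄ turns re z · a + im z · b into z · p + z̄ · q.
    let p : ℕ × ℕ → ℂ := fun m => (a m - I * b m) / 2
    let q : ℕ × ℕ → ℂ := fun m => (a m + I * b m) / 2
    have hp : ∀ m, ‖p m‖ ≤ 2 ^ k * ‖M‖ := fun m => by
      have := norm_sub_le (a m) (I * b m)
      simp only [norm_mul, norm_I, one_mul] at this
      simp only [p, norm_div, RCLike.norm_ofNat]
      linarith [ha2 m, hb2 m]
    have hq : ∀ m, ‖q m‖ ≤ 2 ^ k * ‖M‖ := fun m => by
      have := norm_add_le (a m) (I * b m)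
      simp only [norm_mul, norm_I, one_mul] at this
      simp only [q, norm_div, RCLike.norm_ofNat]
      linarith [ha2 m, hb2 m]
    refine ⟨fun m => (if m.1 = 0 then 0 else p (m.1 - 1, m.2)) +
      (if m.2 = 0 then 0 else q (m.1, m.2 - 1)), fun m => ?_, fun z => ?_⟩
    · have h0 : 0 ≤ 2 ^ k * ‖M‖ := by positivity
      refine (norm_add_le _ _).trans ?_
      have e1 : ‖(if m.1 = 0 then 0 else p (m.1 - 1, m.2))‖ ≤ 2 ^ k * ‖M‖ := by
        split_ifs
        · simp [h0]
        · exact hp _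
      have e2 : ‖(if m.2 = 0 then 0 else q (m.1, m.2 - 1))‖ ≤ 2 ^ k * ‖M‖ := by
        split_ifs
        · simp [h0]
        · exact hq _
      rw [pow_succ]
      linarith
    · have hz : e z = z.re • e 1 + z.im • e I := by
        rw [← map_smul, ← map_smul, ← map_add]
        congr 1
        simp
      have : M (fun _ => e z) = z.re * M.curryLeft (e 1) (fun _ => e z)
          + z.im * M.curryLeft (e I) (fun _ => e z) := by
        have : M (fun _ => e z) = M.curryLeft (e z) (fun _ => e z) := by
          rw [ContinuousMultilinearMap.curryLeft_apply]
          congr 1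
          funext i
          refine Fin.cases rfl (fun _ => rfl) i
        have h2 : M.curryLeft (e z) = z.re • M.curryLeft (e 1) + z.im • M.curryLeft (e I) := by
          conv_lhs => rw [hz]
          rw [map_add, map_smul, map_smul]
        rw [this, h2]
        simp only [add_apply, smul_apply,
          real_smul]
      rw [this, ha', hb']
      simp only [add_mul, Finset.sum_add_distrib]
      rw [← mul_sum_antidiagonal_monom, ← conj_mul_sum_antidiagonal_monom]
      have e1 : ∑ m ∈ Finset.HasAntidiagonal.antidiagonal k, p m * monom m z =
          (∑ m ∈ Finset.HasAntidiagonal.antidiagonal k, a m * monom m z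
            - I * ∑ m ∈ Finset.HasAntidiagonal.antidiagonal k, b m * monom m z) / 2 := by
        rw [Finset.mul_sum, ← Finset.sum_sub_distrib, Finset.sum_div]
        exact Finset.sum_congr rfl fun m _ => by simp only [p]; ring
      have e2 : ∑ m ∈ Finset.HasAntidiagonal.antidiagonal k, q m * monom m z =
          (∑ m ∈ Finset.HasAntidiagonal.antidiagonal k, a m * monom m z
            + I * ∑ m ∈ Finset.HasAntidiagonal.antidiagonal k, b m * monom m z) / 2 := by
        rw [Finset.mul_sum, ← Finset.sum_add_distrib, Finset.sum_div]
        exact Finset.sum_congr rfl fun m _ => by simp only [q]; ring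
      rw [e1, e2]
      have hre : (z.re : ℂ) = (z + starRingEnd ℂ z) / 2 := by
        rw [add_conj]; simp
      have him : (z.im : ℂ) = -I * (z - starRingEnd ℂ z) / 2 := by
        rw [sub_conj]
        push_cast
        linear_combination (z.im : ℂ) * I_sq
      rw [hre, him]
      ring

/-- Taylor expansion of order `N` in the last, complex, variable, uniform for the other
variables in a compact set. -/
theorem exists_uniform_jet {Θ : Type*} [NormedAddCommGroup Θ] [NormedSpace ℝ Θ]
    {U : Set (Θ × ℂ)} (hU : IsOpen U) {F : Θ × ℂ → ℂ} (hF : ContDiffOn ℝ ∞ F U)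
    {K : Set Θ} (hK : IsCompact K) (hKU : ∀ θ ∈ K, (θ, (0 : ℂ)) ∈ U) (N : ℕ) :
    ∃ C > 0, ∃ δ > 0, ∀ θ ∈ K, ∃ a : ℕ × ℕ → ℂ, (∀ m, ‖a m‖ ≤ C) ∧
      ∀ z : ℂ, ‖z‖ ≤ δ → ‖F (θ, z) - ∑ m ∈ jetIndex N, a m * monom m z‖ ≤ C * ‖z‖ ^ (N + 1) := by
  classical
  obtain ⟨δ, hδ, hδU⟩ : ∃ δ > 0, K ×ˢ Metric.closedBall (0 : ℂ) δ ⊆ U := by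
    obtain ⟨A, B, -, hB, hKA, h0B, hAB⟩ := generalized_tube_lemma hK
      (isCompact_singleton (x := (0 : ℂ))) hU (by
        rintro ⟨θ, z⟩ ⟨h1, h2⟩
        rw [mem_singleton_iff] at h2
        simp only at h2
        subst h2
        exact hKU θ h1)
    obtain ⟨δ, hδ, h⟩ := Metric.nhds_basis_closedBall.mem_iff.1 (hB.mem_nhds (h0B rfl))
    exact ⟨δ, hδ, (prod_mono hKA h).trans hAB⟩
  set D := K ×ˢ Metric.closedBall (0 : ℂ) δ with hD
  have hDc : IsCompact D := hK.prod (isCompact_closedBall 0 δ)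
  have hFat : ∀ x ∈ U, ∀ n : ℕ, ContDiffAt ℝ n F x := fun x hx n =>
    (hF.contDiffAt (hU.mem_nhds hx)).of_le (by exact_mod_cast le_top)
  have hbd : ∀ k : ℕ, ∃ B : ℝ, 0 ≤ B ∧ ∀ x ∈ D, ‖iteratedFDeriv ℝ k F x‖ ≤ B := by
    intro k
    have hc : ContinuousOn (iteratedFDeriv ℝ k F) D := fun x hx =>
      ((hFat x (hδU hx) k).iteratedFDeriv_right (i := k) (m := 0)
        (by simp)).continuousAt.continuousWithinAt
    obtain ⟨B, hB⟩ := hDc.exists_bound_of_continuousOn hc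
    exact ⟨max B 0, le_max_right _ _, fun x hx => (hB x hx).trans (le_max_left _ _)⟩
  choose B hB0 hB using hbd
  let e : ℂ →L[ℝ] Θ × ℂ := ContinuousLinearMap.inr ℝ Θ ℂ
  have he : ∀ z, ‖e z‖ = ‖z‖ := fun z => by simp [e, Prod.norm_def]
  -- One constant serves for the coefficients and for the remainder. The range reaches N + 1 because
  -- the integral remainder involves the derivative of that order, and the factors 2^k come from the
  -- passage to z, z̄ coordinates.
  let C := 1 + ∑ k ∈ Finset.range (N + 2), 2 ^ k * B k
  have hCB : ∀ k < N + 2, 2 ^ k * B k ≤ C := fun k hk => by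
    have := Finset.single_le_sum (N := ℝ) (f := fun k => 2 ^ k * B k)
      (fun i _ => mul_nonneg (by positivity) (hB0 i)) (Finset.mem_range.2 hk)
    simp only [C]
    linarith
  have hC : 0 < C := by
    have : 0 ≤ ∑ k ∈ Finset.range (N + 2), 2 ^ k * B k :=
      Finset.sum_nonneg fun i _ => mul_nonneg (by positivity) (hB0 i)
    simp only [C]
    linarith
  refine ⟨C, hC, δ, hδ, fun θ hθ => ?_⟩
  have h0D : (θ, (0 : ℂ)) ∈ D := ⟨hθ, by simp [hδ.le]⟩
  choose a ha ha' using fun k : ℕ => exists_multilinear_diag_eq e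
    (by rw [he]; simp) (by rw [he]; simp) k (iteratedFDeriv ℝ k F (θ, 0))
  have hfac : ∀ k : ℕ, ‖(((k.factorial : ℝ)⁻¹ : ℝ) : ℂ)‖ ≤ 1 := fun k => by
    rw [norm_real, Real.norm_of_nonneg (by positivity)]
    exact inv_le_one_of_one_le₀ (by exact_mod_cast k.factorial_pos)
  refine ⟨fun m => if m.1 + m.2 ≤ N then
    (((m.1 + m.2).factorial : ℝ)⁻¹ : ℝ) * a (m.1 + m.2) m else 0, fun m => ?_, fun z hz => ?_⟩
  · dsimp only
    split_ifs with hm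
    · rw [norm_mul]
      calc _ ≤ 1 * (2 ^ (m.1 + m.2) * ‖iteratedFDeriv ℝ (m.1 + m.2) F (θ, 0)‖) :=
            mul_le_mul (hfac _) (ha _ _) (norm_nonneg _) zero_le_one
        _ ≤ 2 ^ (m.1 + m.2) * B (m.1 + m.2) := by
            rw [one_mul]
            exact mul_le_mul_of_nonneg_left (hB _ _ h0D) (by positivity)
        _ ≤ C := hCB _ (by omega)
    · simpa using hC.le
  · have hpt : ∀ t ∈ Icc (0 : ℝ) 1, (θ, (0 : ℂ)) + t • e z ∈ D := by
      intro t ht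
      have : (θ, (0 : ℂ)) + t • e z = (θ, t * z) := by simp [e]
      rw [this]
      refine ⟨hθ, ?_⟩
      simp only [mem_closedBall_zero_iff, norm_mul, norm_real, Real.norm_of_nonneg ht.1]
      calc t * ‖z‖ ≤ 1 * ‖z‖ := mul_le_mul_of_nonneg_right ht.2 (norm_nonneg _)
        _ ≤ δ := by simpa using hz
    have key := map_add_eq_sum_add_integral_iteratedFDeriv (f := F) (x := (θ, (0 : ℂ))) (y := e z)
      (n := N) (fun t ht => by exact_mod_cast hFat _ (hδU (hpt t ht)) (N + 1))
    have hsum : ∑ m ∈ jetIndex N, (if m.1 + m.2 ≤ N then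
        (((m.1 + m.2).factorial : ℝ)⁻¹ : ℝ) * a (m.1 + m.2) m else 0) * monom m z =
        ∑ k ∈ Finset.range (N + 1),
          (k.factorial : ℝ)⁻¹ • (iteratedFDeriv ℝ k F (θ, 0) fun _ => e z) := by
      rw [sum_jetIndex]
      refine Finset.sum_congr rfl fun k hk => ?_
      rw [ha', Finset.smul_sum]
      refine Finset.sum_congr rfl fun m hm => ?_
      rw [Finset.HasAntidiagonal.mem_antidiagonal] at hm
      rw [if_pos (by rw [hm]; exact Finset.mem_range_succ_iff.1 hk), hm, real_smul, mul_assoc]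
    have hFz : F (θ, z) = F ((θ, 0) + e z) := by simp [e]
    rw [hsum, hFz, key, add_sub_cancel_left, norm_smul]
    have hint : ‖∫ t in (0 : ℝ)..1, (1 - t) ^ N •
        (iteratedFDeriv ℝ (N + 1) F ((θ, 0) + t • e z) fun _ => e z)‖ ≤
        (B (N + 1) * ‖z‖ ^ (N + 1)) * |1 - 0| := by
      refine intervalIntegral.norm_integral_le_of_norm_le_const fun t ht => ?_
      rw [uIoc_of_le zero_le_one] at ht
      have ht' : t ∈ Icc (0 : ℝ) 1 := ⟨ht.1.le, ht.2⟩
      rw [norm_smul, norm_pow]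
      have h1 : ‖1 - t‖ ^ N ≤ 1 := by
        refine pow_le_one₀ (norm_nonneg _) ?_
        rw [Real.norm_eq_abs, abs_le]
        constructor <;> linarith [ht.1, ht.2]
      have h2 := (iteratedFDeriv ℝ (N + 1) F ((θ, 0) + t • e z)).le_opNorm fun _ => e z
      simp only [he, Finset.prod_const, Finset.card_univ, Fintype.card_fin] at h2
      calc _ ≤ 1 * (‖iteratedFDeriv ℝ (N + 1) F ((θ, 0) + t • e z)‖ * ‖z‖ ^ (N + 1)) :=
            mul_le_mul h1 h2 (norm_nonneg _) zero_le_one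
        _ ≤ _ := by
            rw [one_mul]
            exact mul_le_mul_of_nonneg_right (hB _ _ (hpt t ht')) (by positivity)
    have h3 : ‖((N.factorial : ℝ)⁻¹ : ℝ)‖ ≤ 1 := by
      simpa using hfac N
    have h4 : B (N + 1) ≤ C := by
      refine le_trans ?_ (hCB (N + 1) (by omega))
      exact le_mul_of_one_le_left (hB0 _) (one_le_pow₀ (by norm_num))
    calc _ ≤ 1 * ((B (N + 1) * ‖z‖ ^ (N + 1)) * |1 - 0|) :=
          mul_le_mul h3 hint (norm_nonneg _) zero_le_one
      _ = B (N + 1) * ‖z‖ ^ (N + 1) := by simp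
      _ ≤ _ := mul_le_mul_of_nonneg_right h4 (by positivity)

/-! ### Uniqueness of jets -/

/-- Continuity at 0 kills the constant coefficient. Dividing by X then lowers the order of the bound
by one, which is why only the punctured neighbourhood is assumed. -/
lemma coeff_eq_zero_of_isBigO (k : ℕ) (p : Polynomial ℂ)
    (h : (fun t : ℝ => p.eval (t : ℂ)) =O[𝓝[≠] 0] fun t : ℝ => t ^ (k + 1)) :
    ∀ j ≤ k, p.coeff j = 0 := by
  induction k generalizing p with
  | zero =>
    intro j hj
    obtain rfl : j = 0 := by omega
    have h1 : Tendsto (fun t : ℝ => p.eval (t : ℂ)) (𝓝[≠] 0) (𝓝 0) := by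
      refine h.trans_tendsto ?_
      have : Tendsto (fun t : ℝ => t ^ (0 + 1)) (𝓝 0) (𝓝 (0 ^ (0 + 1))) :=
        (continuous_pow _).tendsto _
      simpa using this.mono_left nhdsWithin_le_nhds
    have h2 : Tendsto (fun t : ℝ => p.eval (t : ℂ)) (𝓝[≠] 0) (𝓝 (p.eval ((0 : ℝ) : ℂ))) :=
      ((p.continuous.comp continuous_ofReal).tendsto 0).mono_left nhdsWithin_le_nhds
    rw [Polynomial.coeff_zero_eq_eval_zero]
    simpa using tendsto_nhds_unique h2 h1
  | succ k ih =>
    have h0 : p.coeff 0 = 0 := by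
      have h1 : Tendsto (fun t : ℝ => p.eval (t : ℂ)) (𝓝[≠] 0) (𝓝 0) := by
        refine h.trans_tendsto ?_
        have : Tendsto (fun t : ℝ => t ^ (k + 1 + 1)) (𝓝 0) (𝓝 (0 ^ (k + 1 + 1))) :=
          (continuous_pow _).tendsto _
        simpa using this.mono_left nhdsWithin_le_nhds
      have h2 : Tendsto (fun t : ℝ => p.eval (t : ℂ)) (𝓝[≠] 0) (𝓝 (p.eval ((0 : ℝ) : ℂ))) :=
        ((p.continuous.comp continuous_ofReal).tendsto 0).mono_left nhdsWithin_le_nhds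
      rw [Polynomial.coeff_zero_eq_eval_zero]
      simpa using tendsto_nhds_unique h2 h1
    have hp : ∀ t : ℂ, p.eval t = p.divX.eval t * t := by
      intro t
      conv_lhs => rw [← p.divX_mul_X_add, h0]
      simp
    have hd : (fun t : ℝ => p.divX.eval (t : ℂ)) =O[𝓝[≠] 0] fun t : ℝ => t ^ (k + 1) := by
      obtain ⟨C, hC⟩ := h.bound
      refine Asymptotics.IsBigO.of_bound C ?_
      filter_upwards [hC, self_mem_nhdsWithin] with t ht ht0
      have ht0' : 0 < ‖t‖ := norm_pos_iff.2 ht0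
      rw [hp, norm_mul, norm_real, pow_succ t (k + 1), norm_mul, ← mul_assoc] at ht
      exact le_of_mul_le_mul_right ht ht0'
    intro j hj
    cases j with
    | zero => exact h0
    | succ j =>
      have := ih p.divX hd j (by omega)
      rwa [Polynomial.coeff_divX] at this

/-- On a ray t ↦ t w the sum is a polynomial in t, so each homogeneous part of degree at most k
vanishes on the unit circle. There multiplication by w^j turns w^(m.1) w̄^(m.2) with m.1 + m.2 = j
into w^(2 m.1), and a one-variable polynomial with infinitely many roots has zero coefficients. -/
lemma jet_coeff_eq_zero {s : Finset (ℕ × ℕ)} {a : ℕ × ℕ → ℂ} {k : ℕ}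
    (h : (fun z : ℂ => ∑ m ∈ s, a m * monom m z) =O[𝓝 0] fun z : ℂ => ‖z‖ ^ (k + 1)) :
    ∀ m ∈ s, m.1 + m.2 ≤ k → a m = 0 := by
  classical
  intro m₀ hm₀ hk
  set j := m₀.1 + m₀.2 with hj
  have step : ∀ w : ℂ, ‖w‖ = 1 → ∑ m ∈ s with m.1 + m.2 = j, a m * monom m w = 0 := by
    intro w hw
    let p : Polynomial ℂ := ∑ m ∈ s, Polynomial.monomial (m.1 + m.2) (a m * monom m w)
    have hp : ∀ t : ℝ, p.eval (t : ℂ) = ∑ m ∈ s, a m * monom m (t * w) := by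
      intro t
      simp only [p, Polynomial.eval_finsetSum, Polynomial.eval_monomial]
      refine Finset.sum_congr rfl fun m _ => ?_
      rw [monom_ofReal_mul]
      ring
    have hO : (fun t : ℝ => p.eval (t : ℂ)) =O[𝓝[≠] 0] fun t : ℝ => t ^ (k + 1) := by
      have ht : Tendsto (fun t : ℝ => (t : ℂ) * w) (𝓝[≠] 0) (𝓝 0) := by
        have : Tendsto (fun t : ℝ => (t : ℂ) * w) (𝓝 0) (𝓝 (((0 : ℝ) : ℂ) * w)) := by
          apply Continuous.tendsto
          fun_prop
        simpa using this.mono_left nhdsWithin_le_nhds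
      have := h.comp_tendsto ht
      simp only [Function.comp_def, norm_mul, hw, mul_one, norm_real] at this
      simp only [hp]
      refine this.trans ?_
      simp only [← norm_pow]
      exact (Asymptotics.isBigO_refl _ _).norm_left
    have := coeff_eq_zero_of_isBigO k p hO j hk
    simp only [p, Polynomial.finsetSum_coeff, Polynomial.coeff_monomial] at this
    rw [Finset.sum_filter]
    exact this
  let q : Polynomial ℂ := ∑ m ∈ s with m.1 + m.2 = j, Polynomial.monomial (2 * m.1) (a m)
  have hq : q = 0 := by
    refine Polynomial.eq_zero_of_infinite_isRoot q ?_
    have : Infinite Circle := Circle.argEquiv.infinite_iff.2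
      (Set.infinite_coe_iff.2 (Set.Ioc_infinite (by linarith [Real.pi_pos])))
    have hinf : (Set.range fun t : Circle => (t : ℂ)).Infinite :=
      Set.infinite_range_of_injective Subtype.val_injective
    refine hinf.mono ?_
    rintro _ ⟨w, rfl⟩
    have h1 := step w w.norm_coe
    simp only [mem_ofPred_eq, Polynomial.IsRoot, q, Polynomial.eval_finsetSum,
      Polynomial.eval_monomial]
    have h2 : ∀ m ∈ s.filter (fun m => m.1 + m.2 = j),
        a m * (w : ℂ) ^ (2 * m.1) = (w : ℂ) ^ j * (a m * monom m w) := by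
      intro m hm
      rw [Finset.mem_filter] at hm
      have hw : (w : ℂ) * starRingEnd ℂ w = 1 := by
        rw [mul_conj, normSq_eq_norm_sq, w.norm_coe]; simp
      rw [monom, ← hm.2]
      calc _ = a m * ((w : ℂ) ^ (2 * m.1) * (w * starRingEnd ℂ w) ^ m.2) := by
            rw [hw, one_pow, mul_one]
        _ = _ := by rw [mul_pow]; ring
    rw [Finset.sum_congr rfl h2, ← Finset.mul_sum, h1, mul_zero]
  have := congrArg (fun r => Polynomial.coeff r (2 * m₀.1)) hq
  simp only [q, Polynomial.finsetSum_coeff, Polynomial.coeff_monomial,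
    Polynomial.coeff_zero] at this
  rw [Finset.sum_eq_single_of_mem m₀ (by simp [hm₀, hj])] at this
  · simpa using this
  · intro m hm hne
    rw [Finset.mem_filter] at hm
    rw [if_neg]
    intro h'
    apply hne
    ext <;> omega

/-- Two expansions of the same function agree. -/
lemma jet_unique {s : Finset (ℕ × ℕ)} {a b : ℕ × ℕ → ℂ} {F : ℂ → ℂ} {k : ℕ}
    (ha : (fun z : ℂ => F z - ∑ m ∈ s, a m * monom m z) =O[𝓝 0] fun z : ℂ => ‖z‖ ^ (k + 1))
    (hb : (fun z : ℂ => F z - ∑ m ∈ s, b m * monom m z) =O[𝓝 0] fun z : ℂ => ‖z‖ ^ (k + 1)) :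
    ∀ m ∈ s, m.1 + m.2 ≤ k → a m = b m := by
  intro m hm hk
  have := hb.sub ha
  have h2 : (fun z : ℂ => ∑ m ∈ s, (a m - b m) * monom m z) =O[𝓝 0]
      fun z : ℂ => ‖z‖ ^ (k + 1) := by
    refine this.congr_left fun z => ?_
    simp only [sub_mul, Finset.sum_sub_distrib]
    ring
  exact sub_eq_zero.1 (jet_coeff_eq_zero h2 m hm hk)

end

section

/-! ### First and second derivatives of real functions on complex spaces -/

section Derivatives

variable {E : Type*} [NormedAddCommGroup E] [NormedSpace ℂ E]

/-- The holomorphic derivative `∂r(x)[v]`. -/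
noncomputable def holDeriv (r : E → ℝ) (x v : E) : ℂ :=
  (1 / 2) * ((fderiv ℝ r x v : ℂ) - I * (fderiv ℝ r x (I • v) : ℂ))

/-- The second derivative as a bilinear form. -/
noncomputable abbrev hess (r : E → ℝ) (x : E) : E →L[ℝ] E →L[ℝ] ℝ := fderiv ℝ (fderiv ℝ r) x

/-- The form `∂∂̄r(x)[X, Ȳ]`. -/
noncomputable def leviH (r : E → ℝ) (x X Y : E) : ℂ :=
  (1 / 4) * (((hess r x X Y + hess r x (I • X) (I • Y) : ℝ) : ℂ)
    + I * ((hess r x X (I • Y) - hess r x (I • X) Y : ℝ) : ℂ))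

lemma holDeriv_add (r : E → ℝ) (x v w : E) :
    holDeriv r x (v + w) = holDeriv r x v + holDeriv r x w := by
  simp only [holDeriv, smul_add, map_add, ofReal_add]
  ring

lemma complex_smul_eq (c : ℂ) (v : E) : c • v = c.re • v + c.im • (I • v) := by
  conv_lhs => rw [← re_add_im c]
  rw [add_smul, mul_smul, coe_smul, coe_smul]

lemma holDeriv_smul (r : E → ℝ) (x v : E) (c : ℂ) :
    holDeriv r x (c • v) = c * holDeriv r x v := by
  have h1 : fderiv ℝ r x (c • v) = c.re * fderiv ℝ r x v + c.im * fderiv ℝ r x (I • v) := by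
    rw [complex_smul_eq]; simp
  have h2 : fderiv ℝ r x (I • c • v) = c.re * fderiv ℝ r x (I • v) - c.im * fderiv ℝ r x v := by
    rw [complex_smul_eq c v, smul_add, smul_comm I c.re, smul_comm I c.im, smul_smul I I, I_mul_I]
    simp [sub_eq_add_neg]
  simp only [holDeriv, h1, h2]
  conv_rhs => rw [← re_add_im c]
  push_cast
  linear_combination (1 / 2 * (c.im : ℂ) * (fderiv ℝ r x (I • v) : ℂ)) * I_sq

/-- The holomorphic derivative as a linear map. -/
noncomputable def holDerivₗ (r : E → ℝ) (x : E) : E →ₗ[ℂ] ℂ where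
  toFun := holDeriv r x
  map_add' := holDeriv_add r x
  map_smul' c v := holDeriv_smul r x v c

lemma holDerivₗ_apply (r : E → ℝ) (x v : E) : holDerivₗ r x v = holDeriv r x v := rfl

lemma fderiv_eq_two_re_holDeriv (r : E → ℝ) (x v : E) :
    fderiv ℝ r x v = 2 * (holDeriv r x v).re := by
  simp [holDeriv]

lemma holDeriv_eq_zero_iff (r : E → ℝ) (x v : E) :
    holDeriv r x v = 0 ↔ fderiv ℝ r x v = 0 ∧ fderiv ℝ r x (I • v) = 0 := by
  simp [holDeriv, Complex.ext_iff]

lemma holDeriv_ne_zero {r : E → ℝ} {x : E} (h : fderiv ℝ r x ≠ 0) : ∃ v, holDeriv r x v ≠ 0 := by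
  by_contra! h0
  exact h (ContinuousLinearMap.ext fun v => ((holDeriv_eq_zero_iff r x v).1 (h0 v)).1)

lemma contDiffOn_holDeriv {r : E → ℝ} {W : Set E} (hW : IsOpen W) (hr : ContDiffOn ℝ ∞ r W) :
    ContDiffOn ℝ ∞ (fun y : E × E => holDeriv r y.1 y.2) (W ×ˢ univ) := by
  have h1 : ContDiffOn ℝ ∞ (fderiv ℝ r) W := hr.fderiv_of_isOpen hW (by simp)
  have h2 : ContDiffOn ℝ ∞ (fun y : E × E => fderiv ℝ r y.1) (W ×ˢ univ) :=
    h1.comp contDiff_fst.contDiffOn (fun y hy => hy.1)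
  have h3 : ContDiff ℝ ∞ (fun y : E × E => I • y.2) := by fun_prop
  have h4 : ContDiffOn ℝ ∞ (fun y : E × E => fderiv ℝ r y.1 y.2) (W ×ˢ univ) :=
    h2.clm_apply contDiff_snd.contDiffOn
  have h5 : ContDiffOn ℝ ∞ (fun y : E × E => fderiv ℝ r y.1 (I • y.2)) (W ×ˢ univ) :=
    h2.clm_apply h3.contDiffOn
  have h6 : ContDiff ℝ ∞ (fun t : ℝ => (t : ℂ)) := ofRealCLM.contDiff
  unfold holDeriv
  exact contDiffOn_const.mul ((h6.comp_contDiffOn h4).sub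
    (contDiffOn_const.mul (h6.comp_contDiffOn h5)))

lemma leviH_add_left (r : E → ℝ) (x X X' Y : E) :
    leviH r x (X + X') Y = leviH r x X Y + leviH r x X' Y := by
  simp only [leviH, smul_add, map_add, add_apply]
  push_cast
  ring

lemma leviH_add_right (r : E → ℝ) (x X Y Y' : E) :
    leviH r x X (Y + Y') = leviH r x X Y + leviH r x X Y' := by
  simp only [leviH, smul_add, map_add]
  push_cast
  ring

lemma leviH_smul_left (r : E → ℝ) (x X Y : E) (c : ℂ) :
    leviH r x (c • X) Y = c * leviH r x X Y := by
  have h2 : I • c • X = c.re • (I • X) + (-c.im) • X := by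
    rw [complex_smul_eq c X, smul_add, smul_comm I c.re, smul_comm I c.im, smul_smul I I, I_mul_I]
    simp
  simp only [leviH, h2]
  rw [complex_smul_eq c X]
  simp only [map_add, map_smul, add_apply, smul_apply, smul_eq_mul]
  conv_rhs => rw [← re_add_im c]
  push_cast
  linear_combination (-(1 / 4) * (c.im : ℂ) * ((hess r x X (I • Y) : ℂ) - hess r x (I • X) Y)) * I_sq

lemma leviH_smul_right (r : E → ℝ) (x X Y : E) (c : ℂ) :
    leviH r x X (c • Y) = starRingEnd ℂ c * leviH r x X Y := by
  have h2 : I • c • Y = c.re • (I • Y) + (-c.im) • Y := by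
    rw [complex_smul_eq c Y, smul_add, smul_comm I c.re, smul_comm I c.im, smul_smul I I, I_mul_I]
    simp
  simp only [leviH, h2]
  rw [complex_smul_eq c Y]
  simp only [map_add, map_smul, smul_eq_mul]
  conv_rhs => rw [← re_add_im c]
  simp only [map_add, map_mul, conj_ofReal, conj_I]
  push_cast
  linear_combination ((1 / 4) * (c.im : ℂ) * ((hess r x X (I • Y) : ℂ) - hess r x (I • X) Y)) * I_sq

/-- `∂∂̄r(x)` as a sesquilinear form. -/
noncomputable def leviHₗ (r : E → ℝ) (x : E) : E →ₗ[ℂ] E →ₗ⋆[ℂ] ℂ :=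
  LinearMap.mk₂'ₛₗ (RingHom.id ℂ) (starRingEnd ℂ) (leviH r x) (leviH_add_left r x)
    (fun c X Y => leviH_smul_left r x X Y c) (leviH_add_right r x)
    (fun c X Y => leviH_smul_right r x X Y c)

lemma leviHₗ_apply (r : E → ℝ) (x X Y : E) : leviHₗ r x X Y = leviH r x X Y := rfl

lemma hess_symm {r : E → ℝ} {x : E} (hr : ContDiffAt ℝ 2 r x) (X Y : E) :
    hess r x X Y = hess r x Y X :=
  (hr.isSymmSndFDerivAt (by simp)).eq X Y

lemma leviH_conj {r : E → ℝ} {x : E} (hr : ContDiffAt ℝ 2 r x) (X Y : E) :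
    starRingEnd ℂ (leviH r x X Y) = leviH r x Y X := by
  simp only [leviH, map_mul, map_add, conj_ofReal, conj_I, hess_symm hr Y X,
    hess_symm hr (I • Y), hess_symm hr Y (I • X), map_div₀, map_one, map_ofNat]
  push_cast
  ring

lemma leviH_self_re (r : E → ℝ) (x X : E) :
    (leviH r x X X).re = (1 / 4) * (hess r x X X + hess r x (I • X) (I • X)) := by
  simp [leviH]

/-- Second order Taylor expansion at all points near `p`, with the second derivative at `p`. -/
lemma taylor_two_uniform {r : E → ℝ} {p : E} (hr : ContDiffAt ℝ 2 r p) {η : ℝ} (hη : 0 < η) :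
    ∃ ρ > 0, ∀ x ∈ Metric.ball p ρ, ∀ v, x + v ∈ Metric.ball p ρ →
      |r (x + v) - r x - fderiv ℝ r x v - (1 / 2) * hess r p v v| ≤ η * ‖v‖ ^ 2 := by
  have h1 : ContDiffAt ℝ 1 (fderiv ℝ r) p := hr.fderiv_right (by norm_num)
  have h2 : HasStrictFDerivAt (fderiv ℝ r) (hess r p) p := h1.hasStrictFDerivAt (by norm_num)
  have h3 := h2.isLittleO.bound hη
  have h4 : ∀ᶠ y in 𝓝 p, DifferentiableAt ℝ r y := by
    filter_upwards [hr.eventually (by simp)] with y hy using hy.differentiableAt (by simp)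
  rw [nhds_prod_eq] at h3
  obtain ⟨s, hs, hs'⟩ := h3.exists_mem
  obtain ⟨t, ht, ht'⟩ := Filter.mem_prod_same_iff.1 hs
  obtain ⟨ρ, hρ, hball⟩ := Metric.mem_nhds_iff.1 (Filter.inter_mem ht h4)
  refine ⟨ρ, hρ, fun x hx v hv => ?_⟩
  -- The derivative of k at y is the error of linearising `fderiv ℝ r` between x and y with the
  -- Hessian frozen at p. Strict differentiability at p bounds it by η‖y - x‖, and the mean value
  -- inequality on the segment finishes.
  let k : E → ℝ := fun y => r y - fderiv ℝ r x (y - x) - (1 / 2) * hess r p (y - x) (y - x)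
  let k' : E → E →L[ℝ] ℝ := fun y => fderiv ℝ r y - fderiv ℝ r x - hess r p (y - x)
  have hk : ∀ y ∈ Metric.ball p ρ, HasFDerivAt k (k' y) y := by
    intro y hy
    have d1 : HasFDerivAt r (fderiv ℝ r y) y := (hball hy).2.hasFDerivAt
    have d0 : HasFDerivAt (fun y : E => y - x) (ContinuousLinearMap.id ℝ E) y :=
      (hasFDerivAt_id y).sub_const x
    have d2 : HasFDerivAt (fun y => fderiv ℝ r x (y - x)) (fderiv ℝ r x) y := by
      exact ((fderiv ℝ r x).hasFDerivAt.comp y d0).congr_fderiv (by ext; simp)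
    have d3 := ((hess r p).hasFDerivAt.comp y d0).clm_apply d0
    have d4 := (d1.sub d2).sub (d3.const_mul (1 / 2))
    refine d4.congr_fderiv ?_
    ext w
    simp only [k', sub_apply, smul_apply, add_apply, ContinuousLinearMap.comp_apply,
      ContinuousLinearMap.flip_apply, smul_eq_mul, ContinuousLinearMap.id_apply, Function.comp]
    rw [hess_symm hr w (y - x)]
    ring
  have hseg : segment ℝ x (x + v) ⊆ Metric.ball p ρ := (convex_ball p ρ).segment_subset hx hv
  have key := (convex_segment x (x + v)).norm_image_sub_le_of_norm_hasFDerivWithin_le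
    (f := k) (f' := k') (C := η * ‖v‖)
    (fun y hy => (hk y (hseg hy)).hasFDerivWithinAt) (fun y hy => by
      have hb := hs' (y, x) (ht' (mk_mem_prod (hball (hseg hy)).1 (hball hx).1))
      simp only at hb
      refine hb.trans (mul_le_mul_of_nonneg_left ?_ hη.le)
      obtain ⟨θ, hθ, rfl⟩ := (segment_eq_image' ℝ x (x + v)).subset hy
      rw [add_sub_cancel_left, add_sub_cancel_left, norm_smul, Real.norm_of_nonneg hθ.1]
      exact mul_le_of_le_one_left (norm_nonneg _) hθ.2)
    (left_mem_segment ℝ x (x + v)) (right_mem_segment ℝ x (x + v))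
  simp only [k, add_sub_cancel_left, sub_self, map_zero, mul_zero, sub_zero, Real.norm_eq_abs]
    at key
  have e : r (x + v) - r x - fderiv ℝ r x v - (1 / 2) * hess r p v v =
    r (x + v) - fderiv ℝ r x v - (1 / 2) * hess r p v v - r x := by ring
  rw [e, pow_two, ← mul_assoc]
  exact key

/-- First and second order conditions at an interior touching point of a real curve. -/
lemma second_order_of_le_zero {r : E → ℝ} {p : E} (hr : ContDiffAt ℝ 2 r p) (hp : r p = 0)
    {X Y : E} {g : ℝ → E} (hg : Tendsto g (𝓝[≠] 0) (𝓝 Y))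
    (hle : ∀ᶠ s : ℝ in 𝓝 0, r (p + s • X + s ^ 2 • g s) ≤ 0) :
    fderiv ℝ r p X = 0 ∧ (1 / 2) * hess r p X X + fderiv ℝ r p Y ≤ 0 := by
  have hid : Tendsto (fun s : ℝ => s) (𝓝[≠] 0) (𝓝 0) := tendsto_id.mono_left nhdsWithin_le_nhds
  have hX' : Tendsto (fun s : ℝ => X + s • g s) (𝓝[≠] 0) (𝓝 X) := by
    simpa using tendsto_const_nhds.add (hid.smul hg)
  have hc : HasDerivAt (fun s : ℝ => p + s • X + s ^ 2 • g s) X 0 := by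
    rw [hasDerivAt_iff_tendsto_slope]
    refine hX'.congr' ?_
    filter_upwards [self_mem_nhdsWithin] with s hs
    have hs : s ≠ 0 := hs
    simp only [slope, vsub_eq_sub, sub_zero, zero_smul, add_zero, ne_eq, OfNat.ofNat_ne_zero,
      not_false_eq_true, zero_pow]
    rw [add_assoc, add_sub_cancel_left, smul_add, smul_smul, smul_smul, inv_mul_cancel₀ hs,
      one_smul]
    congr 2
    field_simp
  have hX : fderiv ℝ r p X = 0 := by
    have hd : HasFDerivAt r (fderiv ℝ r p) (p + (0 : ℝ) • X + (0 : ℝ) ^ 2 • g 0) := by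
      simpa using (hr.differentiableAt (by simp)).hasFDerivAt
    have hmax : IsLocalMax (r ∘ fun s : ℝ => p + s • X + s ^ 2 • g s) 0 := by
      filter_upwards [hle] with s hs
      simpa [hp] using hs
    exact hmax.hasDerivAt_eq_zero (hd.comp_hasDerivAt 0 hc)
  refine ⟨hX, ?_⟩
  have hη : ∀ η > 0, (1 / 2) * hess r p X X + fderiv ℝ r p Y - η * ‖X‖ ^ 2 ≤ 0 := by
    intro η hη
    obtain ⟨ρ, hρ, hT⟩ := taylor_two_uniform hr hη
    have hlim : Tendsto (fun s : ℝ => (1 / 2) * hess r p (X + s • g s) (X + s • g s)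
        + fderiv ℝ r p (g s) - η * ‖X + s • g s‖ ^ 2) (𝓝[≠] 0)
        (𝓝 ((1 / 2) * hess r p X X + fderiv ℝ r p Y - η * ‖X‖ ^ 2)) := by
      have c1 : Continuous fun V : E => hess r p V V := by fun_prop
      exact ((((c1.tendsto X).comp hX').const_mul _).add
        (((fderiv ℝ r p).continuous.tendsto Y).comp hg)).sub ((hX'.norm.pow 2).const_mul η)
    refine le_of_tendsto hlim ?_
    have hsmall : ∀ᶠ s : ℝ in 𝓝[≠] 0, p + s • (X + s • g s) ∈ Metric.ball p ρ := by
      have : Tendsto (fun s : ℝ => p + s • (X + s • g s)) (𝓝[≠] 0) (𝓝 p) := by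
        simpa using tendsto_const_nhds.add (hid.smul hX')
      exact this (Metric.ball_mem_nhds p hρ)
    filter_upwards [hsmall, hle.filter_mono nhdsWithin_le_nhds, self_mem_nhdsWithin]
      with s hs1 hs2 hs0
    have hs0 : s ≠ 0 := hs0
    have h := hT p (Metric.mem_ball_self hρ) (s • (X + s • g s)) hs1
    have e1 : p + s • (X + s • g s) = p + s • X + s ^ 2 • g s := by
      rw [smul_add, smul_smul, ← pow_two, add_assoc]
    rw [e1, hp] at h
    have h' := (abs_le.1 h).1
    have e2 : fderiv ℝ r p (s • (X + s • g s)) = s ^ 2 * fderiv ℝ r p (g s) := by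
      rw [map_smul, map_add, hX, map_smul, smul_eq_mul, smul_eq_mul]
      ring
    have e3 : hess r p (s • (X + s • g s)) (s • (X + s • g s)) =
        s ^ 2 * hess r p (X + s • g s) (X + s • g s) := by
      simp only [map_smul, smul_apply, smul_eq_mul]
      ring
    rw [e2, e3, norm_smul, mul_pow, Real.norm_eq_abs, sq_abs] at h'
    have hs2' : 0 < s ^ 2 := by positivity
    by_contra! hcon
    have := mul_pos hs2' hcon
    nlinarith
  have hlim : Tendsto (fun η : ℝ => (1 / 2) * hess r p X X + fderiv ℝ r p Y - η * ‖X‖ ^ 2)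
      (𝓝[>] 0) (𝓝 ((1 / 2) * hess r p X X + fderiv ℝ r p Y - 0 * ‖X‖ ^ 2)) :=
    (tendsto_const_nhds.sub (tendsto_id.mul_const _)).mono_left nhdsWithin_le_nhds
  have := le_of_tendsto hlim (by filter_upwards [self_mem_nhdsWithin] with η h using hη η h)
  simpa using this

/-- If the parabolic surface `γ(t) + |t|² v` over a holomorphic curve lies in `{r ≤ 0}` and touches
`{r = 0}` at a point where the Levi form is nonnegative, then `dr[v] ≤ 0`. -/
theorem fderiv_le_zero_of_curve [CompleteSpace E] {r : E → ℝ} {p : E} (hr : ContDiffAt ℝ 2 r p)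
    (hp : r p = 0) (hL : ∀ X, holDeriv r p X = 0 → 0 ≤ (leviH r p X X).re) {γ : ℂ → E}
    (hγ : AnalyticAt ℂ γ 0) (hγ0 : γ 0 = p) (v : E)
    (hle : ∀ᶠ t : ℂ in 𝓝 0, r (γ t + ‖t‖ ^ 2 • v) ≤ 0) : fderiv ℝ r p v ≤ 0 := by
  obtain ⟨P, hP⟩ := hγ
  have hP1 := hP.has_fpower_series_dslope_fslope
  have hP2 := hP1.has_fpower_series_dslope_fslope
  set g1 := dslope γ 0
  set g2 := dslope g1 0
  have hcont : ContinuousAt g2 0 := hP2.continuousAt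
  have hexp : ∀ t : ℂ, γ t = p + t • g1 0 + t ^ 2 • g2 t := by
    intro t
    have h1 := sub_smul_dslope γ 0 t
    have h2 := sub_smul_dslope g1 0 t
    rw [sub_zero] at h1 h2
    have h3 : g1 t = g1 0 + t • g2 t := by rw [h2]; abel
    have h4 : γ t = p + t • g1 t := by rw [h1, hγ0]; abel
    rw [h4, h3, smul_add, smul_smul, ← pow_two, add_assoc]
  have main : ∀ w : ℂ, ‖w‖ = 1 → fderiv ℝ r p (w • g1 0) = 0 ∧
      (1 / 2) * hess r p (w • g1 0) (w • g1 0) + fderiv ℝ r p (w ^ 2 • g2 0 + v) ≤ 0 := by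
    intro w hw
    have hcurve : Tendsto (fun s : ℝ => (s : ℂ) * w) (𝓝 0) (𝓝 0) := by
      have : Continuous fun s : ℝ => (s : ℂ) * w := by fun_prop
      simpa using this.tendsto 0
    refine second_order_of_le_zero hr hp (g := fun s => w ^ 2 • g2 (s * w) + v) ?_ ?_
    · have := (hcont.tendsto.comp hcurve).const_smul (w ^ 2)
      exact (this.add_const v).mono_left nhdsWithin_le_nhds
    · filter_upwards [hcurve.eventually hle] with s hs
      rw [hexp, norm_mul, hw, mul_one, norm_real, Real.norm_eq_abs, sq_abs] at hs
      convert hs using 2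
      rw [smul_add, ← coe_smul s, ← coe_smul (s ^ 2), smul_smul, smul_smul]
      push_cast
      rw [mul_pow, add_assoc, add_assoc, add_assoc, ← coe_smul (s ^ 2)]
  -- In the directions 1 and I the second order terms w² g2(0) of the curve are opposite and cancel
  -- on addition, while the two Hessian terms add up to twice the Levi form. What survives is the
  -- sign of dr[v].
  obtain ⟨a1, b1⟩ := main 1 (by simp)
  obtain ⟨a2, b2⟩ := main I (by simp)
  rw [one_smul] at a1 b1
  have h0 := hL (g1 0) ((holDeriv_eq_zero_iff _ _ _).2 ⟨a1, a2⟩)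
  rw [leviH_self_re] at h0
  rw [I_sq, map_add, neg_one_smul, map_neg] at b2
  rw [one_pow, one_smul, map_add] at b1
  linarith

end Derivatives

/-! ### The Levi form in terms of real derivatives -/

variable {d : ℕ}

lemma single_I_eq (j : Fin (d + 1)) :
    (EuclideanSpace.single j I : Cspace d) = I • EuclideanSpace.single j 1 := by
  ext i
  by_cases h : i = j
  · subst h; simp
  · simp [h]

lemma eq_sum_single (X : Cspace d) :
    X = ∑ j, X j • (EuclideanSpace.single j 1 : Cspace d) := by
  ext i
  simp [Pi.single_apply]

lemma fderiv_ofReal {r : Cspace d → ℝ} {z : Cspace d} (hr : DifferentiableAt ℝ r z)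
    (v : Cspace d) : fderiv ℝ (fun w => (r w : ℂ)) z v = (fderiv ℝ r z v : ℂ) := by
  have : HasFDerivAt (fun w => (r w : ℂ)) (ofRealCLM.comp (fderiv ℝ r z)) z :=
    ofRealCLM.hasFDerivAt.comp z hr.hasFDerivAt
  rw [this.fderiv]
  simp

lemma sum_dz_mul {r : Cspace d → ℝ} {z : Cspace d} (hr : DifferentiableAt ℝ r z) (X : Cspace d) :
    ∑ j, dz j (fun w => (r w : ℂ)) z * X j = holDeriv r z X := by
  conv_rhs => rw [eq_sum_single X, ← holDerivₗ_apply, map_sum]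
  refine Finset.sum_congr rfl fun j _ => ?_
  rw [map_smul, holDerivₗ_apply, smul_eq_mul, mul_comm, dz, fderiv_ofReal hr, fderiv_ofReal hr,
    single_I_eq]
  rfl

lemma mem_complexTangent {r : Cspace d → ℝ} {z : Cspace d} (hr : DifferentiableAt ℝ r z)
    (X : Cspace d) : X ∈ complexTangent r z ↔ holDeriv r z X = 0 := by
  rw [← sum_dz_mul hr]
  rfl

lemma complexHessian_eq {r : Cspace d → ℝ} {z : Cspace d} (hr : ContDiffAt ℝ 2 r z)
    (j k : Fin (d + 1)) :
    complexHessian r z j k =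
      leviH r z (EuclideanSpace.single j 1) (EuclideanSpace.single k 1) := by
  have h1 : ∀ᶠ y in 𝓝 z, DifferentiableAt ℝ r y := by
    filter_upwards [hr.eventually (by simp)] with y hy using hy.differentiableAt (by simp)
  have h2 : DifferentiableAt ℝ (fderiv ℝ r) z :=
    (hr.fderiv_right (m := 1) (by norm_num)).differentiableAt (by simp)
  set e := (EuclideanSpace.single k 1 : Cspace d)
  have h3 : dzbar k (fun w => (r w : ℂ)) =ᶠ[𝓝 z]
      fun y => (1 / 2) * ((fderiv ℝ r y e : ℂ) + I * (fderiv ℝ r y (I • e) : ℂ)) := by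
    filter_upwards [h1] with y hy
    rw [dzbar, fderiv_ofReal hy, fderiv_ofReal hy, single_I_eq]
  have h4 : ∀ v w : Cspace d,
      HasFDerivAt (fun y => (fderiv ℝ r y v : ℂ)) (ofRealCLM.comp ((hess r z).flip v)) z := by
    intro v w
    have := h2.hasFDerivAt.clm_apply (hasFDerivAt_const v z)
    refine ofRealCLM.hasFDerivAt.comp z (this.congr_fderiv ?_)
    ext y
    simp
  have h5 := (((h4 e e).add ((h4 (I • e) e).const_mul I)).const_mul (1 / 2))
  rw [complexHessian, dz, h3.fderiv_eq, single_I_eq]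
  erw [h5.fderiv]
  simp only [leviH, smul_apply, add_apply, ContinuousLinearMap.comp_apply,
    ContinuousLinearMap.flip_apply, smul_eq_mul, ofRealCLM_apply]
  push_cast
  set f := (EuclideanSpace.single j 1 : Cspace d)
  linear_combination (-(1 / 4) * (hess r z (I • f) (I • e) : ℂ)) * I_sq

lemma ddbar_eq {r : Cspace d → ℝ} {z : Cspace d} (hr : ContDiffAt ℝ 2 r z) (X Y : Cspace d) :
    ddbar r z X Y = leviH r z X Y := by
  have : ddbar r z X Y = ∑ j, ∑ k, complexHessian r z j k * X j * starRingEnd ℂ (Y k) := rfl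
  rw [this]
  conv_rhs => rw [← leviHₗ_apply, eq_sum_single X, map_sum, LinearMap.sum_apply]
  refine Finset.sum_congr rfl fun j _ => ?_
  conv_rhs => rw [eq_sum_single Y, map_sum]
  refine Finset.sum_congr rfl fun k _ => ?_
  rw [LinearMap.map_smulₛₗ, map_smul, LinearMap.smul_apply, leviHₗ_apply, complexHessian_eq hr]
  simp only [smul_eq_mul]
  ring

lemma IsDefiningFunctionOn.contDiffAt {Ω W : Set (Cspace d)} {r : Cspace d → ℝ}
    (hr : IsDefiningFunctionOn Ω W r) {z : Cspace d} (hz : z ∈ W) (n : ℕ) : ContDiffAt ℝ n r z :=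
  (hr.smooth.contDiffAt (hr.isOpen.mem_nhds hz)).of_le (by exact_mod_cast le_top)

/-- A zero of r away from the closure of Ω would be a local minimum of r, which dr ≠ 0 excludes. -/
lemma IsDefiningFunctionOn.mem_frontier {Ω W : Set (Cspace d)} {r : Cspace d → ℝ}
    (hr : IsDefiningFunctionOn Ω W r) {z : Cspace d} (hz : z ∈ W) (h0 : r z = 0) :
    z ∈ frontier Ω := by
  refine ⟨?_, fun h => ?_⟩
  · by_contra hcl
    refine hr.fderiv_ne_zero z hz h0 (IsLocalMin.fderiv_eq_zero ?_)
    filter_upwards [hr.isOpen.mem_nhds hz, isClosed_closure.isOpen_compl.mem_nhds hcl] with y hy hy'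
    rw [h0]
    by_contra! hlt
    exact hy' (subset_closure ((hr.mem_iff y hy).2 hlt))
  · have := (hr.mem_iff z hz).1 (interior_subset h)
    linarith

lemma IsDefiningFunctionOn.eq_zero_of_mem_frontier {Ω W : Set (Cspace d)} {r : Cspace d → ℝ}
    (hr : IsDefiningFunctionOn Ω W r) (hΩ : IsOpen Ω) {z : Cspace d} (hz : z ∈ W)
    (hf : z ∈ frontier Ω) : r z = 0 := by
  have hc : ContinuousAt r z := (hr.contDiffAt hz 0).continuousAt
  refine le_antisymm ?_ ?_
  · by_contra! hlt
    have hnot : ∀ᶠ y in 𝓝 z, y ∉ Ω := by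
      filter_upwards [hc.eventually (lt_mem_nhds hlt), hr.isOpen.mem_nhds hz] with y h1 h2 h3
      linarith [(hr.mem_iff y h2).1 h3]
    obtain ⟨y, hy1, hy2⟩ := mem_closure_iff_frequently.1 hf.1 |>.and_eventually hnot |>.exists
    exact hy2 hy1
  · by_contra! hlt
    rw [hΩ.frontier_eq] at hf
    exact hf.2 ((hr.mem_iff z hz).2 hlt)

/-- The touching argument meets the hypersurface at an uncontrolled zero of r, so pseudoconvexity is
needed at all zeros in W, in terms of real second derivatives. -/
lemma IsPseudoconvex.leviH_nonneg {Ω W : Set (Cspace d)} {r : Cspace d → ℝ}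
    (hΩ : IsPseudoconvex Ω) (hr : IsDefiningFunctionOn Ω W r) {z : Cspace d} (hz : z ∈ W)
    (h0 : r z = 0) (X : Cspace d) (hX : holDeriv r z X = 0) : 0 ≤ (leviH r z X X).re := by
  have h2 := hr.contDiffAt hz 2
  have := hΩ W r hr z ⟨hr.mem_frontier hz h0, hz⟩
    ⟨X, (mem_complexTangent (h2.differentiableAt (by simp)) X).2 hX⟩
  rw [← ddbar_eq h2]
  exact this

end

section

/-! ### Limits of rescaled pseudoconvex domains -/

section Touching

variable {E : Type*} [NormedAddCommGroup E] [NormedSpace ℂ E] [CompleteSpace E]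

/-- The polynomial curve `ξ ↦ ξ - κ ξ²` can be inverted along a holomorphic increment. -/
lemma exists_lift_quadratic {κ : ℝ} (hκ : κ ≠ 0) {w₀ : ℂ} (hw : 1 - 2 * κ * w₀ ≠ 0) {Δ : ℂ → ℂ}
    (hΔ : AnalyticAt ℂ Δ 0) (hΔ0 : Δ 0 = 0) :
    ∃ ξ : ℂ → ℂ, AnalyticAt ℂ ξ 0 ∧ ξ 0 = w₀ ∧
      ∀ᶠ t in 𝓝 0, ξ t - κ * ξ t ^ 2 = w₀ - κ * w₀ ^ 2 + Δ t := by
  have hκ' : (κ : ℂ) ≠ 0 := by exact_mod_cast hκ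
  set m := 1 - 2 * κ * w₀ with hm
  -- This is the discriminant of the quadratic equation for ξ t divided by its value m² at t = 0. It
  -- equals 1 there, so its principal square root is analytic near 0, and the root is taken with ξ 0
  -- = w₀.
  let u : ℂ → ℂ := fun t => 1 - 4 * κ * Δ t / m ^ 2
  have hu : AnalyticAt ℂ u 0 :=
    analyticAt_const.sub ((analyticAt_const.mul hΔ).div analyticAt_const (pow_ne_zero 2 hw))
  have hu0 : u 0 = 1 := by simp [u, hΔ0]
  have hlog : AnalyticAt ℂ (fun t => Complex.log (u t)) 0 := hu.clog (by simp [hu0])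
  have hs : AnalyticAt ℂ (fun t => Complex.exp (Complex.log (u t) / 2)) 0 :=
    (hlog.div analyticAt_const (by norm_num)).cexp
  refine ⟨fun t => (1 - m * Complex.exp (Complex.log (u t) / 2)) / (2 * κ),
    (analyticAt_const.sub (analyticAt_const.mul hs)).div analyticAt_const
      (mul_ne_zero two_ne_zero hκ'), ?_, ?_⟩
  · simp only [hu0, Complex.log_one, zero_div, Complex.exp_zero, mul_one]
    rw [hm]
    field_simp
    ring
  · have hne : ∀ᶠ t in 𝓝 0, u t ≠ 0 :=
      hu.continuousAt.eventually_ne (by rw [hu0]; exact one_ne_zero)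
    filter_upwards [hne] with t ht
    have hsq : Complex.exp (Complex.log (u t) / 2) ^ 2 = u t := by
      rw [← Complex.exp_nat_mul]
      push_cast
      rw [mul_div_cancel₀ _ (two_ne_zero), Complex.exp_log ht]
    set s := Complex.exp (Complex.log (u t) / 2)
    have h1 : m ^ 2 * u t = m ^ 2 - 4 * κ * Δ t := by
      simp only [u]
      field_simp
    have h2 : (1 - m * s) / (2 * κ) - κ * ((1 - m * s) / (2 * κ)) ^ 2 =
        (1 - m ^ 2 * s ^ 2) / (4 * κ) := by
      field_simp
      ring
    rw [h2, hsq, h1, hm]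
    field_simp
    ring

/-- If rescaled pseudoconvex domains converge to `{Re w + S(z) < 0}`, then `S` satisfies the
sub-mean value inequality. -/
theorem sub_mean_of_tendsto {r : E → ℝ} {W : Set E} (hr : ∀ x ∈ W, ContDiffAt ℝ 2 r x)
    (hL : ∀ x ∈ W, r x = 0 → ∀ X, holDeriv r x X = 0 → 0 ≤ (leviH r x X X).re)
    {S : ℂ → ℝ} (hS : Continuous S) {G : ℂ → ℂ} (hG : Differentiable ℂ G) {a : ℂ} {ϱ : ℝ}
    (hϱ : 0 < ϱ) (hSG : ∀ z, ‖z - a‖ = ϱ → S z = (G z).re)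
    {F : ℕ → ℂ × ℂ → E} (hF : ∀ n, Differentiable ℂ (F n)) {v : ℕ → E} {μ : ℕ → ℝ}
    (hμ : ∀ n, 0 < μ n)
    (hlim : TendstoLocallyUniformly (fun n ζ => μ n * r (F n ζ)) (fun ζ => ζ.1.re + S ζ.2) atTop)
    (hW : ∀ K : Set (ℂ × ℂ), IsCompact K →
      ∀ᶠ n in atTop, ∀ ζ ∈ K, F n ζ ∈ W ∧ 0 < fderiv ℝ r (F n ζ) (v n))
    (hshift : ∀ n (ζ : ℂ × ℂ) (t : ℝ), F n (ζ.1 + t, ζ.2) = F n ζ + t • v n) :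
    S a ≤ (G a).re := by
  by_contra! hlt
  obtain ⟨δ, hδ, hδ4⟩ : ∃ δ > 0, S a - (G a).re = 4 * δ :=
    ⟨(S a - (G a).re) / 4, by linarith, by ring⟩
  obtain ⟨M, hM0, hMS, hMG⟩ : ∃ M, 0 ≤ M ∧ (∀ z ∈ Metric.closedBall a ϱ, |S z| ≤ M) ∧
      ∀ z ∈ Metric.closedBall a ϱ, |(G z).re| ≤ M := by
    obtain ⟨M1, h1⟩ := (isCompact_closedBall a ϱ).exists_bound_of_continuousOn hS.continuousOn
    obtain ⟨M2, h2⟩ := (isCompact_closedBall a ϱ).exists_bound_of_continuousOn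
      (f := fun z => (G z).re) (continuous_re.comp hG.continuous).continuousOn
    refine ⟨max (max M1 M2) 0, le_max_right _ _, fun z hz => (h1 z hz).trans ?_,
      fun z hz => (h2 z hz).trans ?_⟩
    · exact (le_max_left _ _).trans (le_max_left _ _)
    · exact (le_max_right _ _).trans (le_max_left _ _)
  set R := M + δ + 1 with hR
  have hR0 : 0 < R := by positivity
  -- The term -κ w² makes the comparison function grow with |im w|, so minima cannot escape in that
  -- direction. The first bound keeps its effect along the real axis below δ; the second keeps Re(w
  -- - κ w²) increasing in re w on the box.
  obtain ⟨κ, hκ0, hκ1, hκ2⟩ : ∃ κ > 0, κ * R ^ 2 ≤ δ ∧ 4 * (κ * R) ≤ 1 := by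
    refine ⟨min (δ / R ^ 2) (1 / (4 * R)), by positivity, ?_, ?_⟩
    · calc _ ≤ δ / R ^ 2 * R ^ 2 := mul_le_mul_of_nonneg_right (min_le_left _ _) (by positivity)
        _ = δ := by field_simp
    · calc _ ≤ 4 * (1 / (4 * R) * R) := by
            gcongr
            exact min_le_right _ _
        _ = 1 := by field_simp
  set η := δ / ϱ ^ 2 with hη
  have hη0 : 0 < η := by positivity
  have hηϱ : η * ϱ ^ 2 = δ := by rw [hη]; field_simp
  obtain ⟨Y, hY0, hY⟩ : ∃ Y > 0, R + M + 2 * δ < κ * Y ^ 2 := by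
    refine ⟨(R + M + 2 * δ) / κ + 1, by positivity, ?_⟩
    have h1 : 1 ≤ (R + M + 2 * δ) / κ + 1 := by
      have : 0 ≤ (R + M + 2 * δ) / κ := by positivity
      linarith
    have h2 : κ * ((R + M + 2 * δ) / κ + 1) = R + M + 2 * δ + κ := by field_simp
    rw [pow_two, ← mul_assoc, h2]
    nlinarith
  set K : Set (ℂ × ℂ) := (Icc (-R) R ×ℂ Icc (-Y) Y) ×ˢ Metric.closedBall a ϱ with hK
  have hKc : IsCompact K := (isCompact_Icc.reProdIm isCompact_Icc).prod (isCompact_closedBall a ϱ)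
  have hu := (tendstoLocallyUniformly_iff_forall_isCompact.1 hlim) K hKc
  have hev := (Metric.tendstoUniformlyOn_iff.1 hu (δ / 2) (by positivity)).and (hW K hKc)
  obtain ⟨n, hn1, hn2⟩ := hev.exists
  set ρ : ℂ × ℂ → ℝ := fun ζ => μ n * r (F n ζ) with hρ
  have hclose : ∀ ζ ∈ K, |ζ.1.re + S ζ.2 - ρ ζ| < δ / 2 := fun ζ hζ => by
    simpa [Real.dist_eq] using hn1 ζ hζ
  have hρc : ContinuousOn ρ K := fun ζ hζ =>
    (continuousAt_const.mul (((hr _ (hn2 ζ hζ).1).continuousAt).comp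
      (hF n).continuous.continuousAt)).continuousWithinAt
  -- Apart from -η‖z - a‖² this is pluriharmonic. It is minimised over the part of the box outside
  -- the rescaled domain; the minimum is at most -3δ, by the point over the centre where S exceeds
  -- Re G.
  let φ : ℂ × ℂ → ℝ := fun ζ => (ζ.1 - κ * ζ.1 ^ 2).re + (G ζ.2).re - η * ‖ζ.2 - a‖ ^ 2
  have hφc : Continuous φ := by
    have := hG.continuous
    fun_prop
  have hre : ∀ w : ℂ, (w - κ * w ^ 2).re = w.re - κ * w.re ^ 2 + κ * w.im ^ 2 := fun w => by
    simp [pow_two]; ring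
  set C := K ∩ ρ ⁻¹' Ici 0 with hC
  have hCc : IsCompact C :=
    hKc.of_isClosed_subset (hρc.preimage_isClosed_of_isClosed hKc.isClosed isClosed_Ici)
      inter_subset_left
  have haK : a ∈ Metric.closedBall a ϱ := Metric.mem_closedBall_self hϱ.le
  have hcK : ((((-S a + δ : ℝ) : ℂ)), a) ∈ K := by
    have := abs_le.1 (hMS a haK)
    refine ⟨?_, haK⟩
    simp only [mem_reProdIm, ofReal_re, ofReal_im, mem_Icc]
    exact ⟨⟨by linarith, by linarith⟩, by linarith, by linarith⟩
  have hcC : ((((-S a + δ : ℝ) : ℂ)), a) ∈ C := by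
    refine ⟨hcK, ?_⟩
    have := abs_lt.1 (hclose _ hcK)
    simp only [ofReal_re] at this
    simp only [mem_preimage, mem_Ici]
    linarith [this.2]
  obtain ⟨⟨w₀, z₀⟩, hmC, hmin⟩ := hCc.exists_isMinOn ⟨_, hcC⟩ hφc.continuousOn
  have hφ3 : φ (w₀, z₀) ≤ -3 * δ := by
    refine (hmin hcC).trans ?_
    simp only [φ, hre, ofReal_re, ofReal_im, sub_self, norm_zero]
    have : 0 ≤ κ * (-S a + δ) ^ 2 := by positivity
    linarith
  have hmK : (w₀, z₀) ∈ K := hmC.1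
  have hρ0 : 0 ≤ ρ (w₀, z₀) := hmC.2
  obtain ⟨⟨hx, hy⟩, hz⟩ := hmK
  have hz' : ‖z₀ - a‖ ≤ ϱ := by simpa [dist_eq_norm] using hz
  have hx : -R ≤ w₀.re ∧ w₀.re ≤ R := hx
  have hy : -Y ≤ w₀.im ∧ w₀.im ≤ Y := hy
  have hS0 := abs_le.1 (hMS z₀ hz)
  have hG0 := abs_le.1 (hMG z₀ hz)
  have hcl := abs_lt.1 (hclose _ hmC.1)
  simp only at hcl
  have hx2 : κ * w₀.re ^ 2 ≤ δ := by
    refine le_trans ?_ hκ1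
    have : w₀.re ^ 2 ≤ R ^ 2 := by nlinarith
    exact mul_le_mul_of_nonneg_left this hκ0.le
  have hη2 : η * ‖z₀ - a‖ ^ 2 ≤ δ := by
    rw [← hηϱ]
    have : ‖z₀ - a‖ ^ 2 ≤ ϱ ^ 2 := by gcongr
    exact mul_le_mul_of_nonneg_left this hη0.le
  have hφe : φ (w₀, z₀) = w₀.re - κ * w₀.re ^ 2 + κ * w₀.im ^ 2 + (G z₀).re
      - η * ‖z₀ - a‖ ^ 2 := by simp only [φ, hre]
  have hy2 : 0 ≤ κ * w₀.im ^ 2 := by positivity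
  rw [hφe] at hφ3
  -- Over the circle S = Re G, so points outside the rescaled domain have value at least -5δ/2,
  -- above the minimum.
  have hz_lt : ‖z₀ - a‖ < ϱ := by
    refine lt_of_le_of_ne hz' fun h => ?_
    have := hSG z₀ h
    linarith
  have hx1 : -R < w₀.re := by linarith
  have hx3 : w₀.re < R := by linarith
  have hyY : w₀.im ^ 2 < Y ^ 2 := by
    by_contra! h
    have := mul_le_mul_of_nonneg_left h hκ0.le
    linarith
  have hyabs := abs_lt.1 (sq_lt_sq₀ (abs_nonneg _) hY0.le |>.1 (by rwa [sq_abs]))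
  have hKn : K ∈ 𝓝 (w₀, z₀) := by
    refine prod_mem_nhds ?_ (Metric.closedBall_mem_nhds_of_mem ?_)
    · have : IsOpen (Ioo (-R) R ×ℂ Ioo (-Y) Y) := isOpen_Ioo.reProdIm isOpen_Ioo
      refine mem_of_superset (this.mem_nhds ⟨⟨hx1, hx3⟩, hyabs⟩) ?_
      rintro w ⟨h1, h2⟩
      exact ⟨Ioo_subset_Icc_self h1, Ioo_subset_Icc_self h2⟩
    · simpa [dist_eq_norm] using hz_lt
  have hρat : ContinuousAt ρ (w₀, z₀) := hρc.continuousAt hKn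
  have hκx : 2 * (κ * w₀.re) ≤ 1 / 2 := by
    linarith [mul_le_mul_of_nonneg_left hx.2 hκ0.le]
  have hκx' : -(1 / 2) ≤ 2 * (κ * w₀.re) := by
    linarith [mul_le_mul_of_nonneg_left hx.1 hκ0.le]
  -- Otherwise a small decrease of re w would stay in C and lower φ.
  have hρz : ρ (w₀, z₀) = 0 := by
    refine le_antisymm ?_ hρ0
    by_contra! hpos
    have hline : Tendsto (fun t : ℝ => (w₀ - (t : ℂ), z₀)) (𝓝[>] 0) (𝓝 (w₀, z₀)) := by
      have : Continuous fun t : ℝ => (w₀ - (t : ℂ), z₀) := by fun_prop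
      simpa using (this.tendsto 0).mono_left nhdsWithin_le_nhds
    obtain ⟨t, ⟨ht1, ht2⟩, ht0⟩ := (((hline.eventually hKn).and
      (hline.eventually (hρat.eventually (lt_mem_nhds hpos)))).and self_mem_nhdsWithin).exists
    have ht0 : 0 < t := ht0
    have := hmin (show (w₀ - (t : ℂ), z₀) ∈ C from ⟨ht1, le_of_lt ht2⟩)
    simp only [φ, hre, mem_ofPred_eq, sub_re, ofReal_re, sub_im, ofReal_im] at this
    have h2 : 0 ≤ κ * t ^ 2 := by positivity
    have h3 : κ * (w₀.re - t) ^ 2 = κ * w₀.re ^ 2 - t * (2 * (κ * w₀.re)) + κ * t ^ 2 := by ring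
    have h4 : 0 < t * (1 - 2 * (κ * w₀.re)) := mul_pos ht0 (by linarith)
    rw [h3, sub_zero] at this
    linarith
  have hm : 1 - 2 * (κ : ℂ) * w₀ ≠ 0 := by
    intro h
    have := congrArg Complex.re h
    simp at this
    linarith
  -- The disc is chosen so that Re G and the first order part of -η‖z - a‖² are cancelled exactly:
  -- along it φ equals its minimum minus η|t|².
  let Δ : ℂ → ℂ := fun t => -(G (z₀ + t) - G z₀) + 2 * η * starRingEnd ℂ (z₀ - a) * t
  have hΔd : Differentiable ℂ Δ := by fun_prop
  obtain ⟨ξ, hξ, hξ0, hξB⟩ := exists_lift_quadratic hκ0.ne' hm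
    (hΔd.analyticAt 0) (by simp [Δ])
  have hγ : AnalyticAt ℂ (fun t => F n (ξ t, z₀ + t)) 0 := by
    rw [Complex.analyticAt_iff_eventually_differentiableAt]
    filter_upwards [hξ.eventually_analyticAt] with t ht
    have h1 : DifferentiableAt ℂ (fun t => (ξ t, z₀ + t)) t :=
      ht.differentiableAt.prodMk (by fun_prop)
    exact ((hF n).differentiableAt (x := (ξ t, z₀ + t))).comp t h1
  have hFW := hn2 _ hmC.1
  have hr0 : r (F n (w₀, z₀)) = 0 := by
    have := mul_eq_zero.1 hρz
    exact this.resolve_left (hμ n).ne'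
  have key := fderiv_le_zero_of_curve (hr _ hFW.1) hr0 (hL _ hFW.1 hr0) hγ (by simp [hξ0])
    ((η / 4) • v n) ?_
  · rw [map_smul, smul_eq_mul] at key
    linarith [mul_pos (show 0 < η / 4 by positivity) hFW.2]
  · have hβ : Tendsto (fun t : ℂ => (ξ t + ((η / 4 * ‖t‖ ^ 2 : ℝ) : ℂ), z₀ + t)) (𝓝 0)
        (𝓝 (w₀, z₀)) := by
      have h2 : ContinuousAt (fun t : ℂ => (ξ t + ((η / 4 * ‖t‖ ^ 2 : ℝ) : ℂ), z₀ + t)) 0 := by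
        refine (hξ.continuousAt.add ?_).prodMk ?_
        · exact Continuous.continuousAt (by fun_prop)
        · exact Continuous.continuousAt (by fun_prop)
      have h3 := h2.tendsto
      simpa [hξ0] using h3
    have hξre : ∀ᶠ t in 𝓝 0, -(1 : ℝ) < 2 * (κ * (ξ t).re) := by
      have h1 : ContinuousAt (fun t => 2 * (κ * (ξ t).re)) 0 := by
        have := hξ.continuousAt
        fun_prop
      refine h1.eventually (lt_mem_nhds ?_)
      simp only [hξ0]
      linarith
    filter_upwards [hβ hKn, hξB, hξre] with t htK htB htr
    have e1 : F n (ξ t, z₀ + t) + ‖t‖ ^ 2 • (η / 4) • v n =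
        F n (ξ t + ((η / 4 * ‖t‖ ^ 2 : ℝ) : ℂ), z₀ + t) := by
      have := hshift n (ξ t, z₀ + t) (η / 4 * ‖t‖ ^ 2)
      rw [this, smul_smul, mul_comm]
    rw [e1]
    rcases eq_or_ne t 0 with rfl | ht0
    · simp [hξ0, hr0]
    -- Pushing by s = η|t|²/4 raises φ by at most 2s, which is less than the gain η|t|². A pushed
    -- point outside the domain would therefore lie below the minimum.
    by_contra! hpos
    have hinC : (ξ t + ((η / 4 * ‖t‖ ^ 2 : ℝ) : ℂ), z₀ + t) ∈ C :=
      ⟨htK, (mul_pos (hμ n) hpos).le⟩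
    have hle := hmin hinC
    set s := η / 4 * ‖t‖ ^ 2 with hs
    have hs0 : 0 ≤ s := by positivity
    have e2 : (ξ t + (s : ℂ) - κ * (ξ t + s) ^ 2).re =
        (ξ t - κ * ξ t ^ 2).re + s * (1 - 2 * (κ * (ξ t).re)) - κ * s ^ 2 := by
      simp only [hre, add_re, ofReal_re, add_im, ofReal_im]
      ring
    have e3 : ‖z₀ + t - a‖ ^ 2 =
        ‖z₀ - a‖ ^ 2 + 2 * (starRingEnd ℂ (z₀ - a) * t).re + ‖t‖ ^ 2 := by
      rw [← normSq_eq_norm_sq, ← normSq_eq_norm_sq, ← normSq_eq_norm_sq]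
      simp only [normSq_apply, sub_re, add_re, sub_im, add_im, mul_re, conj_re, conj_im, map_sub]
      ring
    have e4 : (Δ t).re = -((G (z₀ + t)).re - (G z₀).re)
        + 2 * η * (starRingEnd ℂ (z₀ - a) * t).re := by
      have : Δ t = -(G (z₀ + t) - G z₀) + ((2 * η : ℝ) : ℂ) * (starRingEnd ℂ (z₀ - a) * t) := by
        simp only [Δ]; push_cast; ring
      rw [this, add_re, neg_re, sub_re, re_ofReal_mul]
    simp only [φ, mem_ofPred_eq, e2, e3, htB] at hle
    rw [add_re, e4] at hle
    have h5 : 0 < η * ‖t‖ ^ 2 := by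
      have := norm_pos_iff.2 ht0
      positivity
    have h6 : 0 ≤ κ * s ^ 2 := by positivity
    have h7 : s * (1 - 2 * (κ * (ξ t).re)) ≤ s * 2 :=
      mul_le_mul_of_nonneg_left (by linarith) hs0
    have h8 : s * 4 = η * ‖t‖ ^ 2 := by rw [hs]; ring
    linarith

end Touching

end

section

/-! ### Polynomials in `z` and `z̄` on circles -/

/-- The point is to rewrite z · conj h. With h = h(a) + (z - a) h₁ and (z - a) conj(z - a) = ϱ² on
the circle, (z - a) conj h becomes (z - a) conj h(a) + ϱ² conj h₁, and the rest is a · conj h. -/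
lemma exists_repr_mul_on_circle {a : ℂ} {ϱ : ℝ} (g h : Polynomial ℂ) :
    ∃ g' h' : Polynomial ℂ, ∀ z, ‖z - a‖ = ϱ →
      z * (g.eval z + starRingEnd ℂ (h.eval z)) = g'.eval z + starRingEnd ℂ (h'.eval z) := by
  obtain ⟨h₁, hh₁⟩ : (Polynomial.X - Polynomial.C a) ∣ h - Polynomial.C (h.eval a) :=
    Polynomial.dvd_iff_isRoot.2 (by simp)
  refine ⟨Polynomial.X * g + (Polynomial.X - Polynomial.C a) *
      Polynomial.C (starRingEnd ℂ (h.eval a)),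
    Polynomial.C (ϱ : ℂ) ^ 2 * h₁ + Polynomial.C (starRingEnd ℂ a) * h, fun z hz => ?_⟩
  have e1 : h.eval z = (z - a) * h₁.eval z + h.eval a := by
    have := congrArg (Polynomial.eval z) hh₁
    simp at this
    linear_combination this
  have e2 : (z - a) * starRingEnd ℂ (z - a) = (ϱ : ℂ) ^ 2 := by
    rw [mul_conj, normSq_eq_norm_sq, hz]
    push_cast
    ring
  have e3 := congrArg (starRingEnd ℂ) e1
  rw [map_add, map_mul] at e3
  simp only [Polynomial.eval_add, Polynomial.eval_mul, Polynomial.eval_X, Polynomial.eval_sub,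
    Polynomial.eval_C, Polynomial.eval_pow, map_add, map_mul, map_pow, conj_ofReal, conj_conj]
  linear_combination (z - a) * e3 + (starRingEnd ℂ (h₁.eval z)) * e2

lemma exists_repr_monom_on_circle (a : ℂ) (ϱ : ℝ) (m : ℕ × ℕ) :
    ∃ g h : Polynomial ℂ, ∀ z, ‖z - a‖ = ϱ →
      monom m z = g.eval z + starRingEnd ℂ (h.eval z) := by
  obtain ⟨j, k⟩ := m
  have conj_swap : ∀ g h : Polynomial ℂ, ∃ g' h' : Polynomial ℂ, ∀ z, ‖z - a‖ = ϱ →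
      starRingEnd ℂ z * (g.eval z + starRingEnd ℂ (h.eval z)) =
        g'.eval z + starRingEnd ℂ (h'.eval z) := by
    intro g h
    obtain ⟨g', h', H⟩ := exists_repr_mul_on_circle (a := a) (ϱ := ϱ) h g
    refine ⟨h', g', fun z hz => ?_⟩
    have := congrArg (starRingEnd ℂ) (H z hz)
    simp only [map_mul, map_add, conj_conj] at this
    linear_combination this
  induction j with
  | zero =>
    induction k with
    | zero => exact ⟨1, 0, fun z _ => by simp [monom]⟩
    | succ k ih =>
      obtain ⟨g, h, H⟩ := ih
      obtain ⟨g', h', H'⟩ := conj_swap g h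
      refine ⟨g', h', fun z hz => ?_⟩
      rw [← H' z hz, ← H z hz]
      simp only [monom, pow_succ]
      ring
  | succ j ih =>
    obtain ⟨g, h, H⟩ := ih
    obtain ⟨g', h', H'⟩ := exists_repr_mul_on_circle (a := a) (ϱ := ϱ) g h
    refine ⟨g', h', fun z hz => ?_⟩
    rw [← H' z hz, ← H z hz]
    simp only [monom, pow_succ]
    ring

/-- This solves the Dirichlet problem with polynomials: g + conj h is harmonic, so its value at the
centre is the circle average, and its real part is that of the holomorphic function g + h used as
comparison function. -/
lemma exists_repr_sum_on_circle (a : ℂ) (ϱ : ℝ) (s : Finset (ℕ × ℕ)) (c : ℕ × ℕ → ℂ) :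
    ∃ g h : Polynomial ℂ, ∀ z, ‖z - a‖ = ϱ →
      ∑ m ∈ s, c m * monom m z = g.eval z + starRingEnd ℂ (h.eval z) := by
  choose g h H using exists_repr_monom_on_circle a ϱ
  refine ⟨∑ m ∈ s, Polynomial.C (c m) * g m,
    ∑ m ∈ s, Polynomial.C (starRingEnd ℂ (c m)) * h m, fun z hz => ?_⟩
  simp only [Polynomial.eval_finsetSum, Polynomial.eval_mul, Polynomial.eval_C, map_sum, map_mul,
    conj_conj, ← Finset.sum_add_distrib, ← mul_add]
  exact Finset.sum_congr rfl fun m _ => by rw [H m z hz]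

lemma circleAverage_add_conj {g h : ℂ → ℂ} (hg : Differentiable ℂ g) (hh : Differentiable ℂ h)
    (a : ℂ) (ϱ : ℝ) :
    Real.circleAverage (fun z => g z + starRingEnd ℂ (h z)) a ϱ = g a + starRingEnd ℂ (h a) := by
  have hci : ∀ f : ℂ → ℂ, Continuous f → CircleIntegrable f a ϱ := fun f hf =>
    hf.continuousOn.circleIntegrable'
  rw [Real.circleAverage_fun_add (hci _ hg.continuous)
    (hci (fun z => starRingEnd ℂ (h z)) (continuous_conj.comp hh.continuous))]
  have h1 := (conjCLE : ℂ →L[ℝ] ℂ).circleAverage_comp_comm (hci h hh.continuous)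
  have h2 : ((conjCLE : ℂ →L[ℝ] ℂ) ∘ h) = fun z => starRingEnd ℂ (h z) := by
    funext z; simp
  rw [h2] at h1
  rw [h1, hg.diffContOnCl.circleAverage, hh.diffContOnCl.circleAverage]
  simp

lemma norm_circleAverage_le {f : ℂ → ℂ} {a : ℂ} {ϱ C : ℝ}
    (h : ∀ z, ‖z - a‖ = |ϱ| → ‖f z‖ ≤ C) : ‖Real.circleAverage f a ϱ‖ ≤ C := by
  rw [Real.circleAverage_def, norm_smul]
  have h1 : ‖∫ θ in (0 : ℝ)..2 * Real.pi, f (circleMap a ϱ θ)‖ ≤ C * |2 * Real.pi - 0| :=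
    intervalIntegral.norm_integral_le_of_norm_le_const fun θ _ => h _ (by simp [circleMap])
  have h2 : (0 : ℝ) < 2 * Real.pi := Real.two_pi_pos
  rw [sub_zero, abs_of_pos h2] at h1
  rw [norm_inv, Real.norm_of_nonneg h2.le]
  calc _ ≤ (2 * Real.pi)⁻¹ * (C * (2 * Real.pi)) := by gcongr
    _ = C := by field_simp

/-- `f(w)` has a second order expansion at `0` with `w w̄`-coefficient `L`. -/
def HasTwoJet (f : ℂ → ℂ) (L : ℂ) : Prop :=
  ∃ A₀ A B C D : ℂ, (fun w => f w - (A₀ + A * w + B * starRingEnd ℂ w + C * w ^ 2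
    + D * starRingEnd ℂ w ^ 2 + L * (w * starRingEnd ℂ w))) =O[𝓝 0] fun w => ‖w‖ ^ 3

lemma HasTwoJet.sum {s : Finset (ℕ × ℕ)} {f : ℕ × ℕ → ℂ → ℂ} {L c : ℕ × ℕ → ℂ}
    (h : ∀ m ∈ s, HasTwoJet (f m) (L m)) :
    HasTwoJet (fun w => ∑ m ∈ s, c m * f m w) (∑ m ∈ s, c m * L m) := by
  choose! A₀ A B C D H using h
  refine ⟨∑ m ∈ s, c m * A₀ m, ∑ m ∈ s, c m * A m, ∑ m ∈ s, c m * B m, ∑ m ∈ s, c m * C m,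
    ∑ m ∈ s, c m * D m, ?_⟩
  have := Asymptotics.IsBigO.fun_sum fun m hm => (H m hm).const_mul_left (c m)
  refine this.congr_left fun w => ?_
  simp only [Finset.sum_mul, ← Finset.sum_add_distrib, ← Finset.sum_sub_distrib]
  exact Finset.sum_congr rfl fun m _ => by ring

lemma exists_pow_add_eq (a : ℂ) (j : ℕ) : ∃ (P₂ : ℂ) (R : Polynomial ℂ), ∀ w : ℂ,
    (w + a) ^ j = a ^ j + (j * a ^ (j - 1)) * w + P₂ * w ^ 2 + w ^ 3 * R.eval w := by
  let p : Polynomial ℂ := (Polynomial.X + Polynomial.C a) ^ j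
  refine ⟨p.coeff 2, p.divX.divX.divX, fun w => ?_⟩
  have e0 : p.coeff 0 = a ^ j := by
    rw [Polynomial.coeff_zero_eq_eval_zero]; simp [p]
  have e1 : p.coeff 1 = j * a ^ (j - 1) := by
    have : p.derivative.coeff 0 = p.coeff 1 := by rw [Polynomial.coeff_derivative]; simp
    rw [← this, Polynomial.coeff_zero_eq_eval_zero]
    simp [p, Polynomial.derivative_X_add_C_pow]
  have hdiv : ∀ q : Polynomial ℂ, q.eval w = q.divX.eval w * w + q.coeff 0 := by
    intro q
    conv_lhs => rw [← q.divX_mul_X_add]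
    simp
  have h0 : p.eval w = (w + a) ^ j := by simp [p]
  have h1 := hdiv p
  have h2 := hdiv p.divX
  have h3 := hdiv p.divX.divX
  simp only [Polynomial.coeff_divX, zero_add, Nat.reduceAdd] at h2 h3
  rw [← h0, h1, h2, h3, e0, e1]
  ring

/-- The coefficient is ∂²/∂z∂z̄ of the monomial at a. It is the only term of positive order up to
two that survives averaging over circles. -/
lemma hasTwoJet_monom (a : ℂ) (m : ℕ × ℕ) :
    HasTwoJet (fun w => monom m (w + a))
      ((m.1 * a ^ (m.1 - 1)) * (m.2 * starRingEnd ℂ a ^ (m.2 - 1))) := by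
  obtain ⟨P₂, R, hR⟩ := exists_pow_add_eq a m.1
  obtain ⟨S₂, T, hT⟩ := exists_pow_add_eq a m.2
  set P₀ := a ^ m.1
  set P₁ := (m.1 : ℂ) * a ^ (m.1 - 1)
  set S₀ := starRingEnd ℂ a ^ m.2
  set S₁ := (m.2 : ℂ) * starRingEnd ℂ a ^ (m.2 - 1)
  have hT' : ∀ w : ℂ, starRingEnd ℂ (w + a) ^ m.2 = S₀ + S₁ * starRingEnd ℂ w
      + starRingEnd ℂ S₂ * starRingEnd ℂ w ^ 2
      + starRingEnd ℂ w ^ 3 * starRingEnd ℂ (T.eval w) := by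
    intro w
    rw [← map_pow, hT]
    simp [S₀, S₁]
  refine ⟨P₀ * S₀, P₁ * S₀, P₀ * S₁, P₂ * S₀, P₀ * starRingEnd ℂ S₂, ?_⟩
  have hcub : ∀ (c : ℂ → ℂ) (i j : ℕ), i + j = 3 → Continuous c →
      (fun w : ℂ => c w * (w ^ i * starRingEnd ℂ w ^ j)) =O[𝓝 0] fun w => ‖w‖ ^ 3 := by
    intro c i j hij hc
    have h1 : c =O[𝓝 0] fun _ => (1 : ℝ) := (hc.tendsto 0).isBigO_one ℝ
    have h2 : (fun w : ℂ => w ^ i * starRingEnd ℂ w ^ j) =O[𝓝 0] fun w => ‖w‖ ^ 3 := by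
      refine Asymptotics.IsBigO.of_norm_le fun w => ?_
      simp [← pow_add, hij]
    simpa using h1.mul h2
  have hc1 : Continuous fun w : ℂ => R.eval w := R.continuous
  have hc2 : Continuous fun w : ℂ => T.eval w := T.continuous
  have c0 := hcub (fun w => R.eval w * (S₀ + S₁ * starRingEnd ℂ w
      + starRingEnd ℂ S₂ * starRingEnd ℂ w ^ 2
      + starRingEnd ℂ w ^ 3 * starRingEnd ℂ (T.eval w))) 3 0 rfl (by fun_prop)
  have c1 := hcub (fun w => (P₀ + P₁ * w + P₂ * w ^ 2) * starRingEnd ℂ (T.eval w)) 0 3 rfl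
    (by fun_prop)
  have c2 := hcub (fun w => P₁ * starRingEnd ℂ S₂ + P₂ * starRingEnd ℂ S₂ * w) 1 2 rfl
    (by fun_prop)
  have c3 := hcub (fun _ => P₂ * S₁) 2 1 rfl (by fun_prop)
  refine (((c0.add c1).add c2).add c3).congr_left fun w => ?_
  simp only [monom, hR w, hT' w]
  ring

/-- A polynomial in `z`, `z̄` with the mean value property has no mixed terms. -/
theorem coeff_eq_zero_of_mean_value {s : Finset (ℕ × ℕ)} {q : ℕ × ℕ → ℂ}
    (h : ∀ (a : ℂ) (ϱ : ℝ), 0 < ϱ →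
      Real.circleAverage (fun z => ∑ m ∈ s, q m * monom m z) a ϱ = ∑ m ∈ s, q m * monom m a) :
    ∀ m ∈ s, 1 ≤ m.1 → 1 ≤ m.2 → q m = 0 := by
  set Q : ℂ → ℂ := fun z => ∑ m ∈ s, q m * monom m z with hQ
  have hQc : Continuous Q :=
    continuous_finsetSum _ fun m _ => continuous_const.mul (continuous_monom m)
  -- The sum is a quarter of the Laplacian at a. Averaging the second order expansion over a circle
  -- of radius t gives Q a + L t² up to K t³, so the mean value property yields ‖L‖ ≤ K t.
  have key : ∀ a : ℂ, ∑ m ∈ s, q m * ((m.1 * a ^ (m.1 - 1)) *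
      (m.2 * starRingEnd ℂ a ^ (m.2 - 1))) = 0 := by
    intro a
    obtain ⟨A₀, A, B, C, D, hJ⟩ := HasTwoJet.sum (s := s) (c := q) fun m _ => hasTwoJet_monom a m
    set L := ∑ m ∈ s, q m * ((m.1 * a ^ (m.1 - 1)) * (m.2 * starRingEnd ℂ a ^ (m.2 - 1)))
    obtain ⟨K, hK⟩ := hJ.bound
    obtain ⟨ρ, hρ, hball⟩ := Metric.eventually_nhds_iff.1 hK
    have hA0 : A₀ = Q a := by
      have := hball (y := 0) (by simpa using hρ)
      simp only [map_zero, mul_zero, norm_zero, ne_eq, OfNat.ofNat_ne_zero,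
        not_false_eq_true, zero_pow, add_zero, zero_add, norm_le_zero_iff] at this
      exact (sub_eq_zero.1 this).symm
    have hest : ∀ t ∈ Ioo 0 ρ, ‖L‖ ≤ K * t := by
      intro t ht
      -- On the circle w w̄ is the constant t², so there the jet is holomorphic plus antiholomorphic
      -- and its average is known.
      let g : ℂ → ℂ := fun w => A₀ + A * w + C * w ^ 2 + L * (t : ℂ) ^ 2
      let g' : ℂ → ℂ := fun w => starRingEnd ℂ B * w + starRingEnd ℂ D * w ^ 2
      have hg : Differentiable ℂ g := by fun_prop
      have hg' : Differentiable ℂ g' := by fun_prop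
      have h1 : Real.circleAverage (fun w => Q (w + a)) 0 t = Q a := by
        rw [Real.circleAverage_map_add_const, h a t ht.1]
      have h2 := circleAverage_add_conj hg hg' 0 t
      have h3 := norm_circleAverage_le (a := 0) (ϱ := t) (C := K * t ^ 3)
        (f := fun w => Q (w + a) - (g w + starRingEnd ℂ (g' w))) (fun z hz => by
          rw [sub_zero, abs_of_pos ht.1] at hz
          have hb := hball (y := z) (by simpa [hz] using ht.2)
          have hzz : z * starRingEnd ℂ z = (t : ℂ) ^ 2 := by
            rw [mul_conj, normSq_eq_norm_sq, hz]; push_cast; ring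
          rw [norm_pow, norm_norm, hz] at hb
          refine le_of_eq_of_le (congrArg norm ?_) hb
          simp only [g, g', hQ, map_add, map_mul, map_pow, conj_conj, hzz]
          ring)
      have c1 : Continuous fun w => Q (w + a) := hQc.comp (continuous_add_const a)
      have c2 : Continuous fun w => g w + starRingEnd ℂ (g' w) :=
        hg.continuous.add (continuous_conj.comp hg'.continuous)
      rw [Real.circleAverage_fun_sub c1.continuousOn.circleIntegrable'
        c2.continuousOn.circleIntegrable', h1, h2] at h3
      have h4 : Q a - (g 0 + starRingEnd ℂ (g' 0)) = -(L * (t : ℂ) ^ 2) := by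
        simp [g, g', hA0]
      rw [h4, norm_neg, norm_mul, norm_pow, norm_real, Real.norm_of_nonneg ht.1.le] at h3
      have ht2 : 0 < t ^ 2 := by have := ht.1; positivity
      refine le_of_mul_le_mul_right ?_ ht2
      calc ‖L‖ * t ^ 2 ≤ K * t ^ 3 := h3
        _ = K * t * t ^ 2 := by ring
    have hlim : Tendsto (fun t : ℝ => K * t) (𝓝[>] 0) (𝓝 (K * 0)) :=
      (tendsto_id.const_mul K).mono_left nhdsWithin_le_nhds
    have := ge_of_tendsto hlim (by
      filter_upwards [Ioo_mem_nhdsGT hρ] with t ht using hest t ht)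
    rw [mul_zero] at this
    exact norm_le_zero_iff.1 this
  intro m hm h1 h2
  -- Multiplying the vanishing Laplacian by z z̄ restores the monomials. The factors m.1 and m.2
  -- absorb the truncated exponents at 0.
  have h0 : (fun z : ℂ => ∑ m ∈ s, (q m * m.1 * m.2) * monom m z) =O[𝓝 0]
      fun z : ℂ => ‖z‖ ^ (m.1 + m.2 + 1) := by
    have : ∀ z : ℂ, ∑ m ∈ s, (q m * m.1 * m.2) * monom m z = 0 := by
      intro z
      have := congrArg (fun x => z * starRingEnd ℂ z * x) (key z)
      simp only [mul_zero, Finset.mul_sum] at this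
      rw [← this]
      refine Finset.sum_congr rfl fun m _ => ?_
      obtain ⟨j, k⟩ := m
      cases j with
      | zero => simp
      | succ j =>
        cases k with
        | zero => simp
        | succ k =>
          simp only [monom, Nat.add_sub_cancel, pow_succ]
          ring
    simp only [this]
    exact Asymptotics.isBigO_zero _ _
  have := jet_coeff_eq_zero h0 m hm le_rfl
  have e1 : (m.1 : ℂ) ≠ 0 := by exact_mod_cast (by omega : m.1 ≠ 0)
  have e2 : (m.2 : ℂ) ≠ 0 := by exact_mod_cast (by omega : m.2 ≠ 0)
  simpa [e1, e2] using this

end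

section

/-! ### Coordinates adapted to a boundary point -/

/-- A positive semidefinite Hermitian form of rank at least `k` has `k` orthonormal vectors. -/
lemma exists_orthonormal_of_le_rank {V : Type*} [AddCommGroup V] [Module ℂ V]
    [FiniteDimensional ℂ V] (B : V →ₗ[ℂ] V →ₗ⋆[ℂ] ℂ)
    (hsymm : ∀ x y, starRingEnd ℂ (B x y) = B y x) (hpos : ∀ x, 0 ≤ (B x x).re) (k : ℕ)
    (hk : k ≤ Module.finrank ℂ (LinearMap.range B)) :
    ∃ v : Fin k → V, ∀ i j, B (v i) (v j) = if i = j then 1 else 0 := by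
  induction k with
  | zero => exact ⟨fun i => i.elim0, fun i => i.elim0⟩
  | succ k ih =>
    obtain ⟨v, hv⟩ := ih (by omega)
    have hself : ∀ x, B x x = ((B x x).re : ℂ) := fun x =>
      (conj_eq_iff_real.1 (hsymm x x)).elim fun t ht => by rw [ht]; simp
    -- If no such vector existed, polarisation would make B vanish on the orthogonal complement of
    -- the v i. Every B x would then be a combination of the k functionals B (v i), contradicting
    -- the rank.
    obtain ⟨x, hx, hxx⟩ : ∃ x, (∀ i, B x (v i) = 0) ∧ 0 < (B x x).re := by
      by_contra! hcon
      have h0 : ∀ x, (∀ i, B x (v i) = 0) → B x x = 0 := fun x hx => by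
        rw [hself x, le_antisymm (hcon x hx) (hpos x), ofReal_zero]
      have h0' : ∀ x y, (∀ i, B x (v i) = 0) → (∀ i, B y (v i) = 0) → B x y = 0 := by
        intro x y hx hy
        have e1 := h0 (x + y) (fun i => by simp [hx, hy])
        have e2 := h0 (x + I • y) (fun i => by simp [hx, hy])
        simp only [map_add, LinearMap.add_apply, map_smul, LinearMap.smul_apply,
          LinearMap.map_smulₛₗ, h0 x hx, h0 y hy, smul_eq_mul, conj_I, zero_add, add_zero,
          mul_zero] at e1 e2
        linear_combination (1 / 2) * e1 + (1 / 2) * I * e2 + (1 / 2) * (B x y - B y x) * I_sq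
      let pr : V → V := fun x => ∑ i, B x (v i) • v i
      have hpr : ∀ x i, B (x - pr x) (v i) = 0 := by
        intro x i
        simp [pr, hv, LinearMap.sum_apply]
      have hB : ∀ x, B x = ∑ i, B x (v i) • B (v i) := by
        intro x
        have hz : B (x - pr x) = 0 := by
          ext y
          have h1 : B (x - pr x) (pr y) = 0 := by
            simp only [pr, map_sum, LinearMap.map_smulₛₗ]
            exact Finset.sum_eq_zero fun i _ => by rw [hpr]; simp
          have h2 : B (x - pr x) (y - pr y) = 0 := h0' _ _ (hpr x) (hpr y)
          rw [map_sub, h1, sub_zero] at h2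
          simpa using h2
        rw [map_sub, sub_eq_zero] at hz
        calc B x = B (pr x) := hz
          _ = _ := by simp only [pr, map_sum, map_smul]
      have hle : LinearMap.range B ≤ Submodule.span ℂ (Set.range fun i => B (v i)) := by
        rintro _ ⟨x, rfl⟩
        rw [hB x]
        exact Submodule.sum_mem _ fun i _ => Submodule.smul_mem _ _
          (Submodule.subset_span ⟨i, rfl⟩)
      have : FiniteDimensional ℂ (Submodule.span ℂ (Set.range fun i => B (v i))) :=
        FiniteDimensional.span_of_finite ℂ (Set.finite_range _)
      have h1 := Submodule.finrank_mono hle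
      have h2 := finrank_range_le_card (R := ℂ) (fun i => B (v i))
      rw [Set.finrank, Fintype.card_fin] at h2
      omega
    set t := (B x x).re
    have ht : (0 : ℝ) < Real.sqrt t := Real.sqrt_pos.2 hxx
    have htc : ((Real.sqrt t : ℝ) : ℂ) ≠ 0 := by exact_mod_cast ht.ne'
    set c : ℂ := ((Real.sqrt t : ℝ) : ℂ)⁻¹ with hc
    have hcc : starRingEnd ℂ c = c := by rw [hc, map_inv₀, conj_ofReal]
    have hx' : ∀ i, B (v i) x = 0 := fun i => by rw [← hsymm, hx, map_zero]
    refine ⟨Fin.cons (c • x) v, fun i j => ?_⟩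
    refine Fin.cases ?_ (fun i => ?_) i <;> refine Fin.cases ?_ (fun j => ?_) j
    · simp only [Fin.cons_zero, map_smul, LinearMap.smul_apply, LinearMap.map_smulₛₗ, smul_eq_mul,
        hcc, if_true]
      rw [hself x]
      have : ((t : ℝ) : ℂ) = (Real.sqrt t : ℂ) * (Real.sqrt t : ℂ) := by
        rw [← ofReal_mul, Real.mul_self_sqrt hxx.le]
      change c * (c * (t : ℂ)) = 1
      rw [this, hc]
      field_simp
    · simp [hx, (Fin.succ_ne_zero j).symm]
    · simp [hx', Fin.succ_ne_zero i]
    · simp [hv]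

variable {d : ℕ}

/-- Linear coordinates at `p` in which `∂r(p) = dz_0 / 2` and the Levi form on the span of
`e_2, …, e_d` is the identity. -/
lemma exists_adapted_basis (hd : 1 ≤ d) {r : Cspace d → ℝ} {p : Cspace d}
    (hr : ContDiffAt ℝ 2 r p) (hdr : fderiv ℝ r p ≠ 0)
    (hpsc : ∀ X, holDeriv r p X = 0 → 0 ≤ (leviH r p X X).re) (hrank : d - 1 ≤ leviRank r p) :
    ∃ L : Cspace d ≃L[ℂ] Cspace d, (∀ z, holDeriv r p (L z) = z 0 / 2) ∧
      ∀ z : Cspace d, z 0 = 0 → z 1 = 0 → (leviH r p (L z) (L z)).re = ‖z‖ ^ 2 := by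
  obtain ⟨k, rfl⟩ : ∃ k, d = k + 1 := ⟨d - 1, by omega⟩
  have hdiff := hr.differentiableAt (by simp)
  have hmem : ∀ X : Cspace (k + 1), X ∈ complexTangent r p ↔ holDeriv r p X = 0 :=
    mem_complexTangent hdiff
  have hlev : ∀ X Y : complexTangent r p, leviForm r p X Y = leviH r p X Y := fun X Y =>
    ddbar_eq hr X Y
  obtain ⟨v, hv⟩ := exists_orthonormal_of_le_rank (leviForm r p)
    (fun X Y => by rw [hlev, hlev, leviH_conj hr])
    (fun X => by rw [hlev]; exact hpsc X ((hmem X).1 X.2)) k (by simpa [leviRank] using hrank)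
  have hT : Module.finrank ℂ (complexTangent r p) = k + 1 := by
    have hker : complexTangent r p = LinearMap.ker (holDerivₗ r p) := by
      ext X
      rw [hmem, LinearMap.mem_ker, holDerivₗ_apply]
    have hne : holDerivₗ r p ≠ 0 := by
      obtain ⟨X, hX⟩ := holDeriv_ne_zero hdr
      intro h
      exact hX (by rw [← holDerivₗ_apply, h]; rfl)
    have hsurj : LinearMap.range (holDerivₗ r p) = ⊤ :=
      LinearMap.range_eq_top.2 (LinearMap.surjective hne)
    have h1 := LinearMap.finrank_range_add_finrank_ker (holDerivₗ r p)
    rw [hsurj, finrank_top, Module.finrank_self, finrank_euclideanSpace_fin] at h1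
    rw [hker]
    omega
  have hvli : LinearIndependent ℂ v := by
    rw [Fintype.linearIndependent_iff]
    intro g hg i
    have := congrArg (fun x => leviForm r p x (v i)) hg
    simpa [hv, LinearMap.sum_apply] using this
  -- The tangent space has one dimension more than the orthonormal family. Any vector filling it may
  -- serve as e_1, since nothing is asked of the Levi form there.
  obtain ⟨v₁, hv₁⟩ : ∃ v₁ : complexTangent r p, v₁ ∉ Submodule.span ℂ (Set.range v) := by
    by_contra! hcon
    have h1 : Submodule.span ℂ (Set.range v) = ⊤ := Submodule.eq_top_iff'.2 hcon
    have h2 := finrank_range_le_card (R := ℂ) v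
    rw [Set.finrank, h1, finrank_top, hT, Fintype.card_fin] at h2
    omega
  obtain ⟨ν₀, hν₀⟩ := holDeriv_ne_zero hdr
  set ν : Cspace (k + 1) := (1 / 2 / holDeriv r p ν₀) • ν₀
  have hν : holDeriv r p ν = 1 / 2 := by
    rw [holDeriv_smul]
    field_simp
  let w : Fin (k + 1) → complexTangent r p := Fin.cons v₁ v
  have hw : LinearIndependent ℂ w := linearIndependent_finCons.2 ⟨hvli, hv₁⟩
  have hw' : LinearIndependent ℂ fun i => (w i : Cspace (k + 1)) :=
    hw.map' (complexTangent r p).subtype (Submodule.ker_subtype _)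
  have hwT : ∀ i, holDeriv r p (w i) = 0 := fun i => (hmem _).1 (w i).2
  let b : Fin (k + 2) → Cspace (k + 1) := Fin.cons ν fun i => (w i : Cspace (k + 1))
  have hb : LinearIndependent ℂ b := by
    refine linearIndependent_finCons.2 ⟨hw', fun h => ?_⟩
    have hsub : Submodule.span ℂ (Set.range fun i => (w i : Cspace (k + 1))) ≤
        complexTangent r p := Submodule.span_le.2 (by rintro _ ⟨i, rfl⟩; exact (w i).2)
    have := (hmem ν).1 (hsub h)
    rw [hν] at this
    norm_num at this
  let bb := basisOfLinearIndependentOfCardEqFinrank hb (by simp)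
  let L : Cspace (k + 1) ≃L[ℂ] Cspace (k + 1) :=
    ((WithLp.linearEquiv 2 ℂ (Fin (k + 2) → ℂ)).trans bb.equivFun.symm).toContinuousLinearEquiv
  have hL : ∀ z, L z = z 0 • ν + ∑ i, z (Fin.succ i) • (w i : Cspace (k + 1)) := by
    intro z
    have : L z = ∑ i, z i • bb i := by simp [L, bb.equivFun_symm_apply]
    rw [this, Fin.sum_univ_succ]
    simp [bb, b]
  refine ⟨L, fun z => ?_, fun z h0 h1 => ?_⟩
  · rw [hL, ← holDerivₗ_apply, map_add, map_smul, map_sum]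
    simp only [map_smul, holDerivₗ_apply, hwT, hν]
    simp [div_eq_mul_inv]
  · have e1 : L z = ((∑ i, z (Fin.succ (Fin.succ i)) • v i : complexTangent r p) :
        Cspace (k + 1)) := by
      rw [hL, h0, zero_smul, zero_add, Fin.sum_univ_succ]
      have : z (Fin.succ 0) = 0 := h1
      rw [this]
      simp [w]
    rw [e1, ← hlev, EuclideanSpace.norm_sq_eq, Fin.sum_univ_succ, Fin.sum_univ_succ, h0]
    have : z (Fin.succ 0) = 0 := h1
    rw [this]
    simp [hv, LinearMap.sum_apply, LinearMap.map_smulₛₗ, map_sum]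
    exact Finset.sum_congr rfl fun i _ => by rw [← normSq_apply, normSq_eq_norm_sq]

/-- The coordinates at nearby points: a correction in the direction of `L e_0`. -/
noncomputable def adjustedMap (r : Cspace d → ℝ) (L : Cspace d →L[ℂ] Cspace d) (q : Cspace d) :
    Cspace d →L[ℂ] Cspace d :=
  L + ∑ j : Fin (d + 1), (((if j = 0 then 1 / 2 else 0) -
    holDeriv r q (L (EuclideanSpace.single j 1))) /
      holDeriv r q (L (EuclideanSpace.single 0 1))) •
    ((EuclideanSpace.proj j : Cspace d →L[ℂ] ℂ).smulRight (L (EuclideanSpace.single 0 1)))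

lemma adjustedMap_apply (r : Cspace d → ℝ) (L : Cspace d →L[ℂ] Cspace d) (q z : Cspace d) :
    adjustedMap r L q z = L z + ((z 0 / 2 - holDeriv r q (L z)) /
      holDeriv r q (L (EuclideanSpace.single 0 1))) • L (EuclideanSpace.single 0 1) := by
  have h1 : holDeriv r q (L z) =
      ∑ j, z j * holDeriv r q (L (EuclideanSpace.single j 1)) := by
    conv_lhs => rw [eq_sum_single z]
    rw [map_sum, ← holDerivₗ_apply, map_sum]
    exact Finset.sum_congr rfl fun j _ => by rw [map_smul, map_smul, smul_eq_mul, holDerivₗ_apply]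
  have h2 : z 0 / 2 = ∑ j : Fin (d + 1), z j * (if j = 0 then 1 / 2 else 0) := by
    simp [div_eq_mul_inv]
  rw [h1, h2, ← Finset.sum_sub_distrib, Finset.sum_div, Finset.sum_smul]
  simp only [adjustedMap, add_apply, sum_apply,
    smul_apply, ContinuousLinearMap.smulRight_apply, smul_smul]
  congr 1
  refine Finset.sum_congr rfl fun j _ => ?_
  congr 1
  have : (EuclideanSpace.proj j : Cspace d →L[ℂ] ℂ) z = z j := rfl
  rw [this]
  ring

lemma holDeriv_adjustedMap {r : Cspace d → ℝ} {L : Cspace d →L[ℂ] Cspace d} {q : Cspace d}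
    (h : holDeriv r q (L (EuclideanSpace.single 0 1)) ≠ 0) (z : Cspace d) :
    holDeriv r q (adjustedMap r L q z) = z 0 / 2 := by
  rw [adjustedMap_apply, holDeriv_add, holDeriv_smul]
  field_simp
  ring

/-- Because the correction points along L e_0, the complex normal line of the frame keeps its
direction. A point projected to q along L e_0 is thus recovered on the ζ_0-axis. -/
lemma adjustedMap_single {r : Cspace d → ℝ} {L : Cspace d →L[ℂ] Cspace d} {q : Cspace d}
    (h : holDeriv r q (L (EuclideanSpace.single 0 1)) ≠ 0) :
    adjustedMap r L q (EuclideanSpace.single 0 1) =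
      (1 / (2 * holDeriv r q (L (EuclideanSpace.single 0 1)))) • L (EuclideanSpace.single 0 1) := by
  rw [adjustedMap_apply]
  conv_lhs => enter [1]; rw [← one_smul ℂ (L (EuclideanSpace.single 0 1))]
  rw [← add_smul]
  congr 1
  simp only [PiLp.single_apply, if_true]
  field_simp
  ring

lemma continuousAt_holDeriv {r : Cspace d → ℝ} {p : Cspace d} (hr : ContDiffAt ℝ 2 r p)
    (v : Cspace d) : ContinuousAt (fun q => holDeriv r q v) p := by
  have h1 : ContinuousAt (fderiv ℝ r) p := (hr.fderiv_right (m := 1) (by norm_num)).continuousAt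
  unfold holDeriv
  fun_prop

lemma continuousAt_adjustedMap {r : Cspace d → ℝ} {L : Cspace d →L[ℂ] Cspace d} {p : Cspace d}
    (hr : ContDiffAt ℝ 2 r p) (h : holDeriv r p (L (EuclideanSpace.single 0 1)) ≠ 0) :
    ContinuousAt (adjustedMap r L) p := by
  refine continuousAt_const.add (tendsto_finsetSum _ fun j _ => ?_)
  exact (((continuousAt_const.sub (continuousAt_holDeriv hr _)).div
    (continuousAt_holDeriv hr _) h).smul continuousAt_const)

lemma adjustedMap_self {r : Cspace d → ℝ} {L : Cspace d →L[ℂ] Cspace d} {p : Cspace d}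
    (h : ∀ z, holDeriv r p (L z) = z 0 / 2) : adjustedMap r L p = L := by
  ext1 z
  rw [adjustedMap_apply, h, sub_self, zero_div, zero_smul, add_zero]

/-- Nearby interior points are projected to the boundary along a transversal direction. -/
lemma exists_boundary_projection {r : Cspace d → ℝ} {W : Set (Cspace d)} (hW : IsOpen W)
    (hr : ContDiffOn ℝ ∞ r W) {p ν : Cspace d} (hp : p ∈ W) (hp0 : r p = 0)
    (hν : fderiv ℝ r p ν = 1) {u : ℕ → Cspace d} (hu : Tendsto u atTop (𝓝 p))
    (hneg : ∀ᶠ n in atTop, r (u n) < 0) :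
    ∃ s : ℕ → ℝ, (∀ n, 0 < s n) ∧ Tendsto s atTop (𝓝 0) ∧
      ∀ᶠ n in atTop, r (u n + s n • ν) = 0 := by
  have hrat : ∀ x ∈ W, ContDiffAt ℝ 1 r x := fun x hx =>
    (hr.contDiffAt (hW.mem_nhds hx)).of_le (by exact_mod_cast le_top)
  have hc : ContinuousAt (fun x => fderiv ℝ r x ν) p := by
    have h1 : ContinuousAt (fderiv ℝ r) p :=
      ((hr.contDiffAt (hW.mem_nhds hp)).fderiv_right (m := 1) (by norm_cast)).continuousAt
    fun_prop
  obtain ⟨δ, hδ, hball⟩ := Metric.mem_nhds_iff.1 (Filter.inter_mem (hW.mem_nhds hp)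
    (hc.eventually (lt_mem_nhds (show (1 / 2 : ℝ) < fderiv ℝ r p ν by rw [hν]; norm_num))))
  have hru : Tendsto (fun n => r (u n)) atTop (𝓝 0) := by
    rw [← hp0]
    exact (hrat p hp).continuousAt.tendsto.comp hu
  -- Along ν the derivative stays at least 1/2, so any factor above 2 makes r positive at the end of
  -- the segment. The bound also gives s → 0.
  have key : ∀ᶠ n in atTop, ∃ s, 0 < s ∧ s ≤ -3 * r (u n) ∧ r (u n + s • ν) = 0 := by
    have h1 : ∀ᶠ n in atTop, u n ∈ Metric.ball p (δ / 2) :=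
      hu (Metric.ball_mem_nhds p (by positivity))
    have h2 : ∀ᶠ n in atTop, (-3 * r (u n)) * ‖ν‖ < δ / 2 := by
      have : Tendsto (fun n => (-3 * r (u n)) * ‖ν‖) atTop (𝓝 ((-3 * 0) * ‖ν‖)) :=
        (hru.const_mul _).mul_const _
      exact this.eventually (gt_mem_nhds (by simp; positivity))
    filter_upwards [h1, h2, hneg] with n h1 h2 h3
    set T := -3 * r (u n) with hT
    have hT0 : 0 < T := by linarith
    have hin : ∀ t ∈ Icc 0 T, u n + t • ν ∈ Metric.ball p δ := by
      intro t ht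
      rw [Metric.mem_ball] at h1 ⊢
      calc dist (u n + t • ν) p ≤ dist (u n + t • ν) (u n) + dist (u n) p := dist_triangle _ _ _
        _ < δ / 2 + δ / 2 := by
            refine add_lt_add_of_le_of_lt ?_ h1
            rw [dist_eq_norm, add_sub_cancel_left, norm_smul, Real.norm_of_nonneg ht.1]
            exact (mul_le_mul_of_nonneg_right ht.2 (norm_nonneg _)).trans h2.le
        _ = δ := by ring
    have hder : ∀ t ∈ Icc 0 T, HasDerivAt (fun t : ℝ => r (u n + t • ν))
        (fderiv ℝ r (u n + t • ν) ν) t := by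
      intro t ht
      have d1 : HasFDerivAt r (fderiv ℝ r (u n + t • ν)) (u n + t • ν) :=
        ((hrat _ (hball (hin t ht)).1).differentiableAt (by simp)).hasFDerivAt
      have d2 : HasDerivAt (fun t : ℝ => u n + t • ν) ν t := by
        simpa using ((hasDerivAt_id t).smul_const ν).const_add (u n)
      exact d1.comp_hasDerivAt t d2
    have hcont : ContinuousOn (fun t : ℝ => r (u n + t • ν)) (Icc 0 T) := fun t ht =>
      (hder t ht).continuousAt.continuousWithinAt
    have hmv := (convex_Icc (0 : ℝ) T).mul_sub_le_image_sub_of_le_deriv hcont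
      (fun t ht => (hder t (interior_subset ht)).differentiableAt.differentiableWithinAt)
      (C := 1 / 2) (fun t ht => by
        rw [(hder t (interior_subset ht)).deriv]
        exact (hball (hin t (interior_subset ht))).2.le)
      0 (left_mem_Icc.2 hT0.le) T (right_mem_Icc.2 hT0.le) hT0.le
    simp only [zero_smul, add_zero, sub_zero] at hmv
    obtain ⟨t, ht, ht0⟩ := intermediate_value_Icc hT0.le hcont
      (show (0 : ℝ) ∈ Icc (r (u n + (0 : ℝ) • ν)) (r (u n + T • ν)) by
        rw [zero_smul, add_zero]
        exact ⟨h3.le, by linarith⟩)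
    refine ⟨t, lt_of_le_of_ne ht.1 ?_, ht.2, ht0⟩
    rintro rfl
    simp only [zero_smul, add_zero] at ht0
    linarith
  have : ∀ n, ∃ s, 0 < s ∧ (( ∃ s, 0 < s ∧ s ≤ -3 * r (u n) ∧ r (u n + s • ν) = 0) →
      s ≤ -3 * r (u n) ∧ r (u n + s • ν) = 0) := by
    intro n
    by_cases h : ∃ s, 0 < s ∧ s ≤ -3 * r (u n) ∧ r (u n + s • ν) = 0
    · obtain ⟨s, hs, hs'⟩ := h
      exact ⟨s, hs, fun _ => hs'⟩
    · exact ⟨1, one_pos, fun h' => absurd h' h⟩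
  choose s hs hs' using this
  refine ⟨s, hs, ?_, key.mono fun n hn => (hs' n hn).2⟩
  have h3 : Tendsto (fun n => -3 * r (u n)) atTop (𝓝 0) := by simpa using hru.const_mul (-3)
  exact tendsto_of_tendsto_of_tendsto_of_le_of_le' tendsto_const_nhds h3
    (Eventually.of_forall fun n => (hs n).le) (key.mono fun n hn => (hs' n hn).1)

end

section

/-! ### Curves adapted to the Levi foliation: removal of pure terms -/

variable {d N : ℕ}

/-- The polynomial curve `z e_1 + ∑ z^{k+1} c_k`. -/
noncomputable def curve (c : Fin N → Cspace d) (z : ℂ) : Cspace d :=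
  z • EuclideanSpace.single 1 1 + ∑ k : Fin N, z ^ ((k : ℕ) + 1) • c k

/-- The polynomial `∑ z^{k+1} η_k`. -/
noncomputable def scalarPoly (η : Fin N → ℂ) (z : ℂ) : ℂ :=
  ∑ k : Fin N, z ^ ((k : ℕ) + 1) * η k

/-- `r` along a curve. -/
noncomputable def alongCurve (r : Cspace d → ℝ) (q : Cspace d) (L : Cspace d →L[ℂ] Cspace d)
    (c : Fin N → Cspace d) (z : ℂ) : ℝ := r (q + L (curve c z))

/-- `∂r` along a curve, in the direction `v + η(z) e_0`. -/
noncomputable def derivAlongCurve (r : Cspace d → ℝ) (q : Cspace d)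
    (L : Cspace d →L[ℂ] Cspace d) (c : Fin N → Cspace d) (v : Cspace d) (η : Fin N → ℂ)
    (z : ℂ) : ℂ :=
  holDeriv r (q + L (curve c z)) (L (v + scalarPoly η z • EuclideanSpace.single 0 1))

lemma curve_zero (c : Fin N → Cspace d) : curve c 0 = 0 := by simp [curve]

lemma scalarPoly_zero (η : Fin N → ℂ) : scalarPoly η 0 = 0 := by simp [scalarPoly]

lemma differentiable_curve (c : Fin N → Cspace d) : Differentiable ℂ (curve c) := by
  unfold curve; fun_prop

lemma differentiable_scalarPoly (η : Fin N → ℂ) : Differentiable ℂ (scalarPoly η) := by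
  unfold scalarPoly; fun_prop

lemma curve_add_single (c : Fin N → Cspace d) (k : Fin N) (w : Cspace d) (z : ℂ) :
    curve (c + Pi.single k w) z = curve c z + z ^ ((k : ℕ) + 1) • w := by
  simp only [curve, Pi.add_apply, smul_add, Finset.sum_add_distrib, ← add_assoc]
  congr 1
  rw [Finset.sum_eq_single k] <;> simp +contextual

lemma scalarPoly_add_single (η : Fin N → ℂ) (k : Fin N) (w : ℂ) (z : ℂ) :
    scalarPoly (η + Pi.single k w) z = scalarPoly η z + z ^ ((k : ℕ) + 1) * w := by
  simp only [scalarPoly, Pi.add_apply, mul_add, Finset.sum_add_distrib]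
  congr 1
  rw [Finset.sum_eq_single k] <;> simp +contextual

/-- The base point, the frame and the curve coefficients are treated as smooth parameters in a
compact set, so that one constant and one radius serve for the whole sequence. -/
lemma uniform_jet_alongCurve {r : Cspace d → ℝ} {W : Set (Cspace d)} (hW : IsOpen W)
    (hr : ContDiffOn ℝ ∞ r W) {p : Cspace d} {δ₀ : ℝ} (hball : Metric.closedBall p δ₀ ⊆ W)
    (M C₀ : ℝ) (N n : ℕ) :
    ∃ C > 0, ∃ δ > 0, ∀ q ∈ Metric.closedBall p δ₀, ∀ L : Cspace d →L[ℂ] Cspace d, ‖L‖ ≤ M →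
      ∀ c : Fin N → Cspace d, ‖c‖ ≤ C₀ → ∃ a : ℕ × ℕ → ℂ, (∀ m, ‖a m‖ ≤ C) ∧
        ∀ z : ℂ, ‖z‖ ≤ δ →
          ‖(alongCurve r q L c z : ℂ) - ∑ m ∈ jetIndex n, a m * monom m z‖ ≤ C * ‖z‖ ^ (n + 1) := by
  let Φ : (Cspace d × (Cspace d →L[ℂ] Cspace d) × (Fin N → Cspace d)) × ℂ → Cspace d :=
    fun x => x.1.1 + x.1.2.1 (curve x.1.2.2 x.2)
  have hΦ : ContDiff ℝ ∞ Φ := by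
    have : ContDiff ℂ ∞ Φ := by
      unfold Φ curve
      fun_prop
    exact this.restrict_scalars ℝ
  have hF : ContDiffOn ℝ ∞ (fun x => ((r (Φ x) : ℝ) : ℂ)) (Φ ⁻¹' W) :=
    ofRealCLM.contDiff.comp_contDiffOn (hr.comp hΦ.contDiffOn fun x hx => hx)
  obtain ⟨C, hC, δ, hδ, H⟩ := exists_uniform_jet (hW.preimage hΦ.continuous) hF
    (K := Metric.closedBall p δ₀ ×ˢ Metric.closedBall 0 M ×ˢ Metric.closedBall 0 C₀)
    ((isCompact_closedBall _ _).prod ((isCompact_closedBall _ _).prod (isCompact_closedBall _ _)))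
    (by
      rintro ⟨q, L, c⟩ ⟨hq, -, -⟩
      simpa [Φ, curve_zero] using hball hq) n
  refine ⟨C, hC, δ, hδ, fun q hq L hL c hc => ?_⟩
  exact H (q, L, c) ⟨hq, by simpa using hL, by simpa using hc⟩

lemma uniform_jet_derivAlongCurve {r : Cspace d → ℝ} {W : Set (Cspace d)} (hW : IsOpen W)
    (hr : ContDiffOn ℝ ∞ r W) {p : Cspace d} {δ₀ : ℝ} (hball : Metric.closedBall p δ₀ ⊆ W)
    (M C₀ : ℝ) (N n : ℕ) :
    ∃ C > 0, ∃ δ > 0, ∀ q ∈ Metric.closedBall p δ₀, ∀ L : Cspace d →L[ℂ] Cspace d, ‖L‖ ≤ M →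
      ∀ c : Fin N → Cspace d, ‖c‖ ≤ C₀ → ∀ v, ‖v‖ ≤ 1 → ∀ η : Fin N → ℂ, ‖η‖ ≤ C₀ →
      ∃ a : ℕ × ℕ → ℂ, (∀ m, ‖a m‖ ≤ C) ∧ ∀ z : ℂ, ‖z‖ ≤ δ →
        ‖derivAlongCurve r q L c v η z - ∑ m ∈ jetIndex n, a m * monom m z‖
          ≤ C * ‖z‖ ^ (n + 1) := by
  let Φ : (Cspace d × (Cspace d →L[ℂ] Cspace d) × (Fin N → Cspace d) × Cspace d × (Fin N → ℂ)) × ℂ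
      → Cspace d × Cspace d := fun x => (x.1.1 + x.1.2.1 (curve x.1.2.2.1 x.2),
    x.1.2.1 (x.1.2.2.2.1 + scalarPoly x.1.2.2.2.2 x.2 • EuclideanSpace.single 0 1))
  have hΦ : ContDiff ℝ ∞ Φ := by
    have : ContDiff ℂ ∞ Φ := by
      unfold Φ curve scalarPoly
      fun_prop
    exact this.restrict_scalars ℝ
  have hF : ContDiffOn ℝ ∞ (fun x => holDeriv r (Φ x).1 (Φ x).2) (Φ ⁻¹' (W ×ˢ univ)) :=
    (contDiffOn_holDeriv hW hr).comp hΦ.contDiffOn fun x hx => hx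
  obtain ⟨C, hC, δ, hδ, H⟩ := exists_uniform_jet
    ((hW.prod isOpen_univ).preimage hΦ.continuous) hF
    (K := Metric.closedBall p δ₀ ×ˢ Metric.closedBall 0 M ×ˢ Metric.closedBall 0 C₀ ×ˢ
      Metric.closedBall 0 1 ×ˢ Metric.closedBall 0 C₀)
    ((isCompact_closedBall _ _).prod ((isCompact_closedBall _ _).prod
      ((isCompact_closedBall _ _).prod ((isCompact_closedBall _ _).prod
        (isCompact_closedBall _ _)))))
    (by
      rintro ⟨q, L, c, v, η⟩ ⟨hq, -⟩
      simpa [Φ, curve_zero] using hball hq) n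
  refine ⟨C, hC, δ, hδ, fun q hq L hL c hc v hv η hη => ?_⟩
  exact H (q, L, c, v, η)
    ⟨hq, by simpa using hL, by simpa using hc, by simpa using hv, by simpa using hη⟩

/-! #### Functions without pure terms -/

/-- Up to order `k`, the expansion of `F` has only mixed terms. -/
def NoPure (k : ℕ) (F : ℂ → ℂ) : Prop :=
  ∃ a : ℕ × ℕ → ℂ, (fun z => F z - ∑ m ∈ mixedIndex k, a m * monom m z) =O[𝓝 0]
    fun z : ℂ => ‖z‖ ^ (k + 1)

lemma NoPure.congr {k : ℕ} {F G : ℂ → ℂ} (hF : NoPure k F)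
    (h : (fun z => G z - F z) =O[𝓝 0] fun z : ℂ => ‖z‖ ^ (k + 1)) : NoPure k G := by
  obtain ⟨a, ha⟩ := hF
  exact ⟨a, (ha.add h).congr_left fun z => by ring⟩

lemma isBigO_of_bound {F : ℂ → ℂ} {C δ : ℝ} {k : ℕ} (hδ : 0 < δ)
    (h : ∀ z : ℂ, ‖z‖ ≤ δ → ‖F z‖ ≤ C * ‖z‖ ^ k) : F =O[𝓝 0] fun z : ℂ => ‖z‖ ^ k := by
  refine Asymptotics.IsBigO.of_bound C ?_
  filter_upwards [Metric.closedBall_mem_nhds (0 : ℂ) hδ] with z hz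
  rw [norm_pow, norm_norm]
  exact h z (by simpa using hz)

lemma pow_isBigO {j k : ℕ} (h : k ≤ j) :
    (fun z : ℂ => ‖z‖ ^ j) =O[𝓝 0] fun z : ℂ => ‖z‖ ^ k := by
  refine Asymptotics.IsBigO.of_bound 1 ?_
  filter_upwards [Metric.closedBall_mem_nhds (0 : ℂ) one_pos] with z hz
  rw [one_mul, norm_pow, norm_pow, norm_norm]
  exact pow_le_pow_of_le_one (norm_nonneg _) (by simpa using hz) h

lemma NoPure.coeff_eq_zero {k n : ℕ} {F : ℂ → ℂ} (hF : NoPure k F) (hkn : k ≤ n)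
    {a : ℕ × ℕ → ℂ} (ha : (fun z => F z - ∑ m ∈ jetIndex n, a m * monom m z) =O[𝓝 0]
      fun z : ℂ => ‖z‖ ^ (n + 1)) {m : ℕ × ℕ} (hm : m.1 + m.2 ≤ k)
    (hm' : ¬(1 ≤ m.1 ∧ 1 ≤ m.2)) : a m = 0 := by
  obtain ⟨a₀, ha₀⟩ := hF
  have h1 : (fun z => F z - ∑ m ∈ jetIndex n,
      (if m ∈ mixedIndex k then a₀ m else 0) * monom m z) =O[𝓝 0]
      fun z : ℂ => ‖z‖ ^ (k + 1) := by
    refine ha₀.congr_left fun z => ?_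
    simp only [ite_mul, zero_mul]
    rw [← Finset.sum_filter]
    congr 2
    ext m
    simp only [mem_mixedIndex, Finset.mem_filter, mem_jetIndex]
    omega
  have h2 := jet_unique (ha.trans (pow_isBigO (by omega))) h1 m (mem_jetIndex.2 (by omega)) hm
  rw [h2, if_neg]
  rw [mem_mixedIndex]
  tauto

lemma sum_jetIndex_succ_of_pure_zero {k : ℕ} {a : ℕ × ℕ → ℂ}
    (h : ∀ m : ℕ × ℕ, m.1 + m.2 ≤ k → ¬(1 ≤ m.1 ∧ 1 ≤ m.2) → a m = 0) (z : ℂ) :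
    ∑ m ∈ jetIndex (k + 1), a m * monom m z = ∑ m ∈ mixedIndex (k + 1), a m * monom m z
      + a (k + 1, 0) * z ^ (k + 1) + a (0, k + 1) * starRingEnd ℂ z ^ (k + 1) := by
  rw [← Finset.sum_filter_add_sum_filter_not (jetIndex (k + 1)) fun m => 1 ≤ m.1 ∧ 1 ≤ m.2,
    add_assoc]
  congr 1
  have hsub : ({(k + 1, 0), (0, k + 1)} : Finset (ℕ × ℕ)) ⊆
      (jetIndex (k + 1)).filter fun m => ¬(1 ≤ m.1 ∧ 1 ≤ m.2) := by
    intro m hm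
    simp only [Finset.mem_insert, Finset.mem_singleton] at hm
    rcases hm with rfl | rfl <;> simp [mem_jetIndex]
  rw [← Finset.sum_subset hsub, Finset.sum_pair (by simp)]
  · simp [monom]
  · intro m hm hm'
    rw [Finset.mem_filter, mem_jetIndex] at hm
    simp only [Finset.mem_insert, Finset.mem_singleton, not_or, Prod.ext_iff] at hm'
    rw [h m (by omega) hm.2, zero_mul]

lemma sum_jetIndex_of_pure_zero {k : ℕ} {a : ℕ × ℕ → ℂ}
    (h : ∀ m : ℕ × ℕ, m.1 + m.2 ≤ k → ¬(1 ≤ m.1 ∧ 1 ≤ m.2) → a m = 0) (z : ℂ) :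
    ∑ m ∈ jetIndex k, a m * monom m z = ∑ m ∈ mixedIndex k, a m * monom m z := by
  symm
  refine Finset.sum_subset (Finset.filter_subset _ _) fun m hm hm' => ?_
  rw [mem_jetIndex] at hm
  rw [h m hm (by rw [mem_mixedIndex] at hm'; tauto), zero_mul]

/-- Removing the pure terms of the next order. -/
lemma NoPure.succ {k : ℕ} {F : ℂ → ℂ} (hF : NoPure k F) {a : ℕ × ℕ → ℂ}
    (ha : (fun z => F z - ∑ m ∈ jetIndex (k + 1), a m * monom m z) =O[𝓝 0]
      fun z : ℂ => ‖z‖ ^ (k + 2)) :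
    NoPure (k + 1) fun z =>
      F z - (a (k + 1, 0) * z ^ (k + 1) + a (0, k + 1) * starRingEnd ℂ z ^ (k + 1)) := by
  refine ⟨a, ha.congr_left fun z => ?_⟩
  rw [sum_jetIndex_succ_of_pure_zero (fun m hm hm' => hF.coeff_eq_zero (by omega) ha hm hm')]
  ring

lemma monom_conj (m : ℕ × ℕ) (z : ℂ) : starRingEnd ℂ (monom m z) = monom m.swap z := by
  simp [monom, mul_comm]

/-- Modifying a curve changes r by a real part. Taking real parts of the complex correction of
`NoPure.succ` avoids proving that the two pure coefficients of a real function are conjugate. -/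
lemma NoPure.re {k : ℕ} {F : ℂ → ℂ} (hF : NoPure k F) : NoPure k fun z => ((F z).re : ℂ) := by
  obtain ⟨a, ha⟩ := hF
  refine ⟨fun m => (a m + starRingEnd ℂ (a m.swap)) / 2, ?_⟩
  have h2 : (fun z => starRingEnd ℂ (F z - ∑ m ∈ mixedIndex k, a m * monom m z)) =O[𝓝 0]
      fun z : ℂ => ‖z‖ ^ (k + 1) := by
    refine Asymptotics.IsBigO.of_norm_left ?_
    simpa only [RCLike.norm_conj] using ha.norm_left
  refine ((ha.add h2).const_mul_left (1 / 2)).congr_left fun z => ?_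
  have e : starRingEnd ℂ (∑ m ∈ mixedIndex k, a m * monom m z) =
      ∑ m ∈ mixedIndex k, starRingEnd ℂ (a m.swap) * monom m z := by
    rw [map_sum]
    refine Finset.sum_bij' (fun m _ => m.swap) (fun m _ => m.swap) ?_ ?_ ?_ ?_ ?_
    · intro m hm; rw [mem_mixedIndex] at hm ⊢; simp only [Prod.fst_swap, Prod.snd_swap]; omega
    · intro m hm; rw [mem_mixedIndex] at hm ⊢; simp only [Prod.fst_swap, Prod.snd_swap]; omega
    · intro m _; simp
    · intro m _; simp
    · intro m _; simp [monom_conj]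
  have e2 : ((F z).re : ℂ) = (F z + starRingEnd ℂ (F z)) / 2 := by rw [add_conj]; simp
  dsimp only
  rw [map_sub, e, e2]
  have e3 : ∑ m ∈ mixedIndex k, (a m + starRingEnd ℂ (a m.swap)) / 2 * monom m z =
      (∑ m ∈ mixedIndex k, a m * monom m z
        + ∑ m ∈ mixedIndex k, starRingEnd ℂ (a m.swap) * monom m z) / 2 := by
    rw [← Finset.sum_add_distrib, Finset.sum_div]
    exact Finset.sum_congr rfl fun m _ => by ring
  rw [e3]
  ring

/-! #### The variation of the jets -/

/-- A new term of order k + 1 is felt, up to order k + 2, only through the derivative at the fixed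
base point: moving the base by O(|z|) changes the derivative by O(|z|). This makes each step of the
construction a linear problem at q. -/
lemma incr_isBigO {E F : Type*} [NormedAddCommGroup E] [NormedSpace ℝ E] [NormedAddCommGroup F]
    [NormedSpace ℝ F] {f : E → F} {x : E} (hf : ContDiffAt ℝ 2 f x) {u h : ℂ → E} {k : ℕ}
    (hu : u =O[𝓝 0] fun z : ℂ => ‖z‖) (hh : h =O[𝓝 0] fun z : ℂ => ‖z‖ ^ (k + 1)) :
    (fun z => f (x + u z + h z) - f (x + u z) - fderiv ℝ f x (h z)) =O[𝓝 0]
      fun z : ℂ => ‖z‖ ^ (k + 2) := by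
  have h1 : DifferentiableAt ℝ (fderiv ℝ f) x :=
    (hf.fderiv_right (m := 1) (by norm_num)).differentiableAt (by simp)
  obtain ⟨C, hC⟩ := h1.isBigO_sub.bound
  have h4 : ∀ᶠ y in 𝓝 x, DifferentiableAt ℝ f y := by
    filter_upwards [hf.eventually (by simp)] with y hy using hy.differentiableAt (by simp)
  obtain ⟨ρ, hρ, hball⟩ := Metric.eventually_nhds_iff_ball.1 (hC.and h4)
  obtain ⟨C₁, hC₁, hu'⟩ := hu.exists_pos
  obtain ⟨C₂, hC₂, hh'⟩ := hh.exists_pos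
  have hnorm : Tendsto (fun z : ℂ => ‖z‖) (𝓝 0) (𝓝 0) := by simpa using tendsto_norm (x := (0 : ℂ))
  have hsmall : ∀ᶠ z : ℂ in 𝓝 0, (C₁ + C₂) * ‖z‖ < ρ := by
    have := hnorm.const_mul (C₁ + C₂)
    rw [mul_zero] at this
    exact this.eventually (gt_mem_nhds hρ)
  refine Asymptotics.IsBigO.of_bound ((|C| * (C₁ + C₂)) * C₂) ?_
  filter_upwards [hu'.bound, hh'.bound, hsmall, Metric.closedBall_mem_nhds (0 : ℂ) one_pos]
    with z hz1 hz2 hz3 hz4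
  have hz4 : ‖z‖ ≤ 1 := by simpa using hz4
  rw [norm_norm] at hz1
  rw [norm_pow, norm_norm] at hz2
  have hz2' : ‖h z‖ ≤ C₂ * ‖z‖ := by
    refine hz2.trans (mul_le_mul_of_nonneg_left ?_ hC₂.le)
    rw [pow_succ]
    exact mul_le_of_le_one_left (norm_nonneg _) (pow_le_one₀ (norm_nonneg _) hz4)
  have hseg : ∀ y ∈ segment ℝ (x + u z) (x + u z + h z), ‖y - x‖ ≤ (C₁ + C₂) * ‖z‖ := by
    intro y hy
    obtain ⟨θ, hθ, rfl⟩ := (segment_eq_image' ℝ _ _).subset hy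
    have : x + u z + θ • (x + u z + h z - (x + u z)) - x = u z + θ • h z := by
      rw [add_sub_cancel_left]; abel
    simp only [this]
    refine (norm_add_le _ _).trans ?_
    rw [norm_smul, Real.norm_of_nonneg hθ.1, add_mul]
    exact add_le_add hz1 ((mul_le_of_le_one_left (norm_nonneg _) hθ.2).trans hz2')
  have hin : ∀ y ∈ segment ℝ (x + u z) (x + u z + h z), y ∈ Metric.ball x ρ := fun y hy => by
    rw [Metric.mem_ball, dist_eq_norm]
    exact (hseg y hy).trans_lt hz3
  have key := (convex_segment (x + u z) (x + u z + h z)).norm_image_sub_le_of_norm_hasFDerivWithin_le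
    (f := fun y => f y - fderiv ℝ f x y) (f' := fun y => fderiv ℝ f y - fderiv ℝ f x)
    (C := |C| * ((C₁ + C₂) * ‖z‖))
    (fun y hy => ((hball y (hin y hy)).2.hasFDerivAt.sub
      (fderiv ℝ f x).hasFDerivAt).hasFDerivWithinAt)
    (fun y hy => (hball y (hin y hy)).1.trans <| by
      calc C * ‖y - x‖ ≤ |C| * ‖y - x‖ := mul_le_mul_of_nonneg_right (le_abs_self C) (norm_nonneg _)
        _ ≤ _ := mul_le_mul_of_nonneg_left (hseg y hy) (abs_nonneg _))
    (left_mem_segment ℝ _ _) (right_mem_segment ℝ _ _)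
  rw [add_sub_cancel_left] at key
  have e : f (x + u z + h z) - f (x + u z) - fderiv ℝ f x (h z) =
      f (x + u z + h z) - fderiv ℝ f x (x + u z + h z) - (f (x + u z) - fderiv ℝ f x (x + u z)) := by
    rw [map_add _ (x + u z)]; abel
  rw [e, norm_pow, norm_norm]
  refine key.trans ?_
  calc |C| * ((C₁ + C₂) * ‖z‖) * ‖h z‖ ≤ |C| * ((C₁ + C₂) * ‖z‖) * (C₂ * ‖z‖ ^ (k + 1)) :=
        mul_le_mul_of_nonneg_left hz2 (by positivity)
    _ = _ := by ring

/-- The derivative of `∂r(·)[v]` in the direction `h`. -/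
noncomputable def holHess (r : Cspace d → ℝ) (q h v : Cspace d) : ℂ :=
  (1 / 2) * ((hess r q h v : ℂ) - I * (hess r q h (I • v) : ℂ))

lemma fderiv_holDeriv_pair {r : Cspace d → ℝ} {q : Cspace d} (hr : ContDiffAt ℝ 2 r q)
    (v h w : Cspace d) :
    fderiv ℝ (fun y : Cspace d × Cspace d => holDeriv r y.1 y.2) (q, v) (h, w) =
      holHess r q h v + holDeriv r q w := by
  have h2 : HasFDerivAt (fderiv ℝ r) (hess r q) q :=
    ((hr.fderiv_right (m := 1) (by norm_num)).differentiableAt (by simp)).hasFDerivAt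
  have h3 : HasFDerivAt (fun y : Cspace d × Cspace d => fderiv ℝ r y.1)
      ((hess r q).comp (ContinuousLinearMap.fst ℝ _ _)) (q, v) :=
    h2.comp (q, v) hasFDerivAt_fst
  have h4 := h3.clm_apply (hasFDerivAt_snd (𝕜 := ℝ) (p := (q, v)))
  have h5 : HasFDerivAt (fun y : Cspace d × Cspace d => I • y.2)
      (I • ContinuousLinearMap.snd ℝ (Cspace d) (Cspace d)) (q, v) := hasFDerivAt_snd.const_smul I
  have h6 := h3.clm_apply h5
  have h7 := (((ofRealCLM.hasFDerivAt.comp _ h4).sub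
    ((ofRealCLM.hasFDerivAt.comp _ h6).const_mul I)).const_mul (1 / 2))
  have h8 : HasFDerivAt (fun y : Cspace d × Cspace d => holDeriv r y.1 y.2) _ (q, v) := h7
  rw [h8.fderiv]
  simp [holHess, holDeriv]
  ring

/-- The real linear dependence on c splits into a complex linear and an antilinear part, and the
latter is the Levi form. With c = z^(k+1), the Levi form therefore governs the z̄^(k+1) term of the
derivative. -/
lemma holHess_smul {r : Cspace d → ℝ} {q : Cspace d} (hr : ContDiffAt ℝ 2 r q) (c : ℂ)
    (h v : Cspace d) :
    holHess r q (c • h) v = c * ((1 / 2) * (holHess r q h v - I * holHess r q (I • h) v))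
      + starRingEnd ℂ c * leviH r q v h := by
  have e : leviH r q v h = (1 / 2) * (holHess r q h v + I * holHess r q (I • h) v) := by
    simp only [leviH, holHess, hess_symm hr v, hess_symm hr (I • v)]
    push_cast
    linear_combination (1 / 4) * (hess r q (I • h) (I • v) : ℂ) * I_sq
  have e2 : holHess r q (c • h) v = c.re * holHess r q h v + c.im * holHess r q (I • h) v := by
    rw [complex_smul_eq c h]
    simp only [holHess, map_add, map_smul, add_apply, smul_apply, smul_eq_mul]
    push_cast
    ring
  rw [e2, e]
  have hc : starRingEnd ℂ c = c.re - c.im * I := by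
    conv_lhs => rw [← re_add_im c, map_add, map_mul, conj_ofReal, conj_ofReal, conj_I]
    ring
  rw [hc]
  conv_rhs => rw [← re_add_im c]
  simp only [add_re, ofReal_re, mul_re, I_re, mul_zero, ofReal_im, I_im, mul_one, sub_self,
    add_zero, add_im, mul_im, zero_add]
  linear_combination ((c.im : ℂ) * holHess r q (I • h) v) * I_sq

lemma norm_holHess_le (r : Cspace d → ℝ) (q h v : Cspace d) :
    ‖holHess r q h v‖ ≤ ‖hess r q‖ * ‖h‖ * ‖v‖ := by
  have h1 := (hess r q).le_opNorm₂ h v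
  have h2 := (hess r q).le_opNorm₂ h (I • v)
  rw [norm_smul, norm_I, one_mul] at h2
  rw [holHess, norm_mul]
  have h3 := norm_sub_le (hess r q h v : ℂ) (I * (hess r q h (I • v) : ℂ))
  rw [norm_mul, norm_I, one_mul, norm_real, norm_real] at h3
  have h4 : ‖(1 / 2 : ℂ)‖ = 1 / 2 := by norm_num
  rw [h4]
  linarith

lemma norm_leviH_le {r : Cspace d → ℝ} {q : Cspace d} (hr : ContDiffAt ℝ 2 r q)
    (v h : Cspace d) : ‖leviH r q v h‖ ≤ ‖hess r q‖ * ‖v‖ * ‖h‖ := by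
  have e : leviH r q v h = (1 / 2) * (holHess r q h v + I * holHess r q (I • h) v) := by
    simp only [leviH, holHess, hess_symm hr v, hess_symm hr (I • v)]
    push_cast
    linear_combination (1 / 4) * (hess r q (I • h) (I • v) : ℂ) * I_sq
  have h1 := norm_holHess_le r q h v
  have h2 := norm_holHess_le r q (I • h) v
  rw [norm_smul, norm_I, one_mul] at h2
  have h3 := norm_add_le (holHess r q h v) (I * holHess r q (I • h) v)
  rw [norm_mul, norm_I, one_mul] at h3
  rw [e, norm_mul]
  have h4 : ‖(1 / 2 : ℂ)‖ = 1 / 2 := by norm_num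
  rw [h4]
  linarith

end

/-! ### Construction of the normal curves, one degree at a time -/

section

variable {d N : ℕ}

/-- A linear frame at the boundary point `q` adapted to the Levi form: `∂r(q) ∘ L = z_0 / 2`, and
the Levi form is bounded below in the directions `e_2, …, e_d`. -/
structure IsAdapted (r : Cspace d → ℝ) (q : Cspace d) (L : Cspace d →L[ℂ] Cspace d) : Prop where
  map_eq_zero : r q = 0
  holDeriv_eq : ∀ z, holDeriv r q (L z) = z 0 / 2
  levi_ge : ∀ z : Cspace d, z 0 = 0 → z 1 = 0 →
    1 / 2 * ‖z‖ ^ 2 ≤ (leviH r q (L z) (L z)).re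

/-- The lower bound on the Levi form makes the matrix of the form on e_2, …, e_d injective, hence
invertible, and at the same time bounds the solution independently of q and L. -/
lemma IsAdapted.exists_levi_eq {r : Cspace d → ℝ} {q : Cspace d} {L : Cspace d →L[ℂ] Cspace d}
    (h : IsAdapted r q L) (hr : ContDiffAt ℝ 2 r q) (b : Fin (d + 1) → ℂ) {B : ℝ}
    (hb : ∀ α, ‖b α‖ ≤ B) :
    ∃ w : Cspace d, w 0 = 0 ∧ w 1 = 0 ∧ ‖w‖ ≤ 2 * ((d + 1) * B) ∧
      ∀ α : Fin (d + 1), 2 ≤ (α : ℕ) →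
        leviH r q (L (EuclideanSpace.single α 1)) (L w) = b α := by
  have hB : 0 ≤ B := (norm_nonneg _).trans (hb 0)
  let ι := {α : Fin (d + 1) // 2 ≤ (α : ℕ)}
  let emb : (ι → ℂ) →ₗ[ℂ] Cspace d :=
    ∑ α : ι, (LinearMap.proj α).smulRight (EuclideanSpace.single α.1 (1 : ℂ) : Cspace d)
  have hemb : ∀ x, emb x = ∑ α : ι, x α • (EuclideanSpace.single α.1 (1 : ℂ) : Cspace d) := by
    intro x; simp [emb]
  have hemb_apply : ∀ x j, emb x j = if hj : 2 ≤ (j : ℕ) then x ⟨j, hj⟩ else 0 := by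
    intro x j
    rw [hemb]
    simp only [WithLp.ofLp_sum, Finset.sum_apply, PiLp.smul_apply, PiLp.single_apply,
      smul_eq_mul, mul_ite, mul_one, mul_zero]
    split_ifs with hj
    · rw [Finset.sum_eq_single ⟨j, hj⟩]
      · simp
      · intro β _ hβ
        rw [if_neg]
        rintro rfl
        exact hβ rfl
      · simp
    · refine Finset.sum_eq_zero fun β _ => if_neg ?_
      rintro rfl
      exact hj β.2
  have h0 : ∀ x, emb x 0 = 0 := fun x => by rw [hemb_apply, dif_neg (by simp)]
  have h1 : ∀ x, emb x 1 = 0 := fun x => by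
    rw [hemb_apply, dif_neg]
    have := Nat.mod_le 1 (d + 1)
    simp only [Fin.val_one']
    omega
  let T : (ι → ℂ) →ₗ[ℂ] ι → ℂ := LinearMap.pi fun α =>
    { toFun := fun x => leviH r q (L (emb x)) (L (EuclideanSpace.single α.1 1))
      map_add' := fun x y => by simp only [map_add, leviH_add_left]
      map_smul' := fun c x => by simp only [map_smul, leviH_smul_left]; rfl }
  have hT : ∀ x α, T x α = leviH r q (L (emb x)) (L (EuclideanSpace.single α.1 1)) :=
    fun x α => rfl
  have hself : ∀ x, leviH r q (L (emb x)) (L (emb x)) = ∑ α, starRingEnd ℂ (x α) * T x α := by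
    intro x
    rw [← leviHₗ_apply]
    conv_lhs => enter [2]; rw [hemb, map_sum]
    rw [map_sum]
    refine Finset.sum_congr rfl fun α _ => ?_
    rw [map_smul, leviHₗ_apply, leviH_smul_right, hT]
  have hle : ∀ x, 1 / 2 * ‖emb x‖ ^ 2 ≤ ‖emb x‖ * ∑ α, ‖T x α‖ := by
    intro x
    refine (h.levi_ge _ (h0 x) (h1 x)).trans ?_
    rw [hself]
    refine (re_le_norm _).trans ((norm_sum_le _ _).trans ?_)
    rw [Finset.mul_sum]
    refine Finset.sum_le_sum fun α _ => ?_
    rw [norm_mul, RCLike.norm_conj]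
    refine mul_le_mul_of_nonneg_right ?_ (norm_nonneg _)
    have := PiLp.norm_apply_le (emb x) α.1
    rwa [hemb_apply, dif_pos α.2] at this
  have hnorm : ∀ x, ‖emb x‖ ≤ 2 * ∑ α, ‖T x α‖ := by
    intro x
    by_contra! hcon
    have hpos : 0 < ‖emb x‖ := lt_of_le_of_lt (by positivity) hcon
    nlinarith [hle x, mul_lt_mul_of_pos_left hcon hpos]
  have hinj : Function.Injective T := by
    rw [← LinearMap.ker_eq_bot, LinearMap.ker_eq_bot']
    intro x hx
    have h2 := hnorm x
    simp only [hx, Pi.zero_apply, norm_zero, Finset.sum_const_zero, mul_zero] at h2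
    have h3 : emb x = 0 := norm_le_zero_iff.1 h2
    ext α
    have h4 := hemb_apply x α.1
    rw [h3, dif_pos α.2] at h4
    exact h4.symm
  -- T places the unknown in the linear first slot, whereas the claim has it in the second;
  -- Hermitian symmetry accounts for the conjugates.
  obtain ⟨x, hx⟩ := (LinearMap.injective_iff_surjective.1 hinj) fun α => starRingEnd ℂ (b α.1)
  refine ⟨emb x, h0 x, h1 x, (hnorm x).trans ?_, fun α hα => ?_⟩
  · refine mul_le_mul_of_nonneg_left ?_ two_pos.le
    calc ∑ α, ‖T x α‖ ≤ ∑ _α : ι, B := Finset.sum_le_sum fun α _ => by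
          rw [hx, RCLike.norm_conj]; exact hb _
      _ = Fintype.card ι * B := by simp
      _ ≤ (d + 1) * B := by
          refine mul_le_mul_of_nonneg_right ?_ hB
          have := Fintype.card_subtype_le fun α : Fin (d + 1) => 2 ≤ (α : ℕ)
          rw [Fintype.card_fin] at this
          exact_mod_cast this
  · have h5 := hT x ⟨α, hα⟩
    rw [hx] at h5
    rw [← leviH_conj hr, ← h5, conj_conj]

lemma curve_isBigO (c : Fin N → Cspace d) : curve c =O[𝓝 0] fun z : ℂ => ‖z‖ := by
  have := (differentiable_curve c 0).isBigO_sub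
  simpa [curve_zero] using this.norm_right

lemma scalarPoly_isBigO (η : Fin N → ℂ) : scalarPoly η =O[𝓝 0] fun z : ℂ => ‖z‖ := by
  have := (differentiable_scalarPoly η 0).isBigO_sub
  simpa [scalarPoly_zero] using this.norm_right

lemma noPure_zero {F : ℂ → ℂ} {a : ℕ × ℕ → ℂ} {C δ : ℝ} (hδ : 0 < δ)
    (ha : ∀ z : ℂ, ‖z‖ ≤ δ → ‖F z - ∑ m ∈ jetIndex 0, a m * monom m z‖ ≤ C * ‖z‖ ^ (0 + 1))
    (h0 : F 0 = 0) : NoPure 0 F := by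
  have e : jetIndex 0 = {(0, 0)} := by
    ext m
    rw [mem_jetIndex, Finset.mem_singleton, Prod.ext_iff]
    simp only
    omega
  have e2 : mixedIndex 0 = ∅ := by
    ext m
    rw [mem_mixedIndex]
    simp only [Finset.notMem_empty, iff_false]
    omega
  have h1 := ha 0 (by simpa using hδ.le)
  simp only [e, Finset.sum_singleton, h0, monom] at h1
  have h2 : a (0, 0) = 0 := by simpa using h1
  refine ⟨0, ?_⟩
  refine isBigO_of_bound (C := C) hδ fun z hz => ?_
  have h3 := ha z hz
  rw [e, Finset.sum_singleton, h2] at h3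
  simpa [e2] using h3

lemma two_le_infty : (2 : WithTop ℕ∞) ≤ (∞ : WithTop ℕ∞) := by
  norm_cast

/-- One step of the construction of normal curves: the pure terms of order `k + 1` are removed. -/
lemma IsAdapted.noPure_step {r : Cspace d → ℝ} {W : Set (Cspace d)} (hW : IsOpen W)
    (hr : ContDiffOn ℝ ∞ r W) {q : Cspace d} (hq : q ∈ W) {L : Cspace d →L[ℂ] Cspace d}
    (h : IsAdapted r q L) (hd : 1 ≤ d) {M H B : ℝ} (hL : ‖L‖ ≤ M) (hH : ‖hess r q‖ ≤ H)
    {k : ℕ} (hk : k < N) {c : Fin N → Cspace d} {η : Fin (d + 1) → Fin N → ℂ}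
    (hc1 : ∀ j, c j 1 = 0)
    (hA : NoPure k fun z => (alongCurve r q L c z : ℂ))
    (hB : ∀ α : Fin (d + 1), 2 ≤ (α : ℕ) →
      NoPure k (derivAlongCurve r q L c (EuclideanSpace.single α 1) (η α)))
    {a : ℕ × ℕ → ℂ} (haB : ∀ m, ‖a m‖ ≤ B)
    (ha : (fun z => (alongCurve r q L c z : ℂ) - ∑ m ∈ jetIndex (k + 1), a m * monom m z)
      =O[𝓝 0] fun z : ℂ => ‖z‖ ^ (k + 2))
    {b : Fin (d + 1) → ℕ × ℕ → ℂ} (hbB : ∀ α m, ‖b α m‖ ≤ B)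
    (hb : ∀ α, (fun z => derivAlongCurve r q L c (EuclideanSpace.single α 1) (η α) z
      - ∑ m ∈ jetIndex (k + 1), b α m * monom m z) =O[𝓝 0] fun z : ℂ => ‖z‖ ^ (k + 2)) :
    ∃ (x : Cspace d) (y : Fin (d + 1) → ℂ),
      ‖x‖ ≤ 2 * B + 2 * ((d + 1) * (B + H * M * (M * (2 * B)))) ∧
      (∀ α, ‖y α‖ ≤ 2 * (B + H * (M * (2 * B + 2 * ((d + 1) * (B + H * M * (M * (2 * B)))))) * M)) ∧
      (∀ j, (c + Pi.single ⟨k, hk⟩ x : Fin N → Cspace d) j 1 = 0) ∧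
      NoPure (k + 1) (fun z => (alongCurve r q L (c + Pi.single ⟨k, hk⟩ x) z : ℂ)) ∧
      ∀ α : Fin (d + 1), 2 ≤ (α : ℕ) → NoPure (k + 1)
        (derivAlongCurve r q L (c + Pi.single ⟨k, hk⟩ x) (EuclideanSpace.single α 1)
          (η α + Pi.single ⟨k, hk⟩ (y α))) := by
  have hr2 : ContDiffAt ℝ 2 r q :=
    (hr.contDiffAt (hW.mem_nhds hq)).of_le two_le_infty
  have hM : 0 ≤ M := (norm_nonneg _).trans hL
  have hH0 : 0 ≤ H := (norm_nonneg (hess r q)).trans hH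
  have hB0 : 0 ≤ B := (norm_nonneg _).trans (haB 0)
  have h01 : (1 : Fin (d + 1)) ≠ 0 := by
    rw [Ne, Fin.ext_iff, Fin.val_one', Fin.val_zero, Nat.mod_eq_of_lt (by omega)]
    exact one_ne_zero
  set e₀ : Cspace d := EuclideanSpace.single 0 1 with he₀
  have hLe : ∀ v, ‖L v‖ ≤ M * ‖v‖ := fun v => (L.le_opNorm v).trans (by gcongr)
  have hsingle : ∀ α : Fin (d + 1), ‖L (EuclideanSpace.single α 1)‖ ≤ M := fun α => by
    simpa using hLe (EuclideanSpace.single α 1)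
  -- Since ∂r(q) ∘ L = z_0 / 2, adding z^(k+1) x to the curve changes r to leading order by
  -- Re(z^(k+1) x_0). This x_0 cancels the real part of both pure terms.
  set s : ℂ := -(a (k + 1, 0) + starRingEnd ℂ (a (0, k + 1))) with hs
  have hsB : ‖s‖ ≤ 2 * B := by
    rw [hs, norm_neg]
    refine (norm_add_le _ _).trans ?_
    rw [RCLike.norm_conj]
    linarith [haB (k + 1, 0), haB (0, k + 1)]
  have hs0 : ‖s • e₀‖ ≤ 2 * B := by rw [norm_smul, he₀]; simpa using hsB
  -- With s fixed, its own Levi contribution is subtracted first. The directions e_2, …, e_d then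
  -- correct the z̄^(k+1) coefficients of the derivatives without touching x_0.
  obtain ⟨w, hw0, hw1, hwB, hw⟩ := h.exists_levi_eq hr2
    (fun α => -b α (0, k + 1) - leviH r q (L (EuclideanSpace.single α 1)) (L (s • e₀)))
    (B := B + H * M * (M * (2 * B))) (fun α => by
      refine (norm_sub_le _ _).trans ?_
      rw [norm_neg]
      refine add_le_add (hbB _ _) ((norm_leviH_le hr2 _ _).trans ?_)
      have h1 := hsingle α
      have h2 : ‖L (s • e₀)‖ ≤ M * (2 * B) := (hLe _).trans (by gcongr)
      gcongr)
  set x : Cspace d := s • e₀ + w with hx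
  have hxB : ‖x‖ ≤ 2 * B + 2 * ((d + 1) * (B + H * M * (M * (2 * B)))) :=
    (norm_add_le _ _).trans (add_le_add hs0 hwB)
  have hx0 : x 0 = s := by simp [hx, he₀, hw0]
  have hx1 : x 1 = 0 := by simp [hx, he₀, hw1, h01]
  have hlevi : ∀ α : Fin (d + 1), 2 ≤ (α : ℕ) →
      leviH r q (L (EuclideanSpace.single α 1)) (L x) = -b α (0, k + 1) := by
    intro α hα
    rw [hx, map_add, leviH_add_right, hw α hα]
    ring
  clear_value x
  let M₁ : Fin (d + 1) → ℂ := fun α =>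
    (1 / 2) * (holHess r q (L x) (L (EuclideanSpace.single α 1))
      - I * holHess r q (I • L x) (L (EuclideanSpace.single α 1)))
  have hM₁ : ∀ α, ‖M₁ α‖ ≤ H * (M * ‖x‖) * M := by
    intro α
    have h1 := norm_holHess_le r q (L x) (L (EuclideanSpace.single α 1))
    have h2 := norm_holHess_le r q (I • L x) (L (EuclideanSpace.single α 1))
    rw [norm_smul, norm_I, one_mul] at h2
    have h3 : ‖hess r q‖ * ‖L x‖ * ‖L (EuclideanSpace.single α 1)‖ ≤ H * (M * ‖x‖) * M := by
      have := hsingle α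
      have := hLe x
      gcongr
    have h4 := norm_sub_le (holHess r q (L x) (L (EuclideanSpace.single α 1)))
      (I * holHess r q (I • L x) (L (EuclideanSpace.single α 1)))
    rw [norm_mul, norm_I, one_mul] at h4
    have h5 : ‖(1 / 2 : ℂ)‖ = 1 / 2 := by norm_num
    simp only [M₁, norm_mul, h5]
    linarith
  -- The z^(k+1) coefficient of the derivative becomes b + M₁ + y/2, the factor 1/2 being ∂r(q)[L
  -- e_0].
  let y : Fin (d + 1) → ℂ := fun α => -2 * (b α (k + 1, 0) + M₁ α)
  have hhO : (fun z : ℂ => z ^ (k + 1) • L x) =O[𝓝 0] fun z : ℂ => ‖z‖ ^ (k + 1) := by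
    refine Asymptotics.IsBigO.of_bound ‖L x‖ (Eventually.of_forall fun z => ?_)
    rw [norm_smul, norm_pow, norm_pow, norm_norm, mul_comm]
  have huO : (fun z : ℂ => L (curve c z)) =O[𝓝 0] fun z : ℂ => ‖z‖ :=
    (L.isBigO_comp _ _).trans (curve_isBigO c)
  have hcurve : ∀ z, q + L (curve (c + Pi.single ⟨k, hk⟩ x) z)
      = q + L (curve c z) + z ^ (k + 1) • L x := fun z => by
    rw [curve_add_single, map_add, map_smul, add_assoc]
  refine ⟨x, y, hxB, fun α => ?_, fun j => ?_, ?_, fun α hα => ?_⟩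
  · simp only [y, norm_mul, norm_neg, RCLike.norm_ofNat]
    refine mul_le_mul_of_nonneg_left ((norm_add_le _ _).trans
      (add_le_add (hbB _ _) ((hM₁ α).trans ?_))) two_pos.le
    gcongr
  · rw [Pi.add_apply, PiLp.add_apply, hc1, zero_add]
    by_cases hj : j = ⟨k, hk⟩
    · subst hj; simpa using hx1
    · simp [hj]
  · have h1 := (hA.succ ha).re
    refine h1.congr ?_
    have h2 := incr_isBigO hr2 huO hhO
    have h3 := ofRealCLM.isBigO_comp
      (fun z => r (q + L (curve c z) + z ^ (k + 1) • L x) - r (q + L (curve c z))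
        - fderiv ℝ r q (z ^ (k + 1) • L x)) (𝓝 (0 : ℂ))
    refine (h3.trans h2).congr_left fun z => ?_
    simp only [ofRealCLM_apply]
    have e1 : fderiv ℝ r q (z ^ (k + 1) • L x) = (z ^ (k + 1) * s).re := by
      rw [fderiv_eq_two_re_holDeriv, ← map_smul, h.holDeriv_eq, PiLp.smul_apply, hx0, smul_eq_mul]
      rw [show z ^ (k + 1) * s / 2 = ((1 / 2 : ℝ) : ℂ) * (z ^ (k + 1) * s) by push_cast; ring,
        re_ofReal_mul]
      ring
    have e2 : (a (k + 1, 0) * z ^ (k + 1) + a (0, k + 1) * starRingEnd ℂ z ^ (k + 1)).re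
        = -(z ^ (k + 1) * s).re := by
      have : (a (0, k + 1) * starRingEnd ℂ z ^ (k + 1)).re
          = (starRingEnd ℂ (a (0, k + 1)) * z ^ (k + 1)).re := by
        rw [← conj_re, map_mul, map_pow, conj_conj]
      rw [add_re, this, ← add_re, ← neg_re, hs]
      congr 1
      ring
    simp only [alongCurve]
    rw [hcurve, e1, sub_re, ofReal_re, e2]
    push_cast
    ring
  · have h1 := (hB α hα).succ (hb α)
    refine h1.congr ?_
    have hpair : ContDiffAt ℝ 2 (fun y : Cspace d × Cspace d => holDeriv r y.1 y.2)
        (q, L (EuclideanSpace.single α 1)) :=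
      ((contDiffOn_holDeriv hW hr).contDiffAt ((hW.prod isOpen_univ).mem_nhds ⟨hq, mem_univ _⟩)).of_le two_le_infty
    have hu2 : (fun z : ℂ => (L (curve c z), scalarPoly (η α) z • L e₀)) =O[𝓝 0]
        fun z : ℂ => ‖z‖ := by
      refine huO.prod_left ?_
      refine (Asymptotics.IsBigO.of_bound ‖L e₀‖ (Eventually.of_forall fun z => ?_)).trans
        (scalarPoly_isBigO (η α))
      rw [norm_smul, mul_comm]
    have hh2 : (fun z : ℂ => (z ^ (k + 1) • L x, (z ^ (k + 1) * y α) • L e₀)) =O[𝓝 0]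
        fun z : ℂ => ‖z‖ ^ (k + 1) := by
      refine hhO.prod_left ?_
      refine Asymptotics.IsBigO.of_bound (‖y α‖ * ‖L e₀‖) (Eventually.of_forall fun z => ?_)
      rw [norm_smul, norm_mul, norm_pow, norm_pow, norm_norm]
      exact le_of_eq (by ring)
    refine (incr_isBigO hpair hu2 hh2).congr_left fun z => ?_
    rw [fderiv_holDeriv_pair hr2, holHess_smul hr2, hlevi α hα, holDeriv_smul, h.holDeriv_eq]
    simp only [derivAlongCurve, Prod.mk_add_mk]
    have hlin : ∀ t : ℂ, L (EuclideanSpace.single α 1 + t • EuclideanSpace.single 0 1)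
        = L (EuclideanSpace.single α 1) + t • L e₀ := fun t => by rw [map_add, map_smul]
    rw [hcurve, scalarPoly_add_single, hlin, hlin, add_smul, he₀]
    simp only [M₁, y, PiLp.single_apply, map_pow, ← add_assoc]
    simp only [if_true]
    ring

lemma exists_hess_bound {r : Cspace d → ℝ} {W : Set (Cspace d)} (hW : IsOpen W)
    (hr : ContDiffOn ℝ ∞ r W) {K : Set (Cspace d)} (hK : IsCompact K) (hKW : K ⊆ W) :
    ∃ H, ∀ q ∈ K, ‖hess r q‖ ≤ H :=
  hK.exists_bound_of_continuousOn
    (((hr.fderiv_of_isOpen hW (m := ∞) (by simp)).fderiv_of_isOpen hW (m := ∞)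
      (by simp)).continuousOn.mono hKW)

/-- Normal curves to order `k`, with uniform bounds. -/
lemma exists_noPure {r : Cspace d → ℝ} {W : Set (Cspace d)} (hW : IsOpen W)
    (hr : ContDiffOn ℝ ∞ r W) (hd : 1 ≤ d) {p : Cspace d} {δ₀ : ℝ}
    (hball : Metric.closedBall p δ₀ ⊆ W) (M : ℝ) (N : ℕ) : ∀ k ≤ N, ∃ C₀, 0 ≤ C₀ ∧
      ∀ q ∈ Metric.closedBall p δ₀, ∀ L : Cspace d →L[ℂ] Cspace d, ‖L‖ ≤ M → IsAdapted r q L →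
        ∃ (c : Fin N → Cspace d) (η : Fin (d + 1) → Fin N → ℂ), ‖c‖ ≤ C₀ ∧ (∀ α, ‖η α‖ ≤ C₀) ∧
          (∀ j, c j 1 = 0) ∧ NoPure k (fun z => (alongCurve r q L c z : ℂ)) ∧
          ∀ α : Fin (d + 1), 2 ≤ (α : ℕ) →
            NoPure k (derivAlongCurve r q L c (EuclideanSpace.single α 1) (η α)) := by
  intro k
  induction k with
  | zero =>
    intro _
    refine ⟨0, le_rfl, fun q hq L hL h => ⟨0, 0, by simp, by simp, by simp, ?_, fun α hα => ?_⟩⟩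
    · obtain ⟨C, -, δ, hδ, H⟩ := uniform_jet_alongCurve hW hr hball M 0 N 0
      obtain ⟨a, -, ha⟩ := H q hq L hL 0 (by simp)
      exact noPure_zero hδ ha (by simp [alongCurve, curve_zero, h.map_eq_zero])
    · obtain ⟨C, -, δ, hδ, H⟩ := uniform_jet_derivAlongCurve hW hr hball M 0 N 0
      obtain ⟨a, -, ha⟩ := H q hq L hL 0 (by simp) (EuclideanSpace.single α 1) (by simp) 0 (by simp)
      refine noPure_zero hδ ha ?_
      have : (0 : Fin (d + 1)) ≠ α := by rintro rfl; simp at hα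
      simp [derivAlongCurve, curve_zero, scalarPoly_zero, h.holDeriv_eq, this]
  | succ k ih =>
    intro hk
    obtain ⟨C₀, hC₀, IH⟩ := ih (by omega)
    -- The curves found so far are bounded by C₀, so their jets of the next order are bounded
    -- uniformly, and so are the corrections computed from them.
    obtain ⟨C₁, hC₁, δ₁, hδ₁, H₁⟩ := uniform_jet_alongCurve hW hr hball M C₀ N (k + 1)
    obtain ⟨C₂, hC₂, δ₂, hδ₂, H₂⟩ := uniform_jet_derivAlongCurve hW hr hball M C₀ N (k + 1)
    obtain ⟨H, hH⟩ := exists_hess_bound hW hr (isCompact_closedBall p δ₀) hball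
    set B := max C₁ C₂ with hB
    set X := 2 * B + 2 * ((d + 1) * (B + H * M * (M * (2 * B)))) with hX
    refine ⟨C₀ + |X| + |2 * (B + H * (M * X) * M)|, by positivity, fun q hq L hL h => ?_⟩
    obtain ⟨c, η, hc, hη, hc1, hA, hD⟩ := IH q hq L hL h
    obtain ⟨a, haB, ha⟩ := H₁ q hq L hL c hc
    choose b hbB hb using fun α : Fin (d + 1) =>
      H₂ q hq L hL c hc (EuclideanSpace.single α 1) (by simp) (η α) (hη α)
    have haB' : ∀ m, ‖a m‖ ≤ B := fun m => (haB m).trans (le_max_left C₁ C₂)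
    have hbB' : ∀ α m, ‖b α m‖ ≤ B := fun α m => (hbB α m).trans (le_max_right C₁ C₂)
    have ha' := isBigO_of_bound hδ₁ ha
    have hb' := fun α => isBigO_of_bound hδ₂ (hb α)
    clear_value B
    obtain ⟨x, y, hx, hy, h1, h2, h3⟩ := h.noPure_step hW hr (hball hq) hd hL (hH q hq) hk hc1 hA hD
      haB' ha' hbB' hb'
    rw [← hX] at hx hy
    clear_value X
    refine ⟨c + Pi.single (⟨k, hk⟩ : Fin N) x, fun α => η α + Pi.single (⟨k, hk⟩ : Fin N) (y α),
      ?_, fun α => ?_, ?_, ?_, ?_⟩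
    rotate_left 2
    · exact h1
    · exact h2
    · exact h3
    · refine (norm_add_le _ _).trans ?_
      rw [Pi.norm_single]
      have := hx.trans (le_abs_self _)
      have := abs_nonneg (2 * (B + H * (M * X) * M))
      linarith
    · refine (norm_add_le _ _).trans ?_
      rw [Pi.norm_single]
      have := (hy α).trans (le_abs_self _)
      have := abs_nonneg X
      linarith [hη α]

/-- Normal curves: the jets of order `N` along them have only mixed terms. -/
theorem exists_normal_curve {r : Cspace d → ℝ} {W : Set (Cspace d)} (hW : IsOpen W)
    (hr : ContDiffOn ℝ ∞ r W) (hd : 1 ≤ d) {p : Cspace d} {δ₀ : ℝ}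
    (hball : Metric.closedBall p δ₀ ⊆ W) (M : ℝ) (N : ℕ) : ∃ C > 0, ∃ δ > 0,
      ∀ q ∈ Metric.closedBall p δ₀, ∀ L : Cspace d →L[ℂ] Cspace d, ‖L‖ ≤ M → IsAdapted r q L →
        ∃ (c : Fin N → Cspace d) (η : Fin (d + 1) → Fin N → ℂ) (a : ℕ × ℕ → ℂ)
          (b : Fin (d + 1) → ℕ × ℕ → ℂ),
          ‖c‖ ≤ C ∧ (∀ α, ‖η α‖ ≤ C) ∧ (∀ j, c j 1 = 0) ∧
          (∀ z : ℂ, ‖z‖ ≤ δ →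
            ‖(alongCurve r q L c z : ℂ) - ∑ m ∈ mixedIndex N, a m * monom m z‖
              ≤ C * ‖z‖ ^ (N + 1)) ∧
          ∀ α : Fin (d + 1), 2 ≤ (α : ℕ) → ∀ z : ℂ, ‖z‖ ≤ δ →
            ‖derivAlongCurve r q L c (EuclideanSpace.single α 1) (η α) z
              - ∑ m ∈ mixedIndex N, b α m * monom m z‖ ≤ C * ‖z‖ ^ (N + 1) := by
  obtain ⟨C₀, hC₀, H₀⟩ := exists_noPure hW hr hd hball M N N le_rfl
  obtain ⟨C₁, hC₁, δ₁, hδ₁, H₁⟩ := uniform_jet_alongCurve hW hr hball M C₀ N N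
  obtain ⟨C₂, hC₂, δ₂, hδ₂, H₂⟩ := uniform_jet_derivAlongCurve hW hr hball M C₀ N N
  refine ⟨C₀ + C₁ + C₂, by positivity, min δ₁ δ₂, lt_min hδ₁ hδ₂, fun q hq L hL h => ?_⟩
  obtain ⟨c, η, hc, hη, hc1, hA, hD⟩ := H₀ q hq L hL h
  obtain ⟨a, -, ha⟩ := H₁ q hq L hL c hc
  choose b _ hb using fun α : Fin (d + 1) =>
    H₂ q hq L hL c hc (EuclideanSpace.single α 1) (by simp) (η α) (hη α)
  refine ⟨c, η, a, b, by linarith, fun α => by linarith [hη α], hc1,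
    fun z hz => ?_, fun α hα z hz => ?_⟩
  · rw [← sum_jetIndex_of_pure_zero fun m hm hm' =>
      hA.coeff_eq_zero le_rfl (isBigO_of_bound hδ₁ ha) hm hm']
    refine (ha z (hz.trans (min_le_left _ _))).trans ?_
    gcongr
    linarith
  · rw [← sum_jetIndex_of_pure_zero fun m hm hm' =>
      (hD α hα).coeff_eq_zero le_rfl (isBigO_of_bound hδ₂ (hb α)) hm hm']
    refine (hb α z (hz.trans (min_le_right _ _))).trans ?_
    gcongr
    linarith

end

section

variable {d N : ℕ}

/-! ### Polynomial coordinates and dilations -/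

/-- The indices `2, …, d`. -/
abbrev starIndex (d : ℕ) : Finset (Fin (d + 1)) :=
  Finset.univ.filter fun α : Fin (d + 1) => 2 ≤ (α : ℕ)

/-- The projection `z ↦ (0, 0, z_2, …, z_d)`. -/
noncomputable def starProj (d : ℕ) : Cspace d →L[ℂ] Cspace d :=
  ∑ α ∈ starIndex d, (EuclideanSpace.proj α : Cspace d →L[ℂ] ℂ).smulRight
    (EuclideanSpace.single α (1 : ℂ) : Cspace d)

lemma starProj_apply (z : Cspace d) :
    starProj d z = ∑ α ∈ starIndex d, z α • (EuclideanSpace.single α (1 : ℂ) : Cspace d) := by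
  simp only [starProj, sum_apply, ContinuousLinearMap.smulRight_apply]
  rfl

lemma starProj_coord (z : Cspace d) (j : Fin (d + 1)) :
    starProj d z j = if 2 ≤ (j : ℕ) then z j else 0 := by
  rw [starProj_apply]
  simp only [WithLp.ofLp_sum, Finset.sum_apply, PiLp.smul_apply, PiLp.single_apply, smul_eq_mul,
    mul_ite, mul_one, mul_zero, Finset.sum_ite_eq, Finset.mem_filter, Finset.mem_univ, true_and]

lemma fin_one_val (hd : 1 ≤ d) : ((1 : Fin (d + 1)) : ℕ) = 1 := by
  rw [Fin.val_one', Nat.mod_eq_of_lt (by omega)]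

lemma fin_one_ne_zero (hd : 1 ≤ d) : (1 : Fin (d + 1)) ≠ 0 := by
  rw [Ne, Fin.ext_iff, fin_one_val hd, Fin.val_zero]
  exact one_ne_zero

lemma starProj_zero_coord (z : Cspace d) : starProj d z 0 = 0 := by
  rw [starProj_coord, if_neg (by simp)]

lemma starProj_one_coord (z : Cspace d) : starProj d z 1 = 0 := by
  rw [starProj_coord, if_neg]
  have := Nat.mod_le 1 (d + 1)
  simp only [Fin.val_one']
  omega

lemma norm_starProj_sq (z : Cspace d) : ‖starProj d z‖ ^ 2 = ∑ α ∈ starIndex d, ‖z α‖ ^ 2 := by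
  rw [EuclideanSpace.norm_sq_eq, Finset.sum_filter]
  refine Finset.sum_congr rfl fun j _ => ?_
  rw [starProj_coord]
  split_ifs <;> simp

lemma eq_coords (hd : 1 ≤ d) (z : Cspace d) :
    z = z 0 • EuclideanSpace.single 0 1 + z 1 • EuclideanSpace.single 1 1 + starProj d z := by
  have h01 := fin_one_ne_zero hd
  ext j
  rw [PiLp.add_apply, PiLp.add_apply, starProj_coord]
  by_cases h0 : j = 0
  · subst h0; simp [h01.symm]
  by_cases h1 : j = 1
  · subst h1; rw [if_neg (by rw [fin_one_val hd]; omega)]; simp [h01]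
  have : 2 ≤ (j : ℕ) := by
    rw [Fin.ext_iff] at h0 h1
    rw [fin_one_val hd] at h1
    rw [Fin.val_zero] at h0
    omega
  simp [h0, h1, this]

/-- The shear `z ↦ z + f z`, when `f` is invariant under it. -/
def shear {E : Type*} [AddCommGroup E] (f : E → E) (hf : ∀ z, f (z + f z) = f z)
    (hf' : ∀ z, f (z - f z) = f z) : E ≃ E where
  toFun z := z + f z
  invFun z := z - f z
  left_inv z := by simp [hf]
  right_inv z := by simp [hf']

/-- The polynomial `∑ z^{k+1} c_k`. -/
noncomputable def curveTail (c : Fin N → Cspace d) (z : ℂ) : Cspace d :=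
  ∑ k : Fin N, z ^ ((k : ℕ) + 1) • c k

lemma curve_eq (c : Fin N → Cspace d) (z : ℂ) :
    curve c z = z • EuclideanSpace.single 1 1 + curveTail c z := rfl

lemma curveTail_one (c : Fin N → Cspace d) (hc : ∀ j, c j 1 = 0) (z : ℂ) :
    curveTail c z 1 = 0 := by
  simp [curveTail, hc]

/-- The correction of the zeroth coordinate. -/
noncomputable def correction (η : Fin (d + 1) → Fin N → ℂ) (κ : Cspace d →ₗ[ℂ] Cspace d →ₗ[ℂ] ℂ)
    (z : Cspace d) : ℂ :=
  ∑ α ∈ starIndex d, scalarPoly (η α) (z 1) * z α + κ (starProj d z) (starProj d z)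

/-- Independence of z_0 makes the change of the zeroth coordinate a shear, with an explicit
polynomial inverse. -/
lemma correction_add (hd : 1 ≤ d) (η : Fin (d + 1) → Fin N → ℂ)
    (κ : Cspace d →ₗ[ℂ] Cspace d →ₗ[ℂ] ℂ) (z : Cspace d) (t : ℂ) :
    correction η κ (z + t • EuclideanSpace.single 0 1) = correction η κ z := by
  have h1 : starProj d (z + t • EuclideanSpace.single 0 1) = starProj d z := by
    ext j
    rw [starProj_coord, starProj_coord]
    split_ifs with hj
    · have : j ≠ 0 := by rintro rfl; simp at hj
      simp [this]
    · rfl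
  simp only [correction, h1]
  congr 1
  refine Finset.sum_congr rfl fun α hα => ?_
  have : α ≠ 0 := by rintro rfl; simp at hα
  simp [this, fin_one_ne_zero hd]

/-- The polynomial change of coordinates
`z ↦ z + (∑ η_α(z_1) z_α + κ(z_*, z_*)) e_0 + ∑ z_1^{k+1} c_k`. -/
noncomputable def polyCoord (hd : 1 ≤ d) (c : Fin N → Cspace d) (hc : ∀ j, c j 1 = 0)
    (η : Fin (d + 1) → Fin N → ℂ) (κ : Cspace d →ₗ[ℂ] Cspace d →ₗ[ℂ] ℂ) : Cspace d ≃ Cspace d :=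
  (shear (fun z => correction η κ z • (EuclideanSpace.single 0 1 : Cspace d))
    (fun z => by rw [correction_add hd])
    (fun z => by rw [sub_eq_add_neg, ← neg_smul, correction_add hd])).trans
  (shear (fun z => curveTail c (z 1))
    (fun z => by rw [PiLp.add_apply, curveTail_one c hc, add_zero])
    (fun z => by rw [PiLp.sub_apply, curveTail_one c hc, sub_zero]))

lemma polyCoord_apply (hd : 1 ≤ d) (c : Fin N → Cspace d) (hc : ∀ j, c j 1 = 0)
    (η : Fin (d + 1) → Fin N → ℂ) (κ : Cspace d →ₗ[ℂ] Cspace d →ₗ[ℂ] ℂ) (z : Cspace d) :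
    polyCoord hd c hc η κ z = curve c (z 1) +
      ((z 0 + correction η κ z) • EuclideanSpace.single 0 1 + starProj d z) := by
  have h1 : polyCoord hd c hc η κ z = z + correction η κ z • EuclideanSpace.single 0 1 +
      curveTail c ((z + correction η κ z • (EuclideanSpace.single 0 1 : Cspace d)) 1) := rfl
  have h2 : (z + correction η κ z • (EuclideanSpace.single 0 1 : Cspace d)) 1 = z 1 := by
    simp [fin_one_ne_zero hd]
  rw [h1, h2, curve_eq]
  conv_lhs => enter [1, 1]; rw [eq_coords hd z]
  rw [add_smul]
  abel

lemma differentiable_coord (j : Fin (d + 1)) : Differentiable ℂ fun z : Cspace d => z j :=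
  (EuclideanSpace.proj j : Cspace d →L[ℂ] ℂ).differentiable

lemma differentiable_curveTail (c : Fin N → Cspace d) : Differentiable ℂ (curveTail c) := by
  unfold curveTail; fun_prop

lemma differentiable_correction (η : Fin (d + 1) → Fin N → ℂ)
    (κ : Cspace d →ₗ[ℂ] Cspace d →ₗ[ℂ] ℂ) : Differentiable ℂ (correction η κ) := by
  have h1 : Differentiable ℂ fun z : Cspace d =>
      κ.toContinuousBilinearMap (starProj d z) (starProj d z) := by fun_prop
  have h2 : Differentiable ℂ fun z : Cspace d =>
      ∑ α ∈ starIndex d, scalarPoly (η α) (z 1) * z α := by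
    refine Differentiable.fun_sum fun α _ => ?_
    exact ((differentiable_scalarPoly (η α)).comp (differentiable_coord 1)).mul
      (differentiable_coord α)
  exact h2.add h1

lemma isBiholomorphic_polyCoord (hd : 1 ≤ d) (c : Fin N → Cspace d) (hc : ∀ j, c j 1 = 0)
    (η : Fin (d + 1) → Fin N → ℂ) (κ : Cspace d →ₗ[ℂ] Cspace d →ₗ[ℂ] ℂ) :
    IsBiholomorphic (polyCoord hd c hc η κ) := by
  have h1 : Differentiable ℂ fun z : Cspace d =>
      correction η κ z • (EuclideanSpace.single 0 1 : Cspace d) :=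
    (differentiable_correction η κ).smul_const _
  have h2 : Differentiable ℂ fun z : Cspace d => curveTail c (z 1) :=
    (differentiable_curveTail c).comp (differentiable_coord 1)
  constructor
  · exact (differentiable_id.add h2).comp (differentiable_id.add h1)
  · exact (differentiable_id.sub h1).comp (differentiable_id.sub h2)

/-- The diagonal map with entries `s_j`. -/
noncomputable def diagEquiv (s : Fin (d + 1) → ℂ) (hs : ∀ j, s j ≠ 0) : Cspace d ≃ Cspace d where
  toFun z := WithLp.toLp 2 fun j => s j * z j
  invFun z := WithLp.toLp 2 fun j => (s j)⁻¹ * z j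
  left_inv z := by ext j; simp [hs j]
  right_inv z := by ext j; simp [hs j]

lemma diagEquiv_coord (s : Fin (d + 1) → ℂ) (hs : ∀ j, s j ≠ 0) (z : Cspace d)
    (j : Fin (d + 1)) : diagEquiv s hs z j = s j * z j := rfl

lemma isBiholomorphic_diagEquiv (s : Fin (d + 1) → ℂ) (hs : ∀ j, s j ≠ 0) :
    IsBiholomorphic (diagEquiv s hs) := by
  constructor <;> refine differentiable_euclidean.2 fun j => ?_
  · exact (differentiable_coord j).const_mul (s j)
  · exact (differentiable_coord j).const_mul (s j)⁻¹

/-- The weights `(ε, τ, √ε, …, √ε)`. -/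
noncomputable def weight (d : ℕ) (ε τ : ℝ) (j : Fin (d + 1)) : ℂ :=
  if j = 0 then (ε : ℂ) else if j = 1 then (τ : ℂ) else (√ε : ℂ)

lemma weight_ne_zero {ε τ : ℝ} (hε : 0 < ε) (hτ : 0 < τ) (j : Fin (d + 1)) :
    weight d ε τ j ≠ 0 := by
  unfold weight
  split_ifs
  · exact_mod_cast hε.ne'
  · exact_mod_cast hτ.ne'
  · exact_mod_cast (Real.sqrt_pos.2 hε).ne'

lemma IsBiholomorphic.trans {φ ψ : Cspace d ≃ Cspace d} (hφ : IsBiholomorphic φ)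
    (hψ : IsBiholomorphic ψ) : IsBiholomorphic (φ.trans ψ) :=
  ⟨hψ.1.comp hφ.1, hφ.2.comp hψ.2⟩

lemma IsBiholomorphic.symm {φ : Cspace d ≃ Cspace d} (hφ : IsBiholomorphic φ) :
    IsBiholomorphic φ.symm := ⟨hφ.2, hφ.1⟩

/-- The inverse of the rescaling maps: dilation, polynomial coordinates, affine map. -/
noncomputable def scalingInv (hd : 1 ≤ d) (q : Cspace d) (L : Cspace d ≃L[ℂ] Cspace d)
    (c : Fin N → Cspace d) (hc : ∀ j, c j 1 = 0) (η : Fin (d + 1) → Fin N → ℂ)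
    (κ : Cspace d →ₗ[ℂ] Cspace d →ₗ[ℂ] ℂ) {ε τ : ℝ} (hε : 0 < ε) (hτ : 0 < τ) :
    Cspace d ≃ Cspace d :=
  (diagEquiv (weight d ε τ) (weight_ne_zero hε hτ)).trans
    ((polyCoord hd c hc η κ).trans (L.toEquiv.trans (Equiv.addLeft q)))

lemma isBiholomorphic_scalingInv (hd : 1 ≤ d) (q : Cspace d) (L : Cspace d ≃L[ℂ] Cspace d)
    (c : Fin N → Cspace d) (hc : ∀ j, c j 1 = 0) (η : Fin (d + 1) → Fin N → ℂ)
    (κ : Cspace d →ₗ[ℂ] Cspace d →ₗ[ℂ] ℂ) {ε τ : ℝ} (hε : 0 < ε) (hτ : 0 < τ) :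
    IsBiholomorphic (scalingInv hd q L c hc η κ hε hτ) := by
  refine (isBiholomorphic_diagEquiv _ _).trans ((isBiholomorphic_polyCoord _ _ _ _ _).trans
    (IsBiholomorphic.trans ⟨L.differentiable, L.symm.differentiable⟩ ⟨?_, ?_⟩))
  · exact (differentiable_const q).add differentiable_id
  · exact (differentiable_const (-q)).add differentiable_id

lemma starProj_diagEquiv {ε τ : ℝ} (hε : 0 < ε) (hτ : 0 < τ) (z : Cspace d) :
    starProj d (diagEquiv (weight d ε τ) (weight_ne_zero hε hτ) z) = (√ε : ℂ) • starProj d z := by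
  ext j
  rw [PiLp.smul_apply, starProj_coord, starProj_coord, diagEquiv_coord]
  split_ifs with hj
  · have h0 : j ≠ 0 := by rintro rfl; simp at hj
    have h1 : j ≠ 1 := by
      rintro rfl
      have := Nat.mod_le 1 (d + 1)
      simp only [Fin.val_one'] at hj
      omega
    rw [weight, if_neg h0, if_neg h1, smul_eq_mul]
  · simp

/-- The displacement from the normal curve. -/
noncomputable def displacement (η : Fin (d + 1) → Fin N → ℂ)
    (κ : Cspace d →ₗ[ℂ] Cspace d →ₗ[ℂ] ℂ) (ε τ : ℝ) (ζ : Cspace d) : Cspace d :=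
  ((ε : ℂ) * (ζ 0 + κ (starProj d ζ) (starProj d ζ))) • EuclideanSpace.single 0 1 +
    (√ε : ℂ) • ∑ α ∈ starIndex d, ζ α • ((EuclideanSpace.single α 1 : Cspace d) +
      scalarPoly (η α) (τ * ζ 1) • EuclideanSpace.single 0 1)

/-- The image is split into a point of the normal curve and a displacement from it, the form needed
for a Taylor expansion about the curve. The quadratic term κ receives weight √ε · √ε = ε, the same
as ζ_0. -/
lemma scalingInv_apply (hd : 1 ≤ d) (q : Cspace d) (L : Cspace d ≃L[ℂ] Cspace d)
    (c : Fin N → Cspace d) (hc : ∀ j, c j 1 = 0) (η : Fin (d + 1) → Fin N → ℂ)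
    (κ : Cspace d →ₗ[ℂ] Cspace d →ₗ[ℂ] ℂ) {ε τ : ℝ} (hε : 0 < ε) (hτ : 0 < τ) (ζ : Cspace d) :
    scalingInv hd q L c hc η κ hε hτ ζ =
      q + L (curve c (τ * ζ 1)) + L (displacement η κ ε τ ζ) := by
  have h1 : scalingInv hd q L c hc η κ hε hτ ζ =
    q + L (polyCoord hd c hc η κ (diagEquiv (weight d ε τ) (weight_ne_zero hε hτ) ζ)) := rfl
  have hw1 : weight d ε τ 1 = τ := by simp [weight, fin_one_ne_zero hd]
  have hsq : (√ε : ℂ) * √ε = ε := by exact_mod_cast Real.mul_self_sqrt hε.le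
  rw [h1, polyCoord_apply, map_add, ← add_assoc]
  congr 2
  · rw [diagEquiv_coord, hw1]
  · rw [correction, starProj_diagEquiv hε hτ, displacement, diagEquiv_coord, diagEquiv_coord, hw1]
    simp only [map_smul, LinearMap.smul_apply, smul_eq_mul]
    have h2 : ∑ α ∈ starIndex d, scalarPoly (η α) (τ * ζ 1) *
        (diagEquiv (weight d ε τ) (weight_ne_zero hε hτ) ζ) α =
        √ε * ∑ α ∈ starIndex d, ζ α * scalarPoly (η α) (τ * ζ 1) := by
      rw [Finset.mul_sum]
      refine Finset.sum_congr rfl fun α hα => ?_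
      have hα' : 2 ≤ (α : ℕ) := by simpa using hα
      have := congrArg (fun v : Cspace d => v α) (starProj_diagEquiv hε hτ ζ)
      simp only [PiLp.smul_apply, starProj_coord, if_pos hα', smul_eq_mul] at this
      rw [this]
      ring
    have h3 : ∑ α ∈ starIndex d, ζ α • ((EuclideanSpace.single α 1 : Cspace d) +
        scalarPoly (η α) (τ * ζ 1) • EuclideanSpace.single 0 1) = starProj d ζ +
        (∑ α ∈ starIndex d, ζ α * scalarPoly (η α) (τ * ζ 1)) • EuclideanSpace.single 0 1 := by
      simp only [smul_add, Finset.sum_add_distrib, smul_smul, ← Finset.sum_smul]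
      rw [starProj_apply]
    have hw0 : weight d ε τ 0 = ε := by simp [weight]
    rw [h2, h3, hw0, smul_add, smul_smul]
    rw [← mul_assoc (√ε : ℂ) (√ε : ℂ), hsq]
    module

/-- The holomorphic part of the second derivative, as a complex bilinear form. -/
noncomputable def holQuad (r : Cspace d → ℝ) (x : Cspace d) :
    Cspace d →ₗ[ℂ] Cspace d →ₗ[ℂ] ℂ :=
  LinearMap.mk₂ ℂ
    (fun X Y => (1 / 4) * (((hess r x X Y - hess r x (I • X) (I • Y) : ℝ) : ℂ)
      - I * ((hess r x X (I • Y) + hess r x (I • X) Y : ℝ) : ℂ)))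
    (fun X X' Y => by
      simp only [smul_add, map_add, add_apply]
      push_cast
      ring)
    (fun c X Y => by
      have h2 : I • c • X = c.re • (I • X) + (-c.im) • X := by
        rw [complex_smul_eq c X, smul_add, smul_comm I c.re, smul_comm I c.im, smul_smul I I,
          I_mul_I]
        simp
      simp only [h2]
      rw [complex_smul_eq c X]
      simp only [map_add, map_smul, add_apply, smul_apply, smul_eq_mul]
      conv_rhs => rw [← re_add_im c]
      push_cast
      linear_combination ((1 / 4) * (c.im : ℂ) *
        ((hess r x X (I • Y) : ℂ) + hess r x (I • X) Y)) * I_sq)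
    (fun X Y Y' => by
      simp only [smul_add, map_add]
      push_cast
      ring)
    (fun c X Y => by
      have h2 : I • c • Y = c.re • (I • Y) + (-c.im) • Y := by
        rw [complex_smul_eq c Y, smul_add, smul_comm I c.re, smul_comm I c.im, smul_smul I I,
          I_mul_I]
        simp
      simp only [h2]
      rw [complex_smul_eq c Y]
      simp only [map_add, map_smul, smul_eq_mul]
      conv_rhs => rw [← re_add_im c]
      push_cast
      linear_combination ((1 / 4) * (c.im : ℂ) *
        ((hess r x X (I • Y) : ℂ) + hess r x (I • X) Y)) * I_sq)

/-- The second summand is the real part of a holomorphic quadratic form, so a quadratic change of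
ζ_0 can remove it and leave the Levi form alone. -/
lemma half_hess_eq (r : Cspace d → ℝ) (x X : Cspace d) :
    1 / 2 * hess r x X X = (leviH r x X X).re + (holQuad r x X X).re := by
  have : (holQuad r x X X).re = (1 / 4) * (hess r x X X - hess r x (I • X) (I • X)) := by
    simp [holQuad]
  rw [this, leviH_self_re]
  ring

end

section

variable {d N : ℕ} {ι : Type*} {l : Filter ι}

/-! ### Convergence of the rescaled functions -/

lemma norm_sum_pow_smul_le {E : Type*} [NormedAddCommGroup E] [NormedSpace ℂ E] {c : Fin N → E}
    {C : ℝ} (hc : ‖c‖ ≤ C) {z : ℂ} (hz : ‖z‖ ≤ 1) :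
    ‖∑ k : Fin N, z ^ ((k : ℕ) + 1) • c k‖ ≤ N * C * ‖z‖ := by
  have hC : 0 ≤ C := (norm_nonneg _).trans hc
  calc ‖∑ k : Fin N, z ^ ((k : ℕ) + 1) • c k‖ ≤ ∑ _k : Fin N, C * ‖z‖ := by
        refine norm_sum_le_of_le _ fun k _ => ?_
        rw [norm_smul, norm_pow, mul_comm]
        refine mul_le_mul ((norm_le_pi_norm c k).trans hc) ?_ (by positivity) hC
        exact pow_le_of_le_one (norm_nonneg _) hz (by omega)
    _ = N * C * ‖z‖ := by simp [mul_assoc]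

lemma tendsto_curve {c : ι → Fin N → Cspace d} {C : ℝ} (hc : ∀ᶠ i in l, ‖c i‖ ≤ C) {z : ι → ℂ}
    (hz : Tendsto z l (𝓝 0)) : Tendsto (fun i => curve (c i) (z i)) l (𝓝 0) := by
  have hz' : Tendsto (fun i => ‖z i‖) l (𝓝 0) := by simpa using hz.norm
  have h1 : Tendsto (fun i => curveTail (c i) (z i)) l (𝓝 0) := by
    refine squeeze_zero_norm' (a := fun i => N * C * ‖z i‖) ?_ (by simpa using hz'.const_mul (N * C))
    filter_upwards [hc, hz'.eventually (ge_mem_nhds one_pos)] with i h1 h2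
    exact norm_sum_pow_smul_le h1 h2
  have h2 := (hz.smul_const (EuclideanSpace.single 1 1 : Cspace d)).add h1
  simpa [curve_eq] using h2

lemma tendsto_scalarPoly {η : ι → Fin N → ℂ} {C : ℝ} (hη : ∀ᶠ i in l, ‖η i‖ ≤ C) {z : ι → ℂ}
    (hz : Tendsto z l (𝓝 0)) : Tendsto (fun i => scalarPoly (η i) (z i)) l (𝓝 0) := by
  have hz' : Tendsto (fun i => ‖z i‖) l (𝓝 0) := by simpa using hz.norm
  refine squeeze_zero_norm' (a := fun i => N * C * ‖z i‖) ?_ (by simpa using hz'.const_mul (N * C))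
  filter_upwards [hη, hz'.eventually (ge_mem_nhds one_pos)] with i h1 h2
  exact norm_sum_pow_smul_le h1 h2

/-- Dilation multiplies the coefficient of degree j by τ^j / σ and leaves a remainder of size
τ^(N+1) / σ. It is applied with σ = ε to r and with σ = √ε to the derivatives, which are multiplied
by displacements of size √ε. -/
lemma tendsto_jet {s : Finset (ℕ × ℕ)} {F : ι → ℂ → ℂ} {a : ι → ℕ × ℕ → ℂ} {a' : ℕ × ℕ → ℂ}
    {σ τ : ι → ℝ} (hσ : ∀ i, 0 < σ i) (hτ0 : ∀ i, 0 < τ i) (hτ : Tendsto τ l (𝓝 0))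
    (hN : Tendsto (fun i => τ i ^ (N + 1) / σ i) l (𝓝 0))
    (ha : ∀ m ∈ s, Tendsto (fun i => a i m * ((τ i ^ (m.1 + m.2) / σ i : ℝ) : ℂ)) l (𝓝 (a' m)))
    {C δ : ℝ} (hδ : 0 < δ) (hF : ∀ᶠ i in l, ∀ z : ℂ, ‖z‖ ≤ δ →
      ‖F i z - ∑ m ∈ s, a i m * monom m z‖ ≤ C * ‖z‖ ^ (N + 1))
    {z : ι → ℂ} {z₀ : ℂ} (hz : Tendsto z l (𝓝 z₀)) :
    Tendsto (fun i => F i (τ i * z i) / σ i) l (𝓝 (∑ m ∈ s, a' m * monom m z₀)) := by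
  have h1 : Tendsto (fun i => ∑ m ∈ s, a i m * ((τ i ^ (m.1 + m.2) / σ i : ℝ) : ℂ) * monom m (z i))
      l (𝓝 (∑ m ∈ s, a' m * monom m z₀)) :=
    tendsto_finsetSum _ fun m hm => (ha m hm).mul (((continuous_monom m).tendsto z₀).comp hz)
  have h2 : Tendsto (fun i => (F i (τ i * z i) - ∑ m ∈ s, a i m * monom m (τ i * z i)) / σ i) l
      (𝓝 0) := by
    have hlim : Tendsto (fun i => C * (τ i ^ (N + 1) / σ i * ‖z i‖ ^ (N + 1))) l (𝓝 0) := by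
      simpa using (hN.mul (hz.norm.pow (N + 1))).const_mul C
    refine squeeze_zero_norm' ?_ hlim
    have hsmall : Tendsto (fun i => ‖(τ i : ℂ) * z i‖) l (𝓝 0) := by
      have := (hτ.ofReal.mul hz).norm
      simpa using this
    filter_upwards [hF, hsmall.eventually (ge_mem_nhds hδ)] with i h3 h4
    have h5 := h3 _ h4
    rw [norm_div, norm_real, Real.norm_of_nonneg (hσ i).le, div_le_iff₀ (hσ i)]
    refine h5.trans (le_of_eq ?_)
    rw [norm_mul, norm_real, Real.norm_of_nonneg (hτ0 i).le, mul_pow]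
    field_simp [(hσ i).ne']
  have h3 := h2.add h1
  rw [zero_add] at h3
  refine h3.congr fun i => ?_
  have h4 : (σ i : ℂ) ≠ 0 := by exact_mod_cast (hσ i).ne'
  rw [sub_div, Finset.sum_div]
  have h5 : ∑ m ∈ s, a i m * monom m (τ i * z i) / σ i =
      ∑ m ∈ s, a i m * ((τ i ^ (m.1 + m.2) / σ i : ℝ) : ℂ) * monom m (z i) := by
    refine Finset.sum_congr rfl fun m _ => ?_
    rw [monom_ofReal_mul]
    push_cast
    ring
  rw [h5]
  ring

lemma tendsto_clm_apply {𝕜 E F : Type*} [NontriviallyNormedField 𝕜] [NormedAddCommGroup E]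
    [NormedSpace 𝕜 E] [NormedAddCommGroup F] [NormedSpace 𝕜 F] {f : ι → E →L[𝕜] F} {v : ι → E}
    {f₀ : E →L[𝕜] F} {v₀ : E} (hf : Tendsto f l (𝓝 f₀)) (hv : Tendsto v l (𝓝 v₀)) :
    Tendsto (fun i => f i (v i)) l (𝓝 (f₀ v₀)) :=
  (isBoundedBilinearMap_apply.continuous.tendsto (f₀, v₀)).comp (hf.prodMk_nhds hv)

lemma tendsto_holDeriv {r : Cspace d → ℝ} {p : Cspace d} (hr : ContDiffAt ℝ 2 r p)
    {x v : ι → Cspace d} {v₀ : Cspace d} (hx : Tendsto x l (𝓝 p)) (hv : Tendsto v l (𝓝 v₀)) :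
    Tendsto (fun i => holDeriv r (x i) (v i)) l (𝓝 (holDeriv r p v₀)) := by
  have h1 : ContinuousAt (fderiv ℝ r) p := (hr.fderiv_right (m := 1) (by norm_num)).continuousAt
  have h2 : Tendsto (fun i => fderiv ℝ r (x i)) l (𝓝 (fderiv ℝ r p)) := h1.tendsto.comp hx
  exact ((tendsto_clm_apply h2 hv).ofReal.sub
    ((tendsto_clm_apply h2 (hv.const_smul I)).ofReal.const_mul I)).const_mul (1 / 2)

/-- Displacements, divided by `√ε`. -/
lemma tendsto_displacement {η : ι → Fin (d + 1) → Fin N → ℂ} {C : ℝ}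
    (hη : ∀ᶠ i in l, ∀ α, ‖η i α‖ ≤ C) (κ : Cspace d →ₗ[ℂ] Cspace d →ₗ[ℂ] ℂ) {ε τ : ι → ℝ}
    (hε : ∀ i, 0 < ε i) (hε0 : Tendsto ε l (𝓝 0)) (hτ : Tendsto τ l (𝓝 0))
    {Z : ι → Cspace d} {ζ : Cspace d} (hZ : Tendsto Z l (𝓝 ζ)) :
    ∃ D : ι → Cspace d, (∀ i, displacement (η i) κ (ε i) (τ i) (Z i) = √(ε i) • D i) ∧
      Tendsto D l (𝓝 (starProj d ζ)) := by
  have hcoord : ∀ j, Tendsto (fun i => Z i j) l (𝓝 (ζ j)) := fun j =>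
    ((EuclideanSpace.proj j : Cspace d →L[ℂ] ℂ).continuous.tendsto ζ).comp hZ
  have hκ : Tendsto (fun i => Z i 0 + κ (starProj d (Z i)) (starProj d (Z i))) l
      (𝓝 (ζ 0 + κ (starProj d ζ) (starProj d ζ))) := by
    have : Continuous fun z : Cspace d =>
      κ.toContinuousBilinearMap (starProj d z) (starProj d z) := by fun_prop
    exact (hcoord 0).add ((this.tendsto ζ).comp hZ)
  have hsq : Tendsto (fun i => √(ε i)) l (𝓝 0) := by
    simpa [Function.comp_def] using (Real.continuous_sqrt.tendsto 0).comp hε0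
  have hz : Tendsto (fun i => (τ i : ℂ) * Z i 1) l (𝓝 0) := by
    simpa using hτ.ofReal.mul (hcoord 1)
  refine ⟨fun i => ((√(ε i) : ℂ) * (Z i 0 + κ (starProj d (Z i)) (starProj d (Z i)))) •
    EuclideanSpace.single 0 1 + ∑ α ∈ starIndex d, Z i α • ((EuclideanSpace.single α 1 : Cspace d) +
      scalarPoly (η i α) (τ i * Z i 1) • EuclideanSpace.single 0 1), fun i => ?_, ?_⟩
  · have hs : (ε i : ℂ) = (√(ε i) : ℂ) * √(ε i) := by
      exact_mod_cast (Real.mul_self_sqrt (hε i).le).symm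
    rw [displacement, hs, ← coe_smul, smul_add, smul_smul, mul_assoc]
  · have h1 := ((hsq.ofReal.mul hκ).smul_const (EuclideanSpace.single 0 1 : Cspace d)).add
      (tendsto_finsetSum (starIndex d) fun α _ => (hcoord α).smul
        ((tendsto_const_nhds (x := (EuclideanSpace.single α 1 : Cspace d))).add
          ((tendsto_scalarPoly (hη.mono fun i h => h α) hz).smul_const
            (EuclideanSpace.single 0 1 : Cspace d))))
    simpa [starProj_apply] using h1

lemma tendsto_scaling_point {p : Cspace d} {q : ι → Cspace d} (hq : Tendsto q l (𝓝 p))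
    {L : ι → Cspace d →L[ℂ] Cspace d} {L₀ : Cspace d →L[ℂ] Cspace d} (hL : Tendsto L l (𝓝 L₀))
    {c : ι → Fin N → Cspace d} {η : ι → Fin (d + 1) → Fin N → ℂ} {C : ℝ}
    (hc : ∀ᶠ i in l, ‖c i‖ ≤ C) (hη : ∀ᶠ i in l, ∀ α, ‖η i α‖ ≤ C)
    (κ : Cspace d →ₗ[ℂ] Cspace d →ₗ[ℂ] ℂ) {ε τ : ι → ℝ} (hε : ∀ i, 0 < ε i)
    (hε0 : Tendsto ε l (𝓝 0)) (hτ : Tendsto τ l (𝓝 0))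
    {Z : ι → Cspace d} {ζ : Cspace d} (hZ : Tendsto Z l (𝓝 ζ)) :
    Tendsto (fun i => q i + L i (curve (c i) (τ i * Z i 1))
      + L i (displacement (η i) κ (ε i) (τ i) (Z i))) l (𝓝 p) := by
  have hcoord : ∀ j, Tendsto (fun i => Z i j) l (𝓝 (ζ j)) := fun j =>
    ((EuclideanSpace.proj j : Cspace d →L[ℂ] ℂ).continuous.tendsto ζ).comp hZ
  have hsq : Tendsto (fun i => √(ε i)) l (𝓝 0) := by
    simpa [Function.comp_def] using (Real.continuous_sqrt.tendsto 0).comp hε0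
  have hz : Tendsto (fun i => (τ i : ℂ) * Z i 1) l (𝓝 0) := by
    simpa using hτ.ofReal.mul (hcoord 1)
  obtain ⟨D, hD, hDlim⟩ := tendsto_displacement hη κ hε hε0 hτ hZ
  have hw : ∀ i, L i (displacement (η i) κ (ε i) (τ i) (Z i)) = √(ε i) • L i (D i) := fun i => by
    rw [hD, ← coe_smul, map_smul, coe_smul]
  simp only [hw]
  simpa using (hq.add (tendsto_clm_apply hL (tendsto_curve hc hz))).add
    (hsq.smul (tendsto_clm_apply hL hDlim))

/-- The expansion is centred on the normal curve. Displacements are O(√ε), so the second order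
remainder is o(ε) and the Hessian may be frozen at p. General filters and moving points Z allow the
product filter, which yields locally uniform convergence. -/
theorem tendsto_rescaled {r : Cspace d → ℝ} {p : Cspace d} (hr : ContDiffAt ℝ 2 r p)
    {q : ι → Cspace d} (hq : Tendsto q l (𝓝 p))
    {L : ι → Cspace d →L[ℂ] Cspace d} {L₀ : Cspace d →L[ℂ] Cspace d} (hL : Tendsto L l (𝓝 L₀))
    (hL₀ : holDeriv r p (L₀ (EuclideanSpace.single 0 1)) = 1 / 2)
    {c : ι → Fin N → Cspace d} {η : ι → Fin (d + 1) → Fin N → ℂ} {C : ℝ}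
    (hc : ∀ᶠ i in l, ‖c i‖ ≤ C) (hη : ∀ᶠ i in l, ∀ α, ‖η i α‖ ≤ C)
    (κ : Cspace d →ₗ[ℂ] Cspace d →ₗ[ℂ] ℂ) {ε τ : ι → ℝ} (hε : ∀ i, 0 < ε i)
    (hε0 : Tendsto ε l (𝓝 0)) (hτ0 : ∀ i, 0 < τ i) (hτ : Tendsto τ l (𝓝 0))
    (hτN : Tendsto (fun i => τ i ^ (N + 1) / ε i) l (𝓝 0))
    {a : ι → ℕ × ℕ → ℂ} {a' : ℕ × ℕ → ℂ} {b : ι → Fin (d + 1) → ℕ × ℕ → ℂ}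
    {b' : Fin (d + 1) → ℕ × ℕ → ℂ}
    (ha : ∀ m ∈ mixedIndex N,
      Tendsto (fun i => a i m * ((τ i ^ (m.1 + m.2) / ε i : ℝ) : ℂ)) l (𝓝 (a' m)))
    (hb : ∀ α ∈ starIndex d, ∀ m ∈ mixedIndex N,
      Tendsto (fun i => b i α m * ((τ i ^ (m.1 + m.2) / √(ε i) : ℝ) : ℂ)) l (𝓝 (b' α m)))
    {δ : ℝ} (hδ : 0 < δ)
    (hA : ∀ᶠ i in l, ∀ z : ℂ, ‖z‖ ≤ δ →
      ‖(alongCurve r (q i) (L i) (c i) z : ℂ) - ∑ m ∈ mixedIndex N, a i m * monom m z‖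
        ≤ C * ‖z‖ ^ (N + 1))
    (hB : ∀ α ∈ starIndex d, ∀ᶠ i in l, ∀ z : ℂ, ‖z‖ ≤ δ →
      ‖derivAlongCurve r (q i) (L i) (c i) (EuclideanSpace.single α 1) (η i α) z
        - ∑ m ∈ mixedIndex N, b i α m * monom m z‖ ≤ C * ‖z‖ ^ (N + 1))
    {Z : ι → Cspace d} {ζ : Cspace d} (hZ : Tendsto Z l (𝓝 ζ)) :
    Tendsto (fun i => 1 / ε i * r (q i + L i (curve (c i) (τ i * Z i 1))
      + L i (displacement (η i) κ (ε i) (τ i) (Z i)))) l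
      (𝓝 ((ζ 0).re + (∑ m ∈ mixedIndex N, a' m * monom m (ζ 1)).re
        + 2 * (∑ α ∈ starIndex d, ζ α * ∑ m ∈ mixedIndex N, b' α m * monom m (ζ 1)).re
        + ((κ (starProj d ζ) (starProj d ζ)).re
          + 1 / 2 * hess r p (L₀ (starProj d ζ)) (L₀ (starProj d ζ))))) := by
  have hcoord : ∀ j, Tendsto (fun i => Z i j) l (𝓝 (ζ j)) := fun j =>
    ((EuclideanSpace.proj j : Cspace d →L[ℂ] ℂ).continuous.tendsto ζ).comp hZ
  have hκ : Tendsto (fun i => κ (starProj d (Z i)) (starProj d (Z i))) l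
      (𝓝 (κ (starProj d ζ) (starProj d ζ))) := by
    have : Continuous fun z : Cspace d =>
      κ.toContinuousBilinearMap (starProj d z) (starProj d z) := by fun_prop
    exact (this.tendsto ζ).comp hZ
  have hsq0 : ∀ i, 0 < √(ε i) := fun i => Real.sqrt_pos.2 (hε i)
  have hsq : Tendsto (fun i => √(ε i)) l (𝓝 0) := by
    simpa [Function.comp_def] using (Real.continuous_sqrt.tendsto 0).comp hε0
  have hz : Tendsto (fun i => (τ i : ℂ) * Z i 1) l (𝓝 0) := by
    simpa using hτ.ofReal.mul (hcoord 1)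
  set x : ι → Cspace d := fun i => q i + L i (curve (c i) (τ i * Z i 1)) with hxdef
  have hx : Tendsto x l (𝓝 p) := by simpa using hq.add (tendsto_clm_apply hL (tendsto_curve hc hz))
  obtain ⟨D, hD, hDlim⟩ := tendsto_displacement hη κ hε hε0 hτ hZ
  have hLD : Tendsto (fun i => L i (D i)) l (𝓝 (L₀ (starProj d ζ))) := tendsto_clm_apply hL hDlim
  have hw : ∀ i, L i (displacement (η i) κ (ε i) (τ i) (Z i)) = √(ε i) • L i (D i) := fun i => by
    rw [hD, ← coe_smul, map_smul, coe_smul]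
  have hxw : Tendsto (fun i => x i + L i (displacement (η i) κ (ε i) (τ i) (Z i))) l (𝓝 p) :=
    tendsto_scaling_point hq hL hc hη κ hε hε0 hτ hZ
  have hτN' : Tendsto (fun i => τ i ^ (N + 1) / √(ε i)) l (𝓝 0) := by
    have := hτN.mul hsq
    rw [zero_mul] at this
    refine this.congr fun i => ?_
    have h1 := Real.mul_self_sqrt (hε i).le
    have h2 := (hsq0 i).ne'
    have h3 := (hε i).ne'
    field_simp
    rw [sq, h1]
  -- the value on the curve
  have T1 : Tendsto (fun i => 1 / ε i * r (x i)) l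
      (𝓝 (∑ m ∈ mixedIndex N, a' m * monom m (ζ 1)).re) := by
    have h1 := tendsto_jet hε hτ0 hτ hτN ha hδ hA (hcoord 1)
    refine ((continuous_re.tendsto _).comp h1).congr fun i => ?_
    simp only [Function.comp, alongCurve]
    rw [← ofReal_div, ofReal_re, hxdef]
    ring
  -- the first derivative
  have hsum : ∀ i, holDeriv r (x i) (L i (displacement (η i) κ (ε i) (τ i) (Z i))) =
      ε i * ((Z i 0 + κ (starProj d (Z i)) (starProj d (Z i))) *
        holDeriv r (x i) (L i (EuclideanSpace.single 0 1))) +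
      √(ε i) * ∑ α ∈ starIndex d, Z i α * derivAlongCurve r (q i) (L i) (c i)
        (EuclideanSpace.single α 1) (η i α) (τ i * Z i 1) := by
    intro i
    rw [displacement, ← holDerivₗ_apply]
    simp only [map_add, map_smul, map_sum, smul_eq_mul, derivAlongCurve, holDerivₗ_apply,
      holDeriv_add, holDeriv_smul, hxdef]
    ring
  have T2 : Tendsto (fun i => 1 / ε i * fderiv ℝ r (x i)
      (L i (displacement (η i) κ (ε i) (τ i) (Z i)))) l
      (𝓝 ((ζ 0).re + (κ (starProj d ζ) (starProj d ζ)).re +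
        2 * (∑ α ∈ starIndex d, ζ α * ∑ m ∈ mixedIndex N, b' α m * monom m (ζ 1)).re)) := by
    have h1 := tendsto_holDeriv hr hx (tendsto_clm_apply hL
      (tendsto_const_nhds (x := (EuclideanSpace.single 0 1 : Cspace d))))
    have h2 := (((hcoord 0).add hκ).mul h1).add (tendsto_finsetSum (starIndex d) fun α hα =>
      (hcoord α).mul (tendsto_jet hsq0 hτ0 hτ hτN' (hb α hα) hδ (hB α hα) (hcoord 1)))
    have h3 := (((continuous_re.tendsto _).comp h2).const_mul 2)
    rw [hL₀] at h3
    have e : 2 * ((ζ 0 + κ (starProj d ζ) (starProj d ζ)) * (1 / 2) +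
        ∑ α ∈ starIndex d, ζ α * ∑ m ∈ mixedIndex N, b' α m * monom m (ζ 1)).re =
        (ζ 0).re + (κ (starProj d ζ) (starProj d ζ)).re +
        2 * (∑ α ∈ starIndex d, ζ α * ∑ m ∈ mixedIndex N, b' α m * monom m (ζ 1)).re := by
      rw [add_re, show (ζ 0 + κ (starProj d ζ) (starProj d ζ)) * (1 / 2) =
        ((1 / 2 : ℝ) : ℂ) * (ζ 0 + κ (starProj d ζ) (starProj d ζ)) by push_cast; ring,
        re_ofReal_mul, add_re]
      ring
    rw [e] at h3
    refine h3.congr fun i => ?_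
    have h4 : (ε i : ℂ) ≠ 0 := by exact_mod_cast (hε i).ne'
    have h5 : (√(ε i) : ℂ) ≠ 0 := by exact_mod_cast (hsq0 i).ne'
    have h6 : (√(ε i) : ℂ) * √(ε i) = ε i := by exact_mod_cast Real.mul_self_sqrt (hε i).le
    have h7 : holDeriv r (x i) (L i (displacement (η i) κ (ε i) (τ i) (Z i))) =
        (ε i : ℂ) * ((Z i 0 + κ (starProj d (Z i)) (starProj d (Z i))) *
        holDeriv r (x i) (L i (EuclideanSpace.single 0 1)) +
        ∑ α ∈ starIndex d, Z i α * (derivAlongCurve r (q i) (L i) (c i)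
          (EuclideanSpace.single α 1) (η i α) (τ i * Z i 1) / √(ε i))) := by
      rw [hsum, mul_add]
      congr 1
      rw [Finset.mul_sum, Finset.mul_sum]
      refine Finset.sum_congr rfl fun α _ => ?_
      rw [← h6]
      field_simp
    rw [fderiv_eq_two_re_holDeriv, h7, re_ofReal_mul]
    simp only [Function.comp]
    field_simp [(hε i).ne']
  -- the second derivative
  have T3 : Tendsto (fun i => 1 / 2 * hess r p (L i (D i)) (L i (D i))) l
      (𝓝 (1 / 2 * hess r p (L₀ (starProj d ζ)) (L₀ (starProj d ζ)))) := by
    have : Continuous fun v : Cspace d => hess r p v v := by fun_prop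
    exact ((this.tendsto _).comp hLD).const_mul (1 / 2)
  -- the remainder
  have T4 : Tendsto (fun i => 1 / ε i * (r (x i + L i (displacement (η i) κ (ε i) (τ i) (Z i)))
      - r (x i) - fderiv ℝ r (x i) (L i (displacement (η i) κ (ε i) (τ i) (Z i)))
      - 1 / 2 * hess r p (L i (displacement (η i) κ (ε i) (τ i) (Z i)))
        (L i (displacement (η i) κ (ε i) (τ i) (Z i))))) l (𝓝 0) := by
    rw [Metric.tendsto_nhds]
    intro s hs
    set B := ‖L₀ (starProj d ζ)‖ + 1 with hB'
    have hBpos : 0 < B := by positivity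
    obtain ⟨ρ, hρ, H⟩ := taylor_two_uniform hr (η := s / (2 * B ^ 2)) (by positivity)
    filter_upwards [hx.eventually (Metric.ball_mem_nhds p hρ),
      hxw.eventually (Metric.ball_mem_nhds p hρ),
      hLD.norm.eventually (gt_mem_nhds (lt_add_one _))] with i h1 h2 h3
    have h4 := H (x i) h1 _ h2
    rw [dist_zero_right, norm_mul, Real.norm_eq_abs, Real.norm_eq_abs,
      abs_of_pos (one_div_pos.2 (hε i))]
    calc _ ≤ 1 / ε i * (s / (2 * B ^ 2) *
          ‖L i (displacement (η i) κ (ε i) (τ i) (Z i))‖ ^ 2) := by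
          refine mul_le_mul_of_nonneg_left h4 (one_div_pos.2 (hε i)).le
      _ = s / (2 * B ^ 2) * ‖L i (D i)‖ ^ 2 := by
          rw [hw, norm_smul, mul_pow, Real.norm_of_nonneg (hsq0 i).le, Real.sq_sqrt (hε i).le]
          field_simp [(hε i).ne']
      _ ≤ s / (2 * B ^ 2) * B ^ 2 := by gcongr
      _ = s / 2 := by field_simp
      _ < s := by linarith
  have T := ((T1.add T2).add T3).add T4
  have e : ∀ i, 1 / ε i * (1 / 2 * hess r p (L i (displacement (η i) κ (ε i) (τ i) (Z i)))
      (L i (displacement (η i) κ (ε i) (τ i) (Z i)))) = 1 / 2 * hess r p (L i (D i)) (L i (D i)) := by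
    intro i
    have h1 := Real.mul_self_sqrt (hε i).le
    rw [hw]
    simp only [map_smul, smul_apply, smul_eq_mul]
    rw [← mul_assoc (√(ε i)), h1]
    field_simp [(hε i).ne']
  refine (T.congr fun i => ?_).congr' EventuallyEq.rfl |>.trans (le_of_eq ?_)
  · rw [← e]
    ring
  · congr 1
    ring

end

section

variable {d N : ℕ}

lemma eventually_forall_of_isCompact {ι X : Type*} [TopologicalSpace X] {l : Filter ι} {K : Set X}
    (hK : IsCompact K) {P : ι → X → Prop} (h : ∀ x ∈ K, ∀ᶠ y in l ×ˢ 𝓝 x, P y.1 y.2) :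
    ∀ᶠ i in l, ∀ x ∈ K, P i x := by
  refine hK.induction_on (p := fun s => ∀ᶠ i in l, ∀ x ∈ s, P i x) ?_ ?_ ?_ ?_
  · simp
  · intro s t hst ht
    exact ht.mono fun i hi x hx => hi x (hst hx)
  · intro s t hs ht
    filter_upwards [hs, ht] with i h1 h2 x hx
    exact hx.elim (h1 x) (h2 x)
  · intro x hx
    obtain ⟨pa, ha, pb, hb, hab⟩ := eventually_prod_iff.1 (h x hx)
    exact ⟨{y | pb y}, mem_nhdsWithin_of_mem_nhds hb, ha.mono fun i hi y hy => hab hi hy⟩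

/-! ### Frames along the sequence -/

lemma tendsto_leviH {ι : Type*} {l : Filter ι} {r : Cspace d → ℝ} {p : Cspace d}
    (hr : ContDiffAt ℝ 2 r p) {q : ι → Cspace d} (hq : Tendsto q l (𝓝 p)) {v w : ι → Cspace d}
    {v₀ w₀ : Cspace d} (hv : Tendsto v l (𝓝 v₀)) (hw : Tendsto w l (𝓝 w₀)) :
    Tendsto (fun i => leviH r (q i) (v i) (w i)) l (𝓝 (leviH r p v₀ w₀)) := by
  have h1 : ContinuousAt (hess r) p :=
    ((hr.fderiv_right (m := 1) (by norm_num)).fderiv_right (m := 0) (by norm_num)).continuousAt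
  have h2 : Tendsto (fun i => hess r (q i)) l (𝓝 (hess r p)) := h1.tendsto.comp hq
  have key : ∀ {x y : ι → Cspace d} {x₀ y₀ : Cspace d}, Tendsto x l (𝓝 x₀) → Tendsto y l (𝓝 y₀) →
      Tendsto (fun i => hess r (q i) (x i) (y i)) l (𝓝 (hess r p x₀ y₀)) := fun hx hy =>
    tendsto_clm_apply (tendsto_clm_apply h2 hx) hy
  have hIv := hv.const_smul I
  have hIw := hw.const_smul I
  exact (((key hv hw).add (key hIv hIw)).ofReal.add
    (((key hv hIw).sub (key hIv hw)).ofReal.const_mul I)).const_mul (1 / 4)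

/-- On the compact unit sphere of these directions the limit is 1, so the values eventually exceed
1/2; homogeneity does the rest. -/
lemma eventually_levi_ge {r : Cspace d → ℝ} {p : Cspace d} (hr : ContDiffAt ℝ 2 r p)
    {q : ℕ → Cspace d} (hq : Tendsto q atTop (𝓝 p)) {L : ℕ → Cspace d →L[ℂ] Cspace d}
    {L₀ : Cspace d →L[ℂ] Cspace d} (hL : Tendsto L atTop (𝓝 L₀))
    (h₀ : ∀ z : Cspace d, z 0 = 0 → z 1 = 0 → (leviH r p (L₀ z) (L₀ z)).re = ‖z‖ ^ 2) :
    ∀ᶠ n in atTop, ∀ z : Cspace d, z 0 = 0 → z 1 = 0 →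
      1 / 2 * ‖z‖ ^ 2 ≤ (leviH r (q n) (L n z) (L n z)).re := by
  have hK : IsCompact (Metric.sphere (0 : Cspace d) 1 ∩ {z | z 0 = 0 ∧ z 1 = 0}) := by
    refine (isCompact_sphere _ _).inter_right (IsClosed.inter ?_ ?_)
    · exact isClosed_eq (differentiable_coord 0).continuous continuous_const
    · exact isClosed_eq (differentiable_coord 1).continuous continuous_const
  have h1 : ∀ᶠ n in atTop, ∀ z ∈ Metric.sphere (0 : Cspace d) 1 ∩ {z | z 0 = 0 ∧ z 1 = 0},
      1 / 2 < (leviH r (q n) (L n z) (L n z)).re := by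
    refine eventually_forall_of_isCompact hK fun z hz => ?_
    have hLz : Tendsto (fun y : ℕ × Cspace d => L y.1 y.2) (atTop ×ˢ 𝓝 z) (𝓝 (L₀ z)) :=
      tendsto_clm_apply (hL.comp tendsto_fst) tendsto_snd
    have h2 := (continuous_re.tendsto _).comp (tendsto_leviH hr (hq.comp tendsto_fst) hLz hLz)
    rw [h₀ z hz.2.1 hz.2.2, mem_sphere_zero_iff_norm.1 hz.1] at h2
    exact h2.eventually (lt_mem_nhds (by norm_num))
  filter_upwards [h1] with n hn z hz0 hz1
  rcases eq_or_ne z 0 with rfl | hz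
  · simp [leviH]
  have hpos : 0 < ‖z‖ := norm_pos_iff.2 hz
  have h3 := hn ((‖z‖⁻¹ : ℂ) • z) ⟨by simp [norm_smul, hpos.ne'], by simp [hz0], by simp [hz1]⟩
  rw [map_smul, leviH_smul_left, leviH_smul_right, ← ofReal_inv, conj_ofReal, re_ofReal_mul,
    re_ofReal_mul] at h3
  have h4 : (leviH r (q n) (L n z) (L n z)).re =
      ‖z‖ ^ 2 * (‖z‖⁻¹ * (‖z‖⁻¹ * (leviH r (q n) (L n z) (L n z)).re)) := by
    field_simp
  rw [h4, mul_comm]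
  exact mul_le_mul_of_nonneg_left h3.le (by positivity)

/-- Boundary points `q_n`, frames and normal curves at `q_n`, converging to a frame at `p`, such
that `u_n` lies on the complex normal of the frame at `q_n`. -/
structure NormalData (N : ℕ) (r : Cspace d → ℝ) (p : Cspace d) (u : ℕ → Cspace d) where
  L₀ : Cspace d ≃L[ℂ] Cspace d
  q : ℕ → Cspace d
  L : ℕ → Cspace d ≃L[ℂ] Cspace d
  c : ℕ → Fin N → Cspace d
  η : ℕ → Fin (d + 1) → Fin N → ℂ
  a : ℕ → ℕ × ℕ → ℂ
  b : ℕ → Fin (d + 1) → ℕ × ℕ → ℂ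
  ε : ℕ → ℝ
  θ : ℕ → ℂ
  C : ℝ
  δ : ℝ
  holDeriv_eq : ∀ z, holDeriv r p (L₀ z) = z 0 / 2
  levi_eq : ∀ z : Cspace d, z 0 = 0 → z 1 = 0 → (leviH r p (L₀ z) (L₀ z)).re = ‖z‖ ^ 2
  ε_pos : ∀ n, 0 < ε n
  ε_tendsto : Tendsto ε atTop (𝓝 0)
  q_tendsto : Tendsto q atTop (𝓝 p)
  L_tendsto : Tendsto (fun n => (L n : Cspace d →L[ℂ] Cspace d)) atTop
    (𝓝 (L₀ : Cspace d →L[ℂ] Cspace d))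
  c_one : ∀ n j, c n j 1 = 0
  c_le : ∀ n, ‖c n‖ ≤ C
  η_le : ∀ n α, ‖η n α‖ ≤ C
  δ_pos : 0 < δ
  jet : ∀ᶠ n in atTop, ∀ z : ℂ, ‖z‖ ≤ δ →
    ‖(alongCurve r (q n) (L n : Cspace d →L[ℂ] Cspace d) (c n) z : ℂ)
      - ∑ m ∈ mixedIndex N, a n m * monom m z‖ ≤ C * ‖z‖ ^ (N + 1)
  jet_deriv : ∀ᶠ n in atTop, ∀ α ∈ starIndex d, ∀ z : ℂ, ‖z‖ ≤ δ →
    ‖derivAlongCurve r (q n) (L n : Cspace d →L[ℂ] Cspace d) (c n) (EuclideanSpace.single α 1)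
      (η n α) z - ∑ m ∈ mixedIndex N, b n α m * monom m z‖ ≤ C * ‖z‖ ^ (N + 1)
  θ_tendsto : Tendsto θ atTop (𝓝 1)
  base : ∀ᶠ n in atTop, u n = q n - ((ε n : ℂ) * θ n) • L n (EuclideanSpace.single 0 1)

/-- All points are projected along the same vector L₀ e_0 and the frames are corrections of L₀ along
it. They converge to L₀ and inherit its Levi bound, so the uniform normal curves apply. -/
lemma nonempty_normalData (hd : 1 ≤ d) {Ω W : Set (Cspace d)} (hopen : IsOpen Ω)
    (hpsc : IsPseudoconvex Ω) (hrank : HasLeviCorankAtMostOne Ω) {u : ℕ → Cspace d}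
    (hu : ∀ n, u n ∈ Ω) {p : Cspace d} (hp : p ∈ frontier Ω) (hup : Tendsto u atTop (𝓝 p))
    {r : Cspace d → ℝ} (hpW : p ∈ W) (hr : IsDefiningFunctionOn Ω W r) (N : ℕ) :
    Nonempty (NormalData N r p u) := by
  have hr0 : r p = 0 := hr.eq_zero_of_mem_frontier hopen hpW hp
  have hr2 : ContDiffAt ℝ 2 r p := hr.contDiffAt hpW 2
  have hWp := hr.isOpen.mem_nhds hpW
  obtain ⟨L₀, hL₀, hlev⟩ := exists_adapted_basis hd hr2 (hr.fderiv_ne_zero p hpW hr0)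
    (fun X hX => hpsc.leviH_nonneg hr hpW hr0 X hX) (hrank W r hr p ⟨hp, hpW⟩)
  set e₀ : Cspace d := EuclideanSpace.single 0 1 with he₀
  have hν : holDeriv r p (L₀ e₀) = 1 / 2 := by rw [hL₀]; simp [he₀]
  obtain ⟨s, hs, hs0, hsr⟩ := exists_boundary_projection hr.isOpen hr.smooth hpW hr0
    (ν := L₀ e₀) (by rw [fderiv_eq_two_re_holDeriv, hν]; norm_num) hup
    (by filter_upwards [hup.eventually hWp] with n hn using (hr.mem_iff _ hn).1 (hu n))
  set q : ℕ → Cspace d := fun n => u n + s n • L₀ e₀ with hq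
  have hqlim : Tendsto q atTop (𝓝 p) := by simpa using hup.add (hs0.smul_const (L₀ e₀))
  have hadj : Tendsto (fun n => adjustedMap r (L₀ : Cspace d →L[ℂ] Cspace d) (q n)) atTop
      (𝓝 (L₀ : Cspace d →L[ℂ] Cspace d)) := by
    have h1 := (continuousAt_adjustedMap (L := (L₀ : Cspace d →L[ℂ] Cspace d)) hr2
      (by rw [ContinuousLinearEquiv.coe_coe, hν]; norm_num)).tendsto.comp hqlim
    rwa [adjustedMap_self (by simpa using hL₀)] at h1
  have hinv : ∀ᶠ n in atTop, ∃ e : Cspace d ≃L[ℂ] Cspace d, (e : Cspace d →L[ℂ] Cspace d) =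
      adjustedMap r (L₀ : Cspace d →L[ℂ] Cspace d) (q n) :=
    hadj.eventually (ContinuousLinearEquiv.nhds L₀)
  classical
  -- Invertibility of the corrected frame holds only for large n; L₀ fills in before that.
  set L : ℕ → Cspace d ≃L[ℂ] Cspace d := fun n =>
    if h : ∃ e : Cspace d ≃L[ℂ] Cspace d, (e : Cspace d →L[ℂ] Cspace d) =
      adjustedMap r (L₀ : Cspace d →L[ℂ] Cspace d) (q n) then h.choose else L₀ with hLdef
  have hLn : ∀ᶠ n in atTop, (L n : Cspace d →L[ℂ] Cspace d) =
      adjustedMap r (L₀ : Cspace d →L[ℂ] Cspace d) (q n) := by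
    filter_upwards [hinv] with n hn
    simp only [hLdef, dif_pos hn]
    exact hn.choose_spec
  have hLlim : Tendsto (fun n => (L n : Cspace d →L[ℂ] Cspace d)) atTop
      (𝓝 (L₀ : Cspace d →L[ℂ] Cspace d)) :=
    hadj.congr' (hLn.mono fun n hn => hn.symm)
  have hhol : Tendsto (fun n => holDeriv r (q n) (L₀ e₀)) atTop (𝓝 (1 / 2)) := by
    rw [← hν]
    exact tendsto_holDeriv hr2 hqlim tendsto_const_nhds
  have hne : ∀ᶠ n in atTop, holDeriv r (q n) (L₀ e₀) ≠ 0 :=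
    hhol.eventually_ne (by norm_num)
  have hadapted : ∀ᶠ n in atTop, IsAdapted r (q n) (L n : Cspace d →L[ℂ] Cspace d) := by
    filter_upwards [hsr, hLn, hne, eventually_levi_ge hr2 hqlim hLlim hlev] with n h1 h2 h3 h4
    refine ⟨h1, fun z => ?_, h4⟩
    rw [h2]
    exact holDeriv_adjustedMap h3 z
  obtain ⟨δ₀, hδ₀, hball⟩ := Metric.nhds_basis_closedBall.mem_iff.1 hWp
  obtain ⟨C, hC, δ, hδ, H⟩ := exists_normal_curve hr.isOpen hr.smooth hd hball
    (‖(L₀ : Cspace d →L[ℂ] Cspace d)‖ + 1) N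
  -- Zero data are used where the frame is not yet adapted. The bounds and the condition on c then
  -- hold for every n, as the rescaling maps require, and only the jet estimates are asymptotic.
  have H' : ∀ n, ∃ (c : Fin N → Cspace d) (η : Fin (d + 1) → Fin N → ℂ) (a : ℕ × ℕ → ℂ)
      (b : Fin (d + 1) → ℕ × ℕ → ℂ),
      ‖c‖ ≤ C ∧ (∀ α, ‖η α‖ ≤ C) ∧ (∀ j, c j 1 = 0) ∧
      ((q n ∈ Metric.closedBall p δ₀ ∧ ‖(L n : Cspace d →L[ℂ] Cspace d)‖ ≤
          ‖(L₀ : Cspace d →L[ℂ] Cspace d)‖ + 1 ∧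
          IsAdapted r (q n) (L n : Cspace d →L[ℂ] Cspace d)) →
        (∀ z : ℂ, ‖z‖ ≤ δ → ‖(alongCurve r (q n) (L n : Cspace d →L[ℂ] Cspace d) c z : ℂ)
          - ∑ m ∈ mixedIndex N, a m * monom m z‖ ≤ C * ‖z‖ ^ (N + 1)) ∧
        ∀ α : Fin (d + 1), 2 ≤ (α : ℕ) → ∀ z : ℂ, ‖z‖ ≤ δ →
          ‖derivAlongCurve r (q n) (L n : Cspace d →L[ℂ] Cspace d) c (EuclideanSpace.single α 1)
            (η α) z - ∑ m ∈ mixedIndex N, b α m * monom m z‖ ≤ C * ‖z‖ ^ (N + 1)) := by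
    intro n
    by_cases hn : q n ∈ Metric.closedBall p δ₀ ∧ ‖(L n : Cspace d →L[ℂ] Cspace d)‖ ≤
        ‖(L₀ : Cspace d →L[ℂ] Cspace d)‖ + 1 ∧ IsAdapted r (q n) (L n : Cspace d →L[ℂ] Cspace d)
    · obtain ⟨c, η, a, b, h1, h2, h3, h4, h5⟩ := H (q n) hn.1 _ hn.2.1 hn.2.2
      exact ⟨c, η, a, b, h1, h2, h3, fun _ => ⟨h4, h5⟩⟩
    · exact ⟨0, 0, 0, 0, by simpa using hC.le, by simpa using hC.le, by simp,
        fun h => absurd h hn⟩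
  choose c η a b h1 h2 h3 h6 using H'
  have hgood : ∀ᶠ n in atTop, q n ∈ Metric.closedBall p δ₀ ∧
      ‖(L n : Cspace d →L[ℂ] Cspace d)‖ ≤ ‖(L₀ : Cspace d →L[ℂ] Cspace d)‖ + 1 ∧
      IsAdapted r (q n) (L n : Cspace d →L[ℂ] Cspace d) :=
    (hqlim.eventually (Metric.closedBall_mem_nhds p hδ₀)).and
      ((hLlim.norm.eventually (ge_mem_nhds (lt_add_one _))).and hadapted)
  refine ⟨{ L₀ := L₀, q := q, L := L, c := c, η := η, a := a, b := b, ε := s,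
            θ := fun n => 2 * holDeriv r (q n) (L₀ e₀), C := C, δ := δ, holDeriv_eq := hL₀,
            levi_eq := hlev, ε_pos := hs, ε_tendsto := hs0, q_tendsto := hqlim,
            L_tendsto := hLlim, c_one := h3, c_le := h1, η_le := h2,
            δ_pos := hδ, jet := hgood.mono fun n hn => (h6 n hn).1,
            jet_deriv := hgood.mono fun n hn α hα => (h6 n hn).2 α (by simpa using hα),
            θ_tendsto := ?_, base := ?_ }⟩
  · simpa using hhol.const_mul 2
  · filter_upwards [hLn, hne] with n hn1 hn2
    have h7 : L n e₀ = (1 / (2 * holDeriv r (q n) (L₀ e₀))) • L₀ e₀ := by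
      have h8 := adjustedMap_single (L := (L₀ : Cspace d →L[ℂ] Cspace d)) hn2
      rw [← hn1] at h8
      exact h8
    rw [h7, smul_smul, mul_assoc, mul_one_div_cancel (by simpa using hn2), mul_one, coe_smul, hq]
    simp

end

section

variable {d N : ℕ} {r : Cspace d → ℝ} {p : Cspace d} {u : ℕ → Cspace d}

/-! ### The rescaling maps -/

/-- The limit of the rescaled functions, given limits of the normalised coefficients. -/
noncomputable def limitFunction (N : ℕ) (a : ℕ × ℕ → ℂ) (b : Fin (d + 1) → ℕ × ℕ → ℂ)
    (ζ : Cspace d) : ℝ :=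
  (ζ 0).re + (∑ m ∈ mixedIndex N, a m * monom m (ζ 1)).re +
    2 * (∑ α ∈ starIndex d, ζ α * ∑ m ∈ mixedIndex N, b α m * monom m (ζ 1)).re +
    ∑ α ∈ starIndex d, ‖ζ α‖ ^ 2

lemma continuous_sum_monom (s : Finset (ℕ × ℕ)) (a : ℕ × ℕ → ℂ) :
    Continuous fun z => ∑ m ∈ s, a m * monom m z :=
  continuous_finsetSum _ fun m _ => continuous_const.mul (continuous_monom m)

lemma continuous_limitFunction (N : ℕ) (a : ℕ × ℕ → ℂ) (b : Fin (d + 1) → ℕ × ℕ → ℂ) :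
    Continuous (limitFunction N a b) := by
  have hcoord : ∀ j, Continuous fun ζ : Cspace d => ζ j := fun j =>
    (differentiable_coord j).continuous
  refine (((continuous_re.comp (hcoord 0)).add (continuous_re.comp
    ((continuous_sum_monom _ a).comp (hcoord 1)))).add (continuous_const.mul (continuous_re.comp
      (continuous_finsetSum _ fun α _ => (hcoord α).mul
        ((continuous_sum_monom _ (b α)).comp (hcoord 1)))))).add
    (continuous_finsetSum _ fun α _ => (hcoord α).norm.pow 2)

lemma tendstoLocallyUniformly_of_tendsto {ι X : Type*} [TopologicalSpace X] {l : Filter ι}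
    {F : ι → X → ℝ} {f : X → ℝ} (hf : Continuous f)
    (h : ∀ x, Tendsto (fun y : ι × X => F y.1 y.2) (l ×ˢ 𝓝 x) (𝓝 (f x))) :
    TendstoLocallyUniformly F f l := by
  rw [tendstoLocallyUniformly_iff_forall_tendsto]
  intro x
  exact (((hf.tendsto x).comp tendsto_snd).prodMk_nhds (h x)).mono_right (nhds_le_uniformity (f x))

namespace NormalData

variable (D : NormalData N r p u)

/-- The quadratic form that cancels the holomorphic part of the second derivative at `p`. -/
noncomputable def κ : Cspace d →ₗ[ℂ] Cspace d →ₗ[ℂ] ℂ :=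
  -(holQuad r p).compl₁₂ (D.L₀ : Cspace d →ₗ[ℂ] Cspace d) (D.L₀ : Cspace d →ₗ[ℂ] Cspace d)

lemma κ_apply (v w : Cspace d) : D.κ v w = -holQuad r p (D.L₀ v) (D.L₀ w) := rfl

/-- The rescaling maps with scales `τ_n` along the normal curves. -/
noncomputable def ψ (hd : 1 ≤ d) {τ : ℕ → ℝ} (hτ : ∀ n, 0 < τ n) (n : ℕ) : Cspace d ≃ Cspace d :=
  (scalingInv hd (D.q n) (D.L n) (D.c n) (D.c_one n) (D.η n) D.κ (D.ε_pos n) (hτ n)).symm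

lemma ψ_symm_apply (hd : 1 ≤ d) {τ : ℕ → ℝ} (hτ : ∀ n, 0 < τ n) (n : ℕ) (ζ : Cspace d) :
    (D.ψ hd hτ n).symm ζ = D.q n + (D.L n : Cspace d →L[ℂ] Cspace d) (curve (D.c n) (τ n * ζ 1)) +
      (D.L n : Cspace d →L[ℂ] Cspace d) (displacement (D.η n) D.κ (D.ε n) (τ n) ζ) :=
  scalingInv_apply hd (D.q n) (D.L n) (D.c n) (D.c_one n) (D.η n) D.κ (D.ε_pos n) (hτ n) ζ

lemma tendsto_ψ_symm (hd : 1 ≤ d) {τ : ℕ → ℝ} (hτ : ∀ n, 0 < τ n) (hτ0 : Tendsto τ atTop (𝓝 0))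
    {ι : Type*} {l : Filter ι} {φ : ι → ℕ} (hφ : Tendsto φ l atTop) {Z : ι → Cspace d}
    {ζ : Cspace d} (hZ : Tendsto Z l (𝓝 ζ)) :
    Tendsto (fun i => (D.ψ hd hτ (φ i)).symm (Z i)) l (𝓝 p) := by
  simp only [ψ_symm_apply]
  exact tendsto_scaling_point (D.q_tendsto.comp hφ) (D.L_tendsto.comp hφ)
    (c := fun i => D.c (φ i)) (η := fun i => D.η (φ i)) (C := D.C)
    (Eventually.of_forall fun i => D.c_le _) (Eventually.of_forall fun i α => D.η_le _ α) D.κ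
    (fun i => D.ε_pos (φ i)) (D.ε_tendsto.comp hφ) (hτ0.comp hφ) hZ

lemma eventually_ψ_symm_mem (hd : 1 ≤ d) {τ : ℕ → ℝ} (hτ : ∀ n, 0 < τ n)
    (hτ0 : Tendsto τ atTop (𝓝 0)) {K : Set (Cspace d)} (hK : IsCompact K) {V : Set (Cspace d)}
    (hV : V ∈ 𝓝 p) : ∀ᶠ n in atTop, ∀ ζ ∈ K, (D.ψ hd hτ n).symm ζ ∈ V :=
  eventually_forall_of_isCompact hK fun _ _ =>
    (D.tendsto_ψ_symm hd hτ hτ0 tendsto_fst tendsto_snd).eventually hV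

/-- Neither the correction nor the curve involves ζ_0, so the maps are affine in it. This supplies
the translation hypothesis of `sub_mean_of_tendsto` and locates the base points. -/
lemma ψ_symm_add (hd : 1 ≤ d) {τ : ℕ → ℝ} (hτ : ∀ n, 0 < τ n) (n : ℕ) (ζ : Cspace d) (t : ℂ) :
    (D.ψ hd hτ n).symm (ζ + t • EuclideanSpace.single 0 1) = (D.ψ hd hτ n).symm ζ +
      ((D.ε n : ℂ) * t) • D.L n (EuclideanSpace.single 0 1) := by
  have h0 : (ζ + t • (EuclideanSpace.single 0 1 : Cspace d)) 0 = ζ 0 + t := by simp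
  have h1 : ∀ α ≠ 0, (ζ + t • (EuclideanSpace.single 0 1 : Cspace d)) α = ζ α := fun α hα => by
    simp [hα]
  have h2 : ∀ α ∈ starIndex d, α ≠ 0 := by
    rintro α hα rfl
    simp at hα
  have h3 : starProj d (ζ + t • (EuclideanSpace.single 0 1 : Cspace d)) = starProj d ζ := by
    rw [starProj_apply, starProj_apply]
    exact Finset.sum_congr rfl fun α hα => by rw [h1 α (h2 α hα)]
  have h4 : displacement (D.η n) D.κ (D.ε n) (τ n) (ζ + t • EuclideanSpace.single 0 1) =
      displacement (D.η n) D.κ (D.ε n) (τ n) ζ +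
        ((D.ε n : ℂ) * t) • EuclideanSpace.single 0 1 := by
    rw [displacement, displacement, h3, h0, h1 1 (fin_one_ne_zero hd), Finset.sum_congr rfl
      fun α hα => by rw [h1 α (h2 α hα)]]
    module
  rw [ψ_symm_apply, ψ_symm_apply, h4, h1 1 (fin_one_ne_zero hd), map_add, map_smul, ← add_assoc]
  rfl

lemma ψ_symm_single (hd : 1 ≤ d) {τ : ℕ → ℝ} (hτ : ∀ n, 0 < τ n) (n : ℕ) (t : ℂ) :
    (D.ψ hd hτ n).symm (t • EuclideanSpace.single 0 1) =
      D.q n + ((D.ε n : ℂ) * t) • D.L n (EuclideanSpace.single 0 1) := by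
  have h := D.ψ_symm_add hd hτ n 0 t
  rw [zero_add] at h
  rw [h, ψ_symm_apply]
  simp [displacement, curve_zero]

theorem isScaling (hd : 1 ≤ d) {τ : ℕ → ℝ} (hτ : ∀ n, 0 < τ n) (hτ0 : Tendsto τ atTop (𝓝 0))
    {W : Set (Cspace d)} (hW : W ∈ 𝓝 p) : IsScaling W u (D.ψ hd hτ) D.ε where
  biholomorphic n := (isBiholomorphic_scalingInv hd _ _ _ _ _ _ _ _).symm
  pos := D.ε_pos
  tendsto_zero := D.ε_tendsto
  exhaust K hK := by
    filter_upwards [D.eventually_ψ_symm_mem hd hτ hτ0 hK hW] with n hn ζ hζ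
    exact ⟨_, hn ζ hζ, Equiv.apply_symm_apply _ _⟩
  tendsto_base := by
    have h1 : Tendsto (fun n => (-D.θ n) • (EuclideanSpace.single 0 1 : Cspace d)) atTop
        (𝓝 (EuclideanSpace.single 0 (-1))) := by
      have h2 := D.θ_tendsto.neg.smul_const (EuclideanSpace.single 0 1 : Cspace d)
      have h3 : (-1 : ℂ) • (EuclideanSpace.single 0 1 : Cspace d) = EuclideanSpace.single 0 (-1) := by
        ext j
        by_cases hj : j = 0
        · subst hj; simp
        · simp [hj]
      rwa [h3] at h2
    -- By the choice of q_n, the point u_n is the image of -θ_n e_0, and θ_n → 1.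
    refine h1.congr' ?_
    filter_upwards [D.base] with n hn
    rw [eq_comm, ← Equiv.eq_symm_apply, ψ_symm_single, hn, mul_neg, neg_smul, sub_eq_add_neg]

theorem tendstoLocallyUniformly_rescaled (hd : 1 ≤ d) (hr : ContDiffAt ℝ 2 r p) {τ : ℕ → ℝ}
    (hτ : ∀ n, 0 < τ n) (hτ0 : Tendsto τ atTop (𝓝 0))
    (hτN : Tendsto (fun n => τ n ^ (N + 1) / D.ε n) atTop (𝓝 0)) {φ : ℕ → ℕ}
    (hφ : Tendsto φ atTop atTop) {a : ℕ × ℕ → ℂ} {b : Fin (d + 1) → ℕ × ℕ → ℂ}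
    (ha : ∀ m ∈ mixedIndex N, Tendsto (fun n =>
      D.a (φ n) m * ((τ (φ n) ^ (m.1 + m.2) / D.ε (φ n) : ℝ) : ℂ)) atTop (𝓝 (a m)))
    (hb : ∀ α ∈ starIndex d, ∀ m ∈ mixedIndex N, Tendsto (fun n =>
      D.b (φ n) α m * ((τ (φ n) ^ (m.1 + m.2) / √(D.ε (φ n)) : ℝ) : ℂ)) atTop (𝓝 (b α m))) :
    TendstoLocallyUniformly (fun n => rescaled r (D.ψ hd hτ (φ n)) (D.ε (φ n)))
      (limitFunction N a b) atTop := by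
  refine tendstoLocallyUniformly_of_tendsto (continuous_limitFunction N a b) fun ζ => ?_
  have hfst : Tendsto (fun y : ℕ × Cspace d => y.1) (atTop ×ˢ 𝓝 ζ) atTop := tendsto_fst
  have hφ' : Tendsto (fun y : ℕ × Cspace d => φ y.1) (atTop ×ˢ 𝓝 ζ) atTop := hφ.comp hfst
  have key := tendsto_rescaled hr (D.q_tendsto.comp hφ') (D.L_tendsto.comp hφ')
    (by rw [ContinuousLinearEquiv.coe_coe, D.holDeriv_eq]; simp)
    (c := fun y => D.c (φ y.1)) (η := fun y => D.η (φ y.1)) (C := D.C)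
    (Eventually.of_forall fun i => D.c_le _) (Eventually.of_forall fun i α => D.η_le _ α) D.κ
    (ε := fun y => D.ε (φ y.1)) (τ := fun y => τ (φ y.1))
    (fun i => D.ε_pos _) (D.ε_tendsto.comp hφ') (fun i => hτ _) (hτ0.comp hφ') (hτN.comp hφ')
    (a := fun y => D.a (φ y.1)) (b := fun y => D.b (φ y.1))
    (fun m hm => (ha m hm).comp hfst) (fun α hα m hm => (hb α hα m hm).comp hfst) D.δ_pos
    (hφ'.eventually D.jet) (fun α hα => (hφ'.eventually D.jet_deriv).mono fun i hi => hi α hα)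
    tendsto_snd
  -- κ cancels the holomorphic part of the Hessian at p; the Levi form that remains is normalised to
  -- the squared norm.
  have e : (D.κ (starProj d ζ) (starProj d ζ)).re + 1 / 2 * hess r p
      ((D.L₀ : Cspace d →L[ℂ] Cspace d) (starProj d ζ))
      ((D.L₀ : Cspace d →L[ℂ] Cspace d) (starProj d ζ)) = ∑ α ∈ starIndex d, ‖ζ α‖ ^ 2 := by
    rw [ContinuousLinearEquiv.coe_coe, half_hess_eq, κ_apply, neg_re,
      D.levi_eq _ (starProj_zero_coord ζ) (starProj_one_coord ζ), norm_starProj_sq]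
    ring
  rw [e] at key
  refine key.congr fun y => ?_
  rw [rescaled, ψ_symm_apply]
  rfl

/-! ### The lower bound for the coefficients -/

/-- It bounds the denominator in the D'Angelo type for the limit of the normal curves, which is an
immersion at 0. -/
lemma vanishingOrder_le_one {F : Type*} [NormedAddCommGroup F] {f : ℂ → F}
    (h : (fun t : ℂ => ‖t‖) =O[𝓝 0] f) : vanishingOrder f ≤ 1 := by
  refine iSup₂_le fun k hk => ?_
  have h1 := h.trans hk
  have h2 : k ≤ 1 := by
    by_contra! hlt
    have h3 := h1.trans (pow_isBigO (show 2 ≤ k by omega))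
    obtain ⟨C, hC, h4⟩ := h3.exists_pos
    have hnorm : Tendsto (fun z : ℂ => C * ‖z‖) (𝓝 0) (𝓝 0) := by
      simpa using (tendsto_norm (x := (0 : ℂ))).const_mul C
    have h5 : ∀ᶠ z : ℂ in 𝓝[≠] 0, C * ‖z‖ < 1 ∧ ‖z‖ ≤ C * ‖z‖ ^ 2 ∧ z ≠ 0 := by
      filter_upwards [nhdsWithin_le_nhds (hnorm.eventually (gt_mem_nhds one_pos)),
        nhdsWithin_le_nhds h4.bound, self_mem_nhdsWithin] with z h6 h7 h8
      rw [norm_norm, norm_pow, norm_norm] at h7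
      exact ⟨h6, h7, h8⟩
    obtain ⟨z, h6, h7, h8⟩ := h5.exists
    have h9 : 0 < ‖z‖ := norm_pos_iff.2 h8
    nlinarith
  exact_mod_cast h2

/-- The mixed coefficients of degree at most `N` do not all tend to zero, if the type is less than
`N + 1`. -/
lemma exists_coeff_lower_bound (hr : ∀ᶠ x in 𝓝 p, ContinuousAt r x)
    (hT : dAngeloType r p < (N + 1 : ℕ)) :
    ∃ c₀ > 0, ∀ᶠ n in atTop, c₀ ≤ ∑ m ∈ mixedIndex N, ‖D.a n m‖ := by
  by_contra! hcon
  have hfreq : ∀ k : ℕ, ∃ᶠ n in atTop, ∑ m ∈ mixedIndex N, ‖D.a n m‖ < 1 / ((k : ℝ) + 1) := by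
    intro k
    have := hcon (1 / ((k : ℝ) + 1)) (by positivity)
    simpa [not_eventually] using this
  -- Without a lower bound the coefficients tend to zero on a subsequence; a further one makes the
  -- curve coefficients converge.
  obtain ⟨φ, hφ, hφ'⟩ := extraction_forall_of_frequently hfreq
  obtain ⟨c, -, φ', hφ'm, hc⟩ := tendsto_subseq_of_bounded (x := fun k => D.c (φ k))
    (Metric.isBounded_closedBall (x := (0 : Fin N → Cspace d)) (r := D.C))
    (fun k => by simpa using D.c_le (φ k))
  have hσ : Tendsto (fun k => φ (φ' k)) atTop atTop := (hφ.comp hφ'm).tendsto_atTop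
  have hsum : Tendsto (fun k => ∑ m ∈ mixedIndex N, ‖D.a (φ (φ' k)) m‖) atTop (𝓝 0) := by
    refine squeeze_zero (fun k => Finset.sum_nonneg fun m _ => norm_nonneg _)
      (fun k => (hφ' (φ' k)).le) ?_
    exact tendsto_one_div_add_atTop_nhds_zero_nat.comp hφ'm.tendsto_atTop
  have ha : ∀ m ∈ mixedIndex N, Tendsto (fun k => D.a (φ (φ' k)) m) atTop (𝓝 0) := by
    intro m hm
    refine squeeze_zero_norm (fun k => ?_) hsum
    exact Finset.single_le_sum (f := fun m => ‖D.a (φ (φ' k)) m‖)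
      (fun m _ => norm_nonneg _) hm
  set γ : ℂ → Cspace d := fun z => p + D.L₀ (curve c z) with hγ
  have hγd : Differentiable ℂ γ :=
    (differentiable_const p).add (D.L₀.differentiable.comp (differentiable_curve c))
  have hγ0 : γ 0 = p := by simp [hγ, curve_zero]
  have hcont : ∀ᶠ z in 𝓝 (0 : ℂ), ContinuousAt r (γ z) := by
    have := hγd.continuous.tendsto 0
    rw [hγ0] at this
    exact this.eventually hr
  -- The jet estimate has constants independent of n, so it passes to the limit curve, whose jet has
  -- lost all its terms up to order N.
  have hO : (fun z => r (γ z)) =O[𝓝 0] fun z : ℂ => ‖z‖ ^ (N + 1) := by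
    refine Asymptotics.IsBigO.of_bound D.C ?_
    filter_upwards [hcont, Metric.closedBall_mem_nhds (0 : ℂ) D.δ_pos] with z hz1 hz2
    have hz2 : ‖z‖ ≤ D.δ := by simpa using hz2
    have hcurve : Tendsto (fun k => curve (D.c (φ (φ' k))) z) atTop (𝓝 (curve c z)) := by
      refine tendsto_const_nhds.add (tendsto_finsetSum _ fun j _ => ?_)
      exact ((tendsto_pi_nhds.1 hc j)).const_smul (z ^ ((j : ℕ) + 1))
    have h1 : Tendsto (fun k => alongCurve r (D.q (φ (φ' k)))
        (D.L (φ (φ' k)) : Cspace d →L[ℂ] Cspace d) (D.c (φ (φ' k))) z) atTop (𝓝 (r (γ z))) :=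
      hz1.tendsto.comp ((D.q_tendsto.comp hσ).add
        (tendsto_clm_apply (D.L_tendsto.comp hσ) hcurve))
    have h2 : Tendsto (fun k => ∑ m ∈ mixedIndex N, D.a (φ (φ' k)) m * monom m z) atTop (𝓝 0) := by
      simpa using tendsto_finsetSum (mixedIndex N) fun m hm => (ha m hm).mul_const (monom m z)
    have h3 := (h1.ofReal.sub h2).norm
    rw [sub_zero, norm_real] at h3
    rw [norm_pow, norm_norm]
    exact le_of_tendsto h3 ((hσ.eventually D.jet).mono fun k hk => hk z hz2)
  -- The coordinate of the limit curve along e_1 is exactly t, because c j 1 = 0 persists in the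
  -- limit.
  have hid : (fun t : ℂ => ‖t‖) =O[𝓝 0] fun t => γ t - p := by
    have h1 : (fun t => curve c t) =O[𝓝 0] fun t => γ t - p := by
      have := (D.L₀.symm : Cspace d →L[ℂ] Cspace d).isBigO_comp (fun t => γ t - p) (𝓝 (0 : ℂ))
      simpa [hγ] using this
    have hc1 : ∀ j, c j 1 = 0 := by
      intro j
      have h2 : Tendsto (fun k => D.c (φ (φ' k)) j 1) atTop (𝓝 (c j 1)) :=
        ((differentiable_coord 1).continuous.tendsto (c j)).comp (tendsto_pi_nhds.1 hc j)
      simp only [D.c_one] at h2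
      exact tendsto_nhds_unique h2 tendsto_const_nhds
    refine (Asymptotics.IsBigO.of_bound 1 (Eventually.of_forall fun t => ?_)).trans h1
    rw [one_mul, norm_norm]
    have h3 := PiLp.norm_apply_le (curve c t) 1
    rwa [curve_eq, PiLp.add_apply, curveTail_one c hc1, add_zero, PiLp.smul_apply,
      PiLp.single_apply, if_pos rfl, smul_eq_mul, mul_one, ← curve_eq] at h3
  have hne : ¬ ∀ᶠ t in 𝓝 (0 : ℂ), γ t = p := by
    intro hall
    obtain ⟨C, -, hC⟩ := hid.exists_pos
    have h1 : ∀ᶠ t : ℂ in 𝓝[≠] 0, False := by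
      filter_upwards [nhdsWithin_le_nhds hall, nhdsWithin_le_nhds hC.bound, self_mem_nhdsWithin]
        with t h2 h3 h4
      rw [h2, sub_self, norm_zero, mul_zero, norm_norm] at h3
      exact h4 (norm_le_zero_iff.1 h3)
    exact h1.exists.choose_spec
  have hle : ((N + 1 : ℕ) : ℝ≥0∞) ≤ dAngeloType r p := by
    have h1 : ((N + 1 : ℕ) : ℝ≥0∞) ≤ vanishingOrder fun t => r (γ t) :=
      le_iSup₂ (f := fun (k : ℕ) (_ : (fun t => r (γ t)) =O[𝓝 0] fun t : ℂ => ‖t‖ ^ k) =>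
        (k : ℝ≥0∞)) (N + 1) hO
    have h2 : vanishingOrder (fun t => r (γ t)) / vanishingOrder (fun t => γ t - p) ≤
        dAngeloType r p :=
      le_iSup₂ (f := fun (γ : ℂ → Cspace d)
        (_ : AnalyticAt ℂ γ 0 ∧ γ 0 = p ∧ ¬ ∀ᶠ t in 𝓝 0, γ t = p) =>
        vanishingOrder (fun t => r (γ t)) / vanishingOrder (fun t => γ t - p)) γ
        ⟨hγd.analyticAt 0, hγ0, hne⟩
    refine h1.trans (le_trans ?_ h2)
    calc vanishingOrder (fun t => r (γ t)) = vanishingOrder (fun t => r (γ t)) / 1 := by simp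
      _ ≤ _ := ENNReal.div_le_div_left (vanishingOrder_le_one hid) _
  exact absurd hle (not_le.2 hT)

end NormalData

end

section

variable {d N : ℕ} {r : Cspace d → ℝ} {p : Cspace d} {u : ℕ → Cspace d}

/-! ### Subharmonicity of the limit -/

/-- The plane `{z_* = v_*}`. -/
noncomputable def slice (v : Cspace d) (ζ : ℂ × ℂ) : Cspace d :=
  ζ.1 • EuclideanSpace.single 0 1 + ζ.2 • EuclideanSpace.single 1 1 + starProj d v

lemma slice_zero (hd : 1 ≤ d) (v : Cspace d) (ζ : ℂ × ℂ) : slice v ζ 0 = ζ.1 := by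
  simp [slice, starProj_zero_coord, (fin_one_ne_zero hd).symm]

lemma slice_one (hd : 1 ≤ d) (v : Cspace d) (ζ : ℂ × ℂ) : slice v ζ 1 = ζ.2 := by
  simp [slice, starProj_one_coord, fin_one_ne_zero hd]

lemma slice_star (v : Cspace d) (ζ : ℂ × ℂ) {α : Fin (d + 1)} (hα : α ∈ starIndex d) :
    slice v ζ α = v α := by
  have h2 : 2 ≤ (α : ℕ) := by simpa using hα
  have h0 : α ≠ 0 := by rintro rfl; simp at h2
  have h1 : α ≠ 1 := by
    rintro rfl
    have := Nat.mod_le 1 (d + 1)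
    simp only [Fin.val_one'] at h2
    omega
  simp [slice, starProj_coord, h0, h1, h2]

lemma differentiable_slice (v : Cspace d) : Differentiable ℂ (slice v) := by
  unfold slice
  fun_prop

lemma limitFunction_slice (hd : 1 ≤ d) (a : ℕ × ℕ → ℂ) (b : Fin (d + 1) → ℕ × ℕ → ℂ)
    (v : Cspace d) (ζ : ℂ × ℂ) : limitFunction N a b (slice v ζ) = ζ.1.re +
      ((∑ m ∈ mixedIndex N, (a m + 2 * ∑ α ∈ starIndex d, v α * b α m) * monom m ζ.2).re +
        ∑ α ∈ starIndex d, ‖v α‖ ^ 2) := by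
  have h1 : ∑ m ∈ mixedIndex N, (a m + 2 * ∑ α ∈ starIndex d, v α * b α m) * monom m ζ.2 =
      ∑ m ∈ mixedIndex N, a m * monom m ζ.2 +
        ((2 : ℝ) : ℂ) * ∑ α ∈ starIndex d, v α * ∑ m ∈ mixedIndex N, b α m * monom m ζ.2 := by
    simp only [add_mul, Finset.sum_add_distrib, Finset.mul_sum, Finset.sum_mul]
    rw [Finset.sum_comm]
    congr 1
    refine Finset.sum_congr rfl fun α _ => Finset.sum_congr rfl fun m _ => ?_
    push_cast
    ring
  have h2 : ∑ α ∈ starIndex d, slice v ζ α * ∑ m ∈ mixedIndex N, b α m * monom m ζ.2 =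
      ∑ α ∈ starIndex d, v α * ∑ m ∈ mixedIndex N, b α m * monom m ζ.2 :=
    Finset.sum_congr rfl fun α hα => by rw [slice_star v ζ hα]
  have h3 : ∑ α ∈ starIndex d, ‖slice v ζ α‖ ^ 2 = ∑ α ∈ starIndex d, ‖v α‖ ^ 2 :=
    Finset.sum_congr rfl fun α hα => by rw [slice_star v ζ hα]
  rw [h1, add_re, re_ofReal_mul, limitFunction, slice_zero hd, slice_one hd, h2, h3]
  ring

namespace NormalData

variable (D : NormalData N r p u)

/-- On the slice ζ_* = v the limit has the form Re w + S(z) required by `sub_mean_of_tendsto`, and v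
enters only through the coefficients. The holomorphic comparison function comes from the Dirichlet
solution g + conj h; transversality holds since ∂r(q)[L e_0] tends to 1/2. -/
theorem sub_mean_limit (hd : 1 ≤ d) {W : Set (Cspace d)} (hW : W ∈ 𝓝 p)
    (hr : ∀ x ∈ W, ContDiffAt ℝ 2 r x)
    (hlevi : ∀ x ∈ W, r x = 0 → ∀ X, holDeriv r x X = 0 → 0 ≤ (leviH r x X X).re)
    {τ : ℕ → ℝ} (hτ : ∀ n, 0 < τ n) (hτ0 : Tendsto τ atTop (𝓝 0)) {φ : ℕ → ℕ}
    (hφ : Tendsto φ atTop atTop) {a : ℕ × ℕ → ℂ} {b : Fin (d + 1) → ℕ × ℕ → ℂ}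
    (hlim : TendstoLocallyUniformly (fun n => rescaled r (D.ψ hd hτ (φ n)) (D.ε (φ n)))
      (limitFunction N a b) atTop) (v : Cspace d) (z₀ : ℂ) {ϱ : ℝ} (hϱ : 0 < ϱ) :
    (∑ m ∈ mixedIndex N, (a m + 2 * ∑ α ∈ starIndex d, v α * b α m) * monom m z₀).re ≤
      (Real.circleAverage (fun z => ∑ m ∈ mixedIndex N,
        (a m + 2 * ∑ α ∈ starIndex d, v α * b α m) * monom m z) z₀ ϱ).re := by
  set s : ℕ × ℕ → ℂ := fun m => a m + 2 * ∑ α ∈ starIndex d, v α * b α m with hs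
  set C₀ : ℝ := ∑ α ∈ starIndex d, ‖v α‖ ^ 2 with hC₀
  obtain ⟨g, h, hgh⟩ := exists_repr_sum_on_circle z₀ ϱ (mixedIndex N) s
  have havg : Real.circleAverage (fun z => ∑ m ∈ mixedIndex N, s m * monom m z) z₀ ϱ =
      g.eval z₀ + starRingEnd ℂ (h.eval z₀) := by
    rw [← circleAverage_add_conj g.differentiable h.differentiable z₀ ϱ]
    refine Real.circleAverage_congr_sphere fun z hz => ?_
    rw [abs_of_pos hϱ, mem_sphere_iff_norm] at hz
    exact hgh z hz
  change (∑ m ∈ mixedIndex N, s m * monom m z₀).re ≤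
    (Real.circleAverage (fun z => ∑ m ∈ mixedIndex N, s m * monom m z) z₀ ϱ).re
  clear_value s C₀
  have hS : Continuous fun z => (∑ m ∈ mixedIndex N, s m * monom m z).re + C₀ :=
    (continuous_re.comp (continuous_sum_monom _ s)).add continuous_const
  have hG : Differentiable ℂ fun z => g.eval z + h.eval z + (C₀ : ℂ) :=
    (g.differentiable.add h.differentiable).add_const (C₀ : ℂ)
  have hSG : ∀ z, ‖z - z₀‖ = ϱ → (∑ m ∈ mixedIndex N, s m * monom m z).re + C₀ =
      (g.eval z + h.eval z + (C₀ : ℂ)).re := fun z hz => by rw [hgh z hz]; simp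
  have hF : ∀ n, Differentiable ℂ fun ζ => (D.ψ hd hτ (φ n)).symm (slice v ζ) := fun n =>
    (D.isScaling hd hτ hτ0 hW).biholomorphic (φ n) |>.2.comp (differentiable_slice v)
  suffices key : (∑ m ∈ mixedIndex N, s m * monom m z₀).re + C₀ ≤
      (g.eval z₀ + h.eval z₀ + (C₀ : ℂ)).re by
    rw [havg]
    simpa using key
  refine sub_mean_of_tendsto hr hlevi hS hG hϱ hSG hF
    (v := fun n => D.ε (φ n) • D.L (φ n) (EuclideanSpace.single 0 1))
    (μ := fun n => 1 / D.ε (φ n)) (fun n => one_div_pos.2 (D.ε_pos _)) ?_ ?_ ?_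
  · have h1 := hlim.comp (slice v) (differentiable_slice v).continuous
    have h2 : limitFunction N a b ∘ slice v = fun ζ => ζ.1.re +
        ((∑ m ∈ mixedIndex N, s m * monom m ζ.2).re + C₀) := by
      funext ζ
      rw [hs, hC₀]
      exact limitFunction_slice hd a b v ζ
    rw [h2] at h1
    exact h1
  · intro K hK
    refine eventually_forall_of_isCompact hK fun ζ _ => ?_
    have hφ' : Tendsto (fun y : ℕ × (ℂ × ℂ) => φ y.1) (atTop ×ˢ 𝓝 ζ) atTop :=
      hφ.comp tendsto_fst
    have h1 : Tendsto (fun y : ℕ × (ℂ × ℂ) => (D.ψ hd hτ (φ y.1)).symm (slice v y.2))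
        (atTop ×ˢ 𝓝 ζ) (𝓝 p) := D.tendsto_ψ_symm hd hτ hτ0 hφ'
      (((differentiable_slice v).continuous.tendsto ζ).comp tendsto_snd)
    have h2 := tendsto_holDeriv (hr p (mem_of_mem_nhds hW)) h1 (tendsto_clm_apply
      (D.L_tendsto.comp hφ') (tendsto_const_nhds (x := (EuclideanSpace.single 0 1 : Cspace d))))
    rw [ContinuousLinearEquiv.coe_coe, D.holDeriv_eq] at h2
    have h3 := ((continuous_re.tendsto _).comp h2).eventually
      (lt_mem_nhds (a := 0) (by simp))
    filter_upwards [h1.eventually hW, h3] with y h4 h5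
    refine ⟨h4, ?_⟩
    rw [map_smul, smul_eq_mul, fderiv_eq_two_re_holDeriv]
    exact mul_pos (D.ε_pos _) (mul_pos two_pos h5)
  · intro n ζ t
    have h1 : slice v (ζ.1 + t, ζ.2) = slice v ζ + (t : ℂ) • EuclideanSpace.single 0 1 := by
      simp only [slice]
      module
    rw [h1, ψ_symm_add, mul_comm, mul_smul, coe_smul, coe_smul]

end NormalData

lemma circleIntegrable_of_continuous {f : ℂ → ℂ} (hf : Continuous f) (a : ℂ) (ϱ : ℝ) :
    CircleIntegrable f a ϱ := hf.continuousOn.circleIntegrable'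

lemma eq_zero_of_re_mul_le {X : ℂ} {K : ℝ} (h : ∀ w : ℂ, (w * X).re ≤ K) : X = 0 := by
  by_contra hX
  have h1 : 0 < normSq X := normSq_pos.2 hX
  -- This w makes w X equal to |K| + 1.
  have h2 := h (((|K| + 1) / normSq X : ℝ) * starRingEnd ℂ X)
  rw [mul_assoc, mul_comm (starRingEnd ℂ X), mul_conj, re_ofReal_mul, ofReal_re,
    div_mul_cancel₀ _ h1.ne'] at h2
  linarith [le_abs_self K]

/-- If the sub-mean value property is stable under adding real parts of multiples of `f`, then `f`
has the mean value property. -/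
lemma coeff_eq_zero_of_sub_mean {s : Finset (ℕ × ℕ)} {a b : ℕ × ℕ → ℂ}
    (h : ∀ (w z₀ : ℂ) (ϱ : ℝ), 0 < ϱ → (∑ m ∈ s, (a m + w * b m) * monom m z₀).re ≤
      (Real.circleAverage (fun z => ∑ m ∈ s, (a m + w * b m) * monom m z) z₀ ϱ).re) :
    ∀ m ∈ s, 1 ≤ m.1 → 1 ≤ m.2 → b m = 0 := by
  refine coeff_eq_zero_of_mean_value fun z₀ ϱ hϱ => ?_
  have hsum : ∀ w z, ∑ m ∈ s, (a m + w * b m) * monom m z =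
      ∑ m ∈ s, a m * monom m z + w • ∑ m ∈ s, b m * monom m z := by
    intro w z
    rw [smul_eq_mul, Finset.mul_sum, ← Finset.sum_add_distrib]
    exact Finset.sum_congr rfl fun m _ => by ring
  have hb := continuous_sum_monom s b
  -- The inequality bounds Re(w X), with X the mean value defect of the b-part, by the defect of the
  -- a-part, which does not depend on w. Hence X = 0.
  refine (sub_eq_zero.1 (eq_zero_of_re_mul_le (K := (Real.circleAverage (fun z =>
    ∑ m ∈ s, a m * monom m z) z₀ ϱ - ∑ m ∈ s, a m * monom m z₀).re) fun w => ?_)).symm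
  have h1 := h w z₀ ϱ hϱ
  simp only [hsum] at h1
  have h2 : Real.circleAverage (fun z => ∑ m ∈ s, a m * monom m z + w • ∑ m ∈ s, b m * monom m z)
      z₀ ϱ = Real.circleAverage (fun z => ∑ m ∈ s, a m * monom m z) z₀ ϱ +
        w • Real.circleAverage (fun z => ∑ m ∈ s, b m * monom m z) z₀ ϱ := by
    rw [← Real.circleAverage_fun_smul]
    exact Real.circleAverage_fun_add
      (circleIntegrable_of_continuous (continuous_sum_monom s a) _ _)
      (circleIntegrable_of_continuous (hb.const_smul w) _ _)
  rw [h2] at h1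
  rw [mul_sub, sub_re, sub_re]
  simp only [add_re, smul_eq_mul] at h1
  linarith

lemma isSubharmonic_re_sum {s : Finset (ℕ × ℕ)} {a : ℕ × ℕ → ℂ}
    (h : ∀ (z₀ : ℂ) (ϱ : ℝ), 0 < ϱ → (∑ m ∈ s, a m * monom m z₀).re ≤
      (Real.circleAverage (fun z => ∑ m ∈ s, a m * monom m z) z₀ ϱ).re) :
    IsSubharmonic fun z => (∑ m ∈ s, a m * monom m z).re := by
  have hc := continuous_sum_monom s a
  refine ⟨(continuous_re.comp hc).upperSemicontinuous, fun z₀ ϱ hϱ => (h z₀ ϱ hϱ).trans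
    (le_of_eq ?_)⟩
  exact (reCLM.circleAverage_comp_comm (circleIntegrable_of_continuous hc z₀ ϱ)).symm

/-! ### The choice of the scales -/

/-- The normalising function of the scale `t`. -/
noncomputable def scaleFunction (N : ℕ) (a : ℕ × ℕ → ℂ) (b : Fin (d + 1) → ℕ × ℕ → ℂ) (ε t : ℝ) :
    ℝ :=
  ∑ m ∈ mixedIndex N, ‖a m‖ * (t ^ (m.1 + m.2) / ε) +
    ∑ α ∈ starIndex d, ∑ m ∈ mixedIndex N, ‖b α m‖ * (t ^ (m.1 + m.2) / √ε)

/-- The normalising function vanishes at t = 0, as mixed monomials have positive degree, and is at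
least c₀ / ε > 1 at t = 1. Since the solution lies in (0, 1] and the degrees are at most N, it
satisfies c₀ t^N / ε ≤ 1. -/
lemma exists_scale {a : ℕ × ℕ → ℂ} {b : Fin (d + 1) → ℕ × ℕ → ℂ} {ε c₀ : ℝ} (hε : 0 < ε)
    (hc₀ : c₀ ≤ ∑ m ∈ mixedIndex N, ‖a m‖) (hεc : ε < c₀) :
    ∃ t, 0 < t ∧ scaleFunction N a b ε t = 1 ∧ t ^ N ≤ ε / c₀ := by
  have hcont : Continuous (scaleFunction N a b ε) := by
    unfold scaleFunction
    fun_prop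
  have hsq : 0 < √ε := Real.sqrt_pos.2 hε
  have h0 : scaleFunction N a b ε 0 = 0 := by
    have : ∀ m ∈ mixedIndex N, (0 : ℝ) ^ (m.1 + m.2) = 0 := fun m hm => by
      rw [mem_mixedIndex] at hm
      exact zero_pow (by omega)
    rw [scaleFunction, Finset.sum_eq_zero fun m hm => by rw [this m hm]; simp,
      Finset.sum_eq_zero fun α _ => Finset.sum_eq_zero fun m hm => by rw [this m hm]; simp, add_zero]
  have hnn : ∀ t, 0 ≤ t → 0 ≤ ∑ α ∈ starIndex d, ∑ m ∈ mixedIndex N,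
      ‖b α m‖ * (t ^ (m.1 + m.2) / √ε) := fun t ht =>
    Finset.sum_nonneg fun α _ => Finset.sum_nonneg fun m _ => by positivity
  have h1 : 1 ≤ scaleFunction N a b ε 1 := by
    have h2 := hnn 1 zero_le_one
    have h3 : 1 ≤ ∑ m ∈ mixedIndex N, ‖a m‖ * ((1 : ℝ) ^ (m.1 + m.2) / ε) := by
      simp only [one_pow]
      rw [← Finset.sum_mul, mul_one_div, le_div_iff₀ hε]
      linarith
    exact h3.trans (le_add_of_nonneg_right h2)
  obtain ⟨t, ht, htv⟩ := intermediate_value_Icc zero_le_one hcont.continuousOn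
    (show (1 : ℝ) ∈ Icc (scaleFunction N a b ε 0) (scaleFunction N a b ε 1) from
      ⟨by rw [h0]; exact zero_le_one, h1⟩)
  have ht0 : 0 < t := by
    refine lt_of_le_of_ne ht.1 ?_
    rintro rfl
    rw [h0] at htv
    exact zero_ne_one htv
  refine ⟨t, ht0, htv, ?_⟩
  have hc : 0 < c₀ := hε.trans hεc
  rw [le_div_iff₀ hc, mul_comm]
  have h4 : c₀ * (t ^ N / ε) ≤ 1 := by
    rw [← htv]
    calc c₀ * (t ^ N / ε) ≤ (∑ m ∈ mixedIndex N, ‖a m‖) * (t ^ N / ε) := by gcongr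
      _ ≤ ∑ m ∈ mixedIndex N, ‖a m‖ * (t ^ (m.1 + m.2) / ε) := by
          rw [Finset.sum_mul]
          refine Finset.sum_le_sum fun m hm => ?_
          rw [mem_mixedIndex] at hm
          have := pow_le_pow_of_le_one ht0.le ht.2 hm.1
          gcongr
      _ ≤ _ := le_add_of_nonneg_right (hnn t ht0.le)
  rw [← mul_div_assoc, div_le_one hε] at h4
  exact h4

/-- The bound τ^N ≤ ε / c₀ gives both limits: τ → 0, and τ^(N+1) / ε ≤ τ / c₀. The case N = 0 is
excluded because the sum of mixed coefficients would be empty. -/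
lemma NormalData.exists_scales (D : NormalData N r p u) {c₀ : ℝ} (hc₀ : 0 < c₀)
    (hlow : ∀ᶠ n in atTop, c₀ ≤ ∑ m ∈ mixedIndex N, ‖D.a n m‖) :
    ∃ τ : ℕ → ℝ, (∀ n, 0 < τ n) ∧ Tendsto τ atTop (𝓝 0) ∧
      Tendsto (fun n => τ n ^ (N + 1) / D.ε n) atTop (𝓝 0) ∧
      ∀ᶠ n in atTop, scaleFunction N (D.a n) (D.b n) (D.ε n) (τ n) = 1 := by
  have hN : N ≠ 0 := by
    rintro rfl
    obtain ⟨n, hn⟩ := hlow.exists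
    have : mixedIndex 0 = ∅ := by
      ext m
      rw [mem_mixedIndex]
      simp only [Finset.notMem_empty, iff_false]
      omega
    rw [this, Finset.sum_empty] at hn
    linarith
  have H : ∀ n, ∃ t, 0 < t ∧ ((c₀ ≤ ∑ m ∈ mixedIndex N, ‖D.a n m‖ ∧ D.ε n < c₀) →
      scaleFunction N (D.a n) (D.b n) (D.ε n) t = 1 ∧ t ^ N ≤ D.ε n / c₀) := by
    intro n
    by_cases hn : c₀ ≤ ∑ m ∈ mixedIndex N, ‖D.a n m‖ ∧ D.ε n < c₀
    · obtain ⟨t, h1, h2, h3⟩ := exists_scale (b := D.b n) (D.ε_pos n) hn.1 hn.2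
      exact ⟨t, h1, fun _ => ⟨h2, h3⟩⟩
    · exact ⟨1, one_pos, fun h => absurd h hn⟩
  choose τ hτ h1 using H
  have hgood : ∀ᶠ n in atTop, scaleFunction N (D.a n) (D.b n) (D.ε n) (τ n) = 1 ∧
      τ n ^ N ≤ D.ε n / c₀ := by
    filter_upwards [hlow, D.ε_tendsto.eventually (gt_mem_nhds hc₀)] with n h2 h3
    exact h1 n ⟨h2, h3⟩
  have hε : Tendsto (fun n => D.ε n / c₀) atTop (𝓝 0) := by
    simpa using D.ε_tendsto.div_const c₀
  have hτ0 : Tendsto τ atTop (𝓝 0) := by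
    rw [Metric.tendsto_nhds]
    intro s hs
    filter_upwards [hgood, hε.eventually (gt_mem_nhds (pow_pos hs N))] with n h2 h3
    rw [dist_zero_right, Real.norm_of_nonneg (hτ n).le]
    exact lt_of_pow_lt_pow_left₀ N hs.le (h2.2.trans_lt h3)
  refine ⟨τ, hτ, hτ0, ?_, hgood.mono fun n hn => hn.1⟩
  refine squeeze_zero' (Eventually.of_forall fun n => ?_) ?_
    (show Tendsto (fun n => τ n / c₀) atTop (𝓝 0) by simpa using hτ0.div_const c₀)
  · have := hτ n
    have := D.ε_pos n
    positivity
  · filter_upwards [hgood] with n hn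
    have h2 := D.ε_pos n
    rw [div_le_iff₀ h2, pow_succ]
    calc τ n ^ N * τ n ≤ D.ε n / c₀ * τ n := mul_le_mul_of_nonneg_right hn.2 (hτ n).le
      _ = τ n / c₀ * D.ε n := by ring

/-- A subsequence along which the normalised coefficients converge. -/
lemma NormalData.exists_subseq (D : NormalData N r p u) {τ : ℕ → ℝ} (hτ : ∀ n, 0 < τ n)
    (hscale : ∀ᶠ n in atTop, scaleFunction N (D.a n) (D.b n) (D.ε n) (τ n) = 1) {φ : ℕ → ℕ}
    (hφ : Tendsto φ atTop atTop) :
    ∃ φ' : ℕ → ℕ, StrictMono φ' ∧ ∃ (a : ℕ × ℕ → ℂ) (b : Fin (d + 1) → ℕ × ℕ → ℂ),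
      (∀ m ∉ mixedIndex N, a m = 0) ∧
      (∀ m ∈ mixedIndex N, Tendsto (fun n => D.a (φ (φ' n)) m *
        ((τ (φ (φ' n)) ^ (m.1 + m.2) / D.ε (φ (φ' n)) : ℝ) : ℂ)) atTop (𝓝 (a m))) ∧
      (∀ α ∈ starIndex d, ∀ m ∈ mixedIndex N, Tendsto (fun n => D.b (φ (φ' n)) α m *
        ((τ (φ (φ' n)) ^ (m.1 + m.2) / √(D.ε (φ (φ' n))) : ℝ) : ℂ)) atTop (𝓝 (b α m))) ∧
      ∑ m ∈ mixedIndex N, ‖a m‖ + ∑ α ∈ starIndex d, ∑ m ∈ mixedIndex N, ‖b α m‖ = 1 := by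
  classical
  set A : ℕ → ℕ × ℕ → ℂ := fun n m => D.a n m * ((τ n ^ (m.1 + m.2) / D.ε n : ℝ) : ℂ) with hA
  set B : ℕ → Fin (d + 1) → ℕ × ℕ → ℂ := fun n α m =>
    D.b n α m * ((τ n ^ (m.1 + m.2) / √(D.ε n) : ℝ) : ℂ) with hB
  have hsum : ∀ n, scaleFunction N (D.a n) (D.b n) (D.ε n) (τ n) =
      ∑ m ∈ mixedIndex N, ‖A n m‖ + ∑ α ∈ starIndex d, ∑ m ∈ mixedIndex N, ‖B n α m‖ := by
    intro n
    have h1 := D.ε_pos n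
    have h2 := hτ n
    have h3 : 0 < √(D.ε n) := Real.sqrt_pos.2 h1
    have h4 : ∀ m : ℕ × ℕ, 0 ≤ τ n ^ (m.1 + m.2) / D.ε n := fun m => by positivity
    have h5 : ∀ m : ℕ × ℕ, 0 ≤ τ n ^ (m.1 + m.2) / √(D.ε n) := fun m => by positivity
    simp only [hA, hB, norm_mul, norm_real, Real.norm_of_nonneg (h4 _),
      Real.norm_of_nonneg (h5 _), scaleFunction]
  -- The rescaled coefficients are restricted to the finite index sets, giving points of the unit
  -- ball of a finite-dimensional space. Limits are later extended by zero so that a is finitely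
  -- supported.
  let X : ℕ → (↥(mixedIndex N) → ℂ) × (↥(starIndex d) → ↥(mixedIndex N) → ℂ) := fun n =>
    (fun m => A n m, fun α m => B n α m)
  have hX : ∀ᶠ n in atTop, X n ∈ Metric.closedBall
      (0 : (↥(mixedIndex N) → ℂ) × (↥(starIndex d) → ↥(mixedIndex N) → ℂ)) 1 := by
    filter_upwards [hscale] with n hn
    rw [hsum] at hn
    have hA0 : 0 ≤ ∑ m ∈ mixedIndex N, ‖A n m‖ := Finset.sum_nonneg fun m _ => norm_nonneg _
    have hB0 : ∀ α, 0 ≤ ∑ m ∈ mixedIndex N, ‖B n α m‖ := fun α =>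
      Finset.sum_nonneg fun m _ => norm_nonneg _
    have hB1 : 0 ≤ ∑ α ∈ starIndex d, ∑ m ∈ mixedIndex N, ‖B n α m‖ :=
      Finset.sum_nonneg fun α _ => hB0 α
    rw [mem_closedBall_zero_iff, Prod.norm_def, max_le_iff, pi_norm_le_iff_of_nonneg zero_le_one,
      pi_norm_le_iff_of_nonneg zero_le_one]
    refine ⟨fun m => ?_, fun α => ?_⟩
    · have := Finset.single_le_sum (f := fun m => ‖A n m‖) (fun m _ => norm_nonneg _) m.2
      simp only [X]
      linarith
    · rw [pi_norm_le_iff_of_nonneg zero_le_one]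
      intro m
      have h1 := Finset.single_le_sum (f := fun m => ‖B n α m‖) (fun m _ => norm_nonneg _) m.2
      have h2 := Finset.single_le_sum (f := fun α => ∑ m ∈ mixedIndex N, ‖B n α m‖)
        (fun α _ => hB0 α) α.2
      simp only [X]
      linarith
  obtain ⟨x, -, φ', hφ', hlim⟩ := tendsto_subseq_of_frequently_bounded
    (x := fun n => X (φ n)) Metric.isBounded_closedBall (hφ.eventually hX).frequently
  have hlimA : ∀ m : ↥(mixedIndex N), Tendsto (fun n => A (φ (φ' n)) m) atTop (𝓝 (x.1 m)) :=
    fun m => tendsto_pi_nhds.1 ((continuous_fst.tendsto x).comp hlim) m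
  have hlimB : ∀ (α : ↥(starIndex d)) (m : ↥(mixedIndex N)),
      Tendsto (fun n => B (φ (φ' n)) α m) atTop (𝓝 (x.2 α m)) :=
    fun α m => tendsto_pi_nhds.1 (tendsto_pi_nhds.1 ((continuous_snd.tendsto x).comp hlim) α) m
  let a : ℕ × ℕ → ℂ := fun m => if hm : m ∈ mixedIndex N then x.1 ⟨m, hm⟩ else 0
  let b : Fin (d + 1) → ℕ × ℕ → ℂ := fun α m => if hα : α ∈ starIndex d then
    if hm : m ∈ mixedIndex N then x.2 ⟨α, hα⟩ ⟨m, hm⟩ else 0 else 0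
  have ha : ∀ m ∈ mixedIndex N, Tendsto (fun n => A (φ (φ' n)) m) atTop (𝓝 (a m)) := by
    intro m hm
    simp only [a, dif_pos hm]
    exact hlimA ⟨m, hm⟩
  have hb : ∀ α ∈ starIndex d, ∀ m ∈ mixedIndex N,
      Tendsto (fun n => B (φ (φ' n)) α m) atTop (𝓝 (b α m)) := by
    intro α hα m hm
    simp only [b, dif_pos hα, dif_pos hm]
    exact hlimB ⟨α, hα⟩ ⟨m, hm⟩
  refine ⟨φ', hφ', a, b, fun m hm => dif_neg hm, ha, hb, ?_⟩
  have h1 := (tendsto_finsetSum (mixedIndex N) fun m hm => (ha m hm).norm).add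
    (tendsto_finsetSum (starIndex d) fun α hα =>
      tendsto_finsetSum (mixedIndex N) fun m hm => (hb α hα m hm).norm)
  refine tendsto_nhds_unique h1 (tendsto_const_nhds.congr' ?_)
  filter_upwards [(hφ.comp hφ'.tendsto_atTop).eventually hscale] with n hn
  rw [← hn]
  exact hsum _

end

section

variable {d N : ℕ} {r : Cspace d → ℝ} {p : Cspace d} {u : ℕ → Cspace d}

/-! ### Model polynomials -/

lemma polyValue_onFinset (s : Finset (ℕ × ℕ)) (a : ℕ × ℕ → ℂ) (h : ∀ m, a m ≠ 0 → m ∈ s) (ζ : ℂ) :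
    polyValue (Finsupp.onFinset s a h) ζ = ∑ m ∈ s, a m * monom m ζ := by
  rw [polyValue, Finsupp.onFinset_sum h (fun m => by simp)]
  exact Finset.sum_congr rfl fun m _ => by rw [monom, mul_assoc]

lemma isModelPolynomial_onFinset {a : ℕ × ℕ → ℂ} (h : ∀ m, a m ≠ 0 → m ∈ mixedIndex N)
    (him : ∀ z, (∑ m ∈ mixedIndex N, a m * monom m z).im = 0)
    (hsub : IsSubharmonic fun z => (∑ m ∈ mixedIndex N, a m * monom m z).re) :
    IsModelPolynomial (Finsupp.onFinset (mixedIndex N) a h)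
      fun z => (∑ m ∈ mixedIndex N, a m * monom m z).re where
  eq_polyValue ζ := by
    rw [polyValue_onFinset]
    exact Complex.ext (ofReal_re _) (by rw [ofReal_im, him])
  subharmonic := hsub
  no_harmonic_terms j hj := by
    constructor <;> by_contra hne <;> have hm := h _ hne <;> rw [mem_mixedIndex] at hm <;> omega
  map_zero := by
    rw [Finset.sum_eq_zero, zero_re]
    intro m hm
    rw [mem_mixedIndex] at hm
    rw [monom, zero_pow (by omega), zero_mul, mul_zero]

lemma exists_sum_monom_ne_zero {s : Finset (ℕ × ℕ)} {a : ℕ × ℕ → ℂ} {m : ℕ × ℕ} (hm : m ∈ s)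
    (ha : a m ≠ 0) : ∃ z, ∑ m ∈ s, a m * monom m z ≠ 0 := by
  by_contra! hcon
  refine ha (jet_coeff_eq_zero (k := m.1 + m.2) ?_ m hm le_rfl)
  simp only [hcon]
  exact Asymptotics.isBigO_zero _ _

/-- The limit polynomial is the limit of rescaled values of the real function r along the curves, so
no symmetry of the coefficients has to be tracked. -/
lemma NormalData.limit_im_eq_zero (D : NormalData N r p u) {τ : ℕ → ℝ} (hτ : ∀ n, 0 < τ n)
    (hτ0 : Tendsto τ atTop (𝓝 0))
    (hτN : Tendsto (fun n => τ n ^ (N + 1) / D.ε n) atTop (𝓝 0)) {φ : ℕ → ℕ}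
    (hφ : Tendsto φ atTop atTop) {a : ℕ × ℕ → ℂ}
    (ha : ∀ m ∈ mixedIndex N, Tendsto (fun n =>
      D.a (φ n) m * ((τ (φ n) ^ (m.1 + m.2) / D.ε (φ n) : ℝ) : ℂ)) atTop (𝓝 (a m))) (z : ℂ) :
    (∑ m ∈ mixedIndex N, a m * monom m z).im = 0 := by
  have h1 := tendsto_jet (fun n => D.ε_pos (φ n)) (fun n => hτ (φ n)) (hτ0.comp hφ)
    (hτN.comp hφ) ha D.δ_pos (hφ.eventually D.jet) (tendsto_const_nhds (x := z))
  have h2 := (continuous_im.tendsto _).comp h1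
  refine tendsto_nhds_unique h2 (tendsto_const_nhds.congr fun n => ?_)
  simp only [Function.comp]
  rw [← ofReal_div, ofReal_im]

lemma limitFunction_eq_modelFunction {a : ℕ × ℕ → ℂ} {b : Fin (d + 1) → ℕ × ℕ → ℂ}
    (hb : ∀ α ∈ starIndex d, ∀ m ∈ mixedIndex N, b α m = 0) :
    limitFunction N a b = modelFunction fun z => (∑ m ∈ mixedIndex N, a m * monom m z).re := by
  funext ζ
  rw [limitFunction, modelFunction, Finset.sum_eq_zero (s := starIndex d) (f := fun α =>
    ζ α * ∑ m ∈ mixedIndex N, b α m * monom m (ζ 1)), zero_re, mul_zero, add_zero]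
  intro α hα
  rw [Finset.sum_eq_zero fun m hm => by rw [hb α hα m hm, zero_mul], mul_zero]

/-- Scalings with the zero model polynomial. -/
theorem exists_scaling_zero (hd : 1 ≤ d) {W : Set (Cspace d)} (hW : W ∈ 𝓝 p)
    (hr : ContDiffAt ℝ 2 r p) (D : NormalData 1 r p u) :
    ∃ (ψ : ℕ → Cspace d ≃ Cspace d) (ε : ℕ → ℝ) (c : ℕ × ℕ →₀ ℂ) (P : ℂ → ℝ),
      IsScaling W u ψ ε ∧ IsModelPolynomial c P ∧
      TendstoLocallyUniformly (fun n => rescaled r (ψ n) (ε n)) (modelFunction P) atTop := by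
  have hempty : mixedIndex 1 = ∅ := by
    ext m
    rw [mem_mixedIndex]
    simp only [Finset.notMem_empty, iff_false]
    omega
  have hnot : ∀ m, m ∉ mixedIndex 1 := by simp [hempty]
  -- With N = 1 there is no mixed monomial, and τ = ε is small enough for the quadratic remainder to
  -- vanish after division by ε.
  have hτN : Tendsto (fun n => D.ε n ^ (1 + 1) / D.ε n) atTop (𝓝 0) := by
    refine D.ε_tendsto.congr fun n => ?_
    have := (D.ε_pos n).ne'
    field_simp
  have h0 : (fun z : ℂ => (∑ m ∈ mixedIndex 1, (0 : ℕ × ℕ → ℂ) m * monom m z).re) = fun _ => 0 := by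
    simp
  refine ⟨D.ψ hd D.ε_pos, D.ε, Finsupp.onFinset (mixedIndex 1) 0 (by simp), _,
    D.isScaling hd D.ε_pos D.ε_tendsto hW,
    isModelPolynomial_onFinset (by simp) (by simp) ?_, ?_⟩
  · rw [h0]
    refine ⟨continuous_const.upperSemicontinuous, fun a ϱ _ => ?_⟩
    rw [Real.circleAverage_const]
  · rw [← limitFunction_eq_modelFunction (b := 0) (by simp)]
    exact D.tendstoLocallyUniformly_rescaled hd hr D.ε_pos D.ε_tendsto hτN tendsto_id
      (fun m hm => absurd hm (hnot m)) (fun α _ m hm => absurd hm (hnot m))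

/-- Scalings with nonzero model polynomials. -/
theorem exists_scaling_ne_zero (hd : 1 ≤ d) {W : Set (Cspace d)} (hW : W ∈ 𝓝 p)
    (hr : ∀ x ∈ W, ContDiffAt ℝ 2 r x)
    (hlevi : ∀ x ∈ W, r x = 0 → ∀ X, holDeriv r x X = 0 → 0 ≤ (leviH r x X X).re)
    (D : NormalData N r p u) (hNT : (N : ℝ≥0∞) ≤ dAngeloType r p)
    (hTN : dAngeloType r p < (N + 1 : ℕ)) :
    ∃ (ψ : ℕ → Cspace d ≃ Cspace d) (ε : ℕ → ℝ), IsScaling W u ψ ε ∧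
      ∀ φ : ℕ → ℕ, StrictMono φ → ∃ φ' : ℕ → ℕ, StrictMono φ' ∧
        ∃ (c : ℕ × ℕ →₀ ℂ) (P : ℂ → ℝ), IsModelPolynomial c P ∧ (∃ ζ, P ζ ≠ 0) ∧
          (∀ m ∈ c.support, ((m.1 + m.2 : ℕ) : ℝ≥0∞) ≤ dAngeloType r p) ∧
          TendstoLocallyUniformly
            (fun n => rescaled r (ψ (φ (φ' n))) (ε (φ (φ' n)))) (modelFunction P) atTop := by
  have hcont : ∀ᶠ x in 𝓝 p, ContinuousAt r x := by
    filter_upwards [hW] with x hx using (hr x hx).continuousAt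
  obtain ⟨c₀, hc₀, hlow⟩ := D.exists_coeff_lower_bound hcont hTN
  obtain ⟨τ, hτ, hτ0, hτN, hscale⟩ := D.exists_scales hc₀ hlow
  refine ⟨D.ψ hd hτ, D.ε, D.isScaling hd hτ hτ0 hW, fun φ hφ => ?_⟩
  obtain ⟨φ', hφ', a, b, ha0, ha, hb, hsum⟩ := D.exists_subseq hτ hscale hφ.tendsto_atTop
  have hσ : Tendsto (fun n => φ (φ' n)) atTop atTop := (hφ.comp hφ').tendsto_atTop
  have hlim := D.tendstoLocallyUniformly_rescaled hd (hr p (mem_of_mem_nhds hW)) hτ hτ0 hτN hσ ha hb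
  have hmean := D.sub_mean_limit hd hW hr hlevi hτ hτ0 hσ hlim
  have hb0 : ∀ α ∈ starIndex d, ∀ m ∈ mixedIndex N, b α m = 0 := by
    intro α hα m hm
    have hm' := mem_mixedIndex.1 hm
    refine coeff_eq_zero_of_sub_mean (s := mixedIndex N) (a := a) (b := b α)
      (fun w z₀ ϱ hϱ => ?_) m hm hm'.2.1 hm'.2.2
    -- The half compensates the factor 2 in front of the cross terms, so that w multiplies b α
    -- alone.
    have h1 := hmean (EuclideanSpace.single α (w / 2)) z₀ hϱ
    have h2 : ∀ m, 2 * ∑ β ∈ starIndex d,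
        (EuclideanSpace.single α (w / 2) : Cspace d) β * b β m = w * b α m := by
      intro m
      rw [Finset.sum_eq_single_of_mem α hα fun β _ hβ => by simp [hβ]]
      simp
      ring
    simpa only [h2] using h1
  have hsub : IsSubharmonic fun z => (∑ m ∈ mixedIndex N, a m * monom m z).re := by
    refine isSubharmonic_re_sum fun z₀ ϱ hϱ => ?_
    simpa using hmean 0 z₀ hϱ
  have hmem : ∀ m, a m ≠ 0 → m ∈ mixedIndex N := fun m hm => by
    by_contra h
    exact hm (ha0 m h)
  have him := D.limit_im_eq_zero hτ hτ0 hτN hσ ha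
  refine ⟨φ', hφ', Finsupp.onFinset (mixedIndex N) a hmem, _,
    isModelPolynomial_onFinset hmem him hsub, ?_, fun m hm => ?_, ?_⟩
  -- The limits have total norm 1 and the b-part is zero, so the a-part cannot vanish.
  · obtain ⟨m, hm, hne⟩ : ∃ m ∈ mixedIndex N, a m ≠ 0 := by
      by_contra! hcon
      rw [Finset.sum_eq_zero fun m hm => by rw [hcon m hm, norm_zero],
        Finset.sum_eq_zero fun α hα => Finset.sum_eq_zero fun m hm => by
          rw [hb0 α hα m hm, norm_zero], add_zero] at hsum
      exact zero_ne_one hsum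
    obtain ⟨z, hz⟩ := exists_sum_monom_ne_zero hm hne
    exact ⟨z, fun h => hz (Complex.ext h (him z))⟩
  · have h1 := mem_mixedIndex.1 (hmem m (by simpa using hm))
    exact le_trans (by exact_mod_cast h1.1) hNT
  · rw [← limitFunction_eq_modelFunction hb0]
    exact hlim

lemma exists_nat_le_lt {T : ℝ≥0∞} (hT : T < ⊤) : ∃ N : ℕ, (N : ℝ≥0∞) ≤ T ∧ T < (N + 1 : ℕ) := by
  lift T to NNReal using hT.ne
  refine ⟨⌊T⌋₊, ?_, ?_⟩
  · exact_mod_cast Nat.floor_le T.2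
  · exact_mod_cast Nat.lt_floor_add_one T

end

end CorankOne

open CorankOne in
theorem mainTheorem4 {d : ℕ} (hd : 1 ≤ d) (Ω : Set (Cspace d))
    (hopen : IsOpen Ω) (hconn : IsConnected Ω) (hbdd : Bornology.IsBounded Ω)
    (hsmooth : HasSmoothBoundary Ω) (hpsc : IsPseudoconvex Ω) (htype : IsOfFiniteType Ω)
    (hrank : HasLeviCorankAtMostOne Ω)
    (u : ℕ → Cspace d) (hu : ∀ n, u n ∈ Ω) (p : Cspace d) (hp : p ∈ frontier Ω)
    (hup : Tendsto u atTop (𝓝 p))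
    (W : Set (Cspace d)) (r : Cspace d → ℝ) (hpW : p ∈ W) (hr : IsDefiningFunctionOn Ω W r) :
    (∃ (ψ : ℕ → Cspace d ≃ Cspace d) (ε : ℕ → ℝ) (c : ℕ × ℕ →₀ ℂ) (P : ℂ → ℝ),
      IsScaling W u ψ ε ∧ IsModelPolynomial c P ∧
      TendstoLocallyUniformly (fun n => rescaled r (ψ n) (ε n)) (modelFunction P) atTop) ∧
    (∃ (ψ : ℕ → Cspace d ≃ Cspace d) (ε : ℕ → ℝ), IsScaling W u ψ ε ∧
      ∀ φ : ℕ → ℕ, StrictMono φ → ∃ φ' : ℕ → ℕ, StrictMono φ' ∧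
        ∃ (c : ℕ × ℕ →₀ ℂ) (P : ℂ → ℝ), IsModelPolynomial c P ∧ (∃ ζ, P ζ ≠ 0) ∧
          (∀ m ∈ c.support, ((m.1 + m.2 : ℕ) : ℝ≥0∞) ≤ dAngeloType r p) ∧
          TendstoLocallyUniformly
            (fun n => rescaled r (ψ (φ (φ' n))) (ε (φ (φ' n)))) (modelFunction P) atTop) := by
  have hW : W ∈ 𝓝 p := hr.isOpen.mem_nhds hpW
  obtain ⟨D₁⟩ := nonempty_normalData hd hopen hpsc hrank hu hp hup hpW hr 1
  -- N is the integer part of the type: N ≤ type bounds the degree of the limit, and type < N + 1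
  -- forbids the mixed coefficients up to order N from degenerating.
  obtain ⟨N, hN, hN'⟩ := exists_nat_le_lt (htype W r hr p ⟨hp, hpW⟩)
  obtain ⟨D⟩ := nonempty_normalData hd hopen hpsc hrank hu hp hup hpW hr N
  exact ⟨exists_scaling_zero hd hW (hr.contDiffAt hpW 2) D₁,
    exists_scaling_ne_zero hd hW (fun x hx => hr.contDiffAt hx 2)
      (fun x hx h0 X hX => hpsc.leviH_nonneg hr hx h0 X hX) D hN hN'⟩
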